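/- Let $T>1$, $E(T)=\cot^2\!\big(\frac{\pi}{4T}\big)$, $c(T)=\cos\frac{\pi}{T}$, and $m(x)=2\,\frac{\cos(\pi x/T)-c(T)}{1-c(T)}-1$. For $\rho>1$ let $\mathcal D(\rho)=\{x\in\mathbb C: |\operatorname{Re}x|\le T,\ m(x)\in\overline{B}(\rho)\}$, where $\overline B(\rho)$ is the compact region bounded by the Bernstein ellipse $\mathcal B(\rho)=\{\frac12(\rho^{-1}e^{i\theta}+\rho e^{-i\theta}):\theta\in[-\pi,\pi]\}$. Let $\|\cdot\|$ denote the norm of $L^2(-1,1)$ for functions and the Euclidean norm for vectors. Continuous Fourier extension: for $f\in L^2(-1,1)$ and $N\ge 0$ its coefficient vector is the $a=(a_{-N},\dots,a_N)\in\mathbb C^{2N+1}$ for which $\sum_{|n|\le N}a_n\phi_n$, with $\phi_n(x)=\frac1{\sqrt{2T}}e^{i n\pi x/T}$, minimizes $\|f-\phi\|$ over $\phi\in\operatorname{span}\{\phi_n:|n|\le N\}$. Discrete Fourier extension: let $x_n=-x_{-n-1}=\frac{T}{\pi}\arccos\!\big[\frac12(1-c(T))\cos\frac{(2n+1)\pi}{2N+2}+\frac12(1+c(T))\big]$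 for $n=0,\dots,N$. The coefficient vector of $f$ is the $a=(a_{-N-1},\dots,a_N)\in\mathbb C^{2N+2}$ for which $\phi(x)=\sum_{n=0}^{N}\big(a_n\cos\frac{n\pi x}{T}+a_{-n-1}\sin\frac{(n+1)\pi x}{T}\big)$ minimizes $\sum_{n=-N-1}^{N}|f(x_n)-\phi(x_n)|^2$. (i) For every $\rho^*>1$ there is a constant $C>0$, depending only on $T$ and $\rho^*$, such that for every $f$ that is continuous on $\mathcal D(\rho^*)$ and analytic in its interior, with $c_f=C\max_{x\in\mathcal D(\rho)}|f(x)|$ and $\rho=\min\{\rho^*,E(T)\}$, the coefficient vector $a$ of the continuous Fourier extension of $f|_{[-1,1]}$ satisfies $$\|a\|\le c_f\Big(\frac{E(T)}{\rho^*}\Big)^{N}\ (N\ge 0)\quad\text{if }\rho^*<E(T),\qquad \|a\|\le c_f\,N\ (N\ge 1)\quad\text{if }\rho^*\ge E(T).$$ (ii) Under the same hypotheses, the coefficient vector of the discrete Fourier extension of $f|_{[-1,1]}$ satisfies the same two bounds. (iii) There is a constant $c>0$, depending only on $T$, such that for all $f\in L^2(-1,1)$ and $N\ge 0$ the coefficient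 vector $a$ of the continuous Fourier extension of $f$ satisfies $\|a\|\le c\,\|f\|\,E(T)^N$. -/

import Mathlib

namespace FourierExtension

noncomputable section

/-- The Fourier extension constant `E(T) = cot² (π / (4 T))`. -/
def E (T : ℝ) : ℝ := Real.cot (Real.pi / (4 * T)) ^ 2

/-- The constant `c(T) = cos (π / T)`. -/
def c (T : ℝ) : ℝ := Real.cos (Real.pi / T)

/-- The map `x ↦ z = m(x) = 2 (cos (π x / T) - c(T)) / (1 - c(T)) - 1`, for complex `x`. -/
def m (T : ℝ) (x : ℂ) : ℂ :=
  2 * (Complex.cos (Real.pi / T * x) - c T) / (1 - c T) - 1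

/-- The Bernstein ellipse `{ (ρ⁻¹ e^{iθ} + ρ e^{-iθ}) / 2 : θ ∈ [-π, π] }` (a curve). -/
def bernsteinEllipse (ρ : ℝ) : Set ℂ :=
  (fun θ : ℝ => 1 / 2 * ((ρ : ℂ)⁻¹ * Complex.exp (Complex.I * θ)
    + (ρ : ℂ) * Complex.exp (-(Complex.I * θ)))) '' Set.Icc (-Real.pi) Real.pi

/-- The compact region bounded by the Bernstein ellipse of index `ρ ≥ 1`. The ellipse has foci
`±1` and major axis of length `ρ + ρ⁻¹`. -/
def bernsteinRegion (ρ : ℝ) : Set ℂ := {z | ‖z - 1‖ + ‖z + 1‖ ≤ ρ + ρ⁻¹}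

/-- The Bernstein ellipse is exactly the bounding curve of `bernsteinRegion`. -/
theorem mem_bernsteinEllipse_iff {ρ : ℝ} (hρ : 1 ≤ ρ) (z : ℂ) :
    z ∈ bernsteinEllipse ρ ↔ ‖z - 1‖ + ‖z + 1‖ = ρ + ρ⁻¹ := by
  have key : ∀ w : ℂ, w ≠ 0 → ‖1 / 2 * (w⁻¹ + w) - 1‖ + ‖1 / 2 * (w⁻¹ + w) + 1‖
      = ‖w‖ + ‖w‖⁻¹ := by
    intro w hw
    have hn : ‖w‖ ≠ 0 := norm_ne_zero_iff.mpr hw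
    have e1 : 1 / 2 * (w⁻¹ + w) - 1 = (w - 1) ^ 2 / (2 * w) := by field_simp; ring
    have e2 : 1 / 2 * (w⁻¹ + w) + 1 = (w + 1) ^ 2 / (2 * w) := by field_simp; ring
    have h2 : ‖(2 : ℂ)‖ = 2 := by simp
    have hp := parallelogram_law_with_norm ℝ w 1
    rw [norm_one] at hp
    rw [e1, e2, norm_div, norm_div, norm_pow, norm_pow, norm_mul, h2]
    field_simp
    nlinarith [hp]
  have hρ0 : 0 < ρ := by linarith
  have hρc : (ρ : ℂ) ≠ 0 := by exact_mod_cast hρ0.ne'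
  constructor
  · rintro ⟨θ, -, rfl⟩
    have hw : (ρ : ℂ) * Complex.exp (-(Complex.I * θ)) ≠ 0 :=
      mul_ne_zero hρc (Complex.exp_ne_zero _)
    have hnorm : ‖(ρ : ℂ) * Complex.exp (-(Complex.I * θ))‖ = ρ := by
      rw [norm_mul, Complex.norm_exp]
      simp [abs_of_pos hρ0]
    have h := key _ hw
    rw [hnorm, mul_inv, ← Complex.exp_neg, neg_neg] at h
    exact h
  · intro hz
    obtain ⟨s, hs⟩ := IsAlgClosed.exists_pow_nat_eq (z ^ 2 - 1) (n := 2) (by norm_num)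
    have hmul : (z + s) * (z - s) = 1 := by linear_combination -hs
    obtain ⟨w, hw, rfl⟩ : ∃ w : ℂ, w ≠ 0 ∧ z = 1 / 2 * (w⁻¹ + w) := by
      refine ⟨z + s, left_ne_zero_of_mul_eq_one hmul, ?_⟩
      rw [inv_eq_of_mul_eq_one_right hmul]
      ring
    rw [key w hw] at hz
    have hn : 0 < ‖w‖ := norm_pos_iff.mpr hw
    have hfac : (‖w‖ - ρ) * (‖w‖ * ρ - 1) = 0 := by
      field_simp at hz
      nlinarith [hz]
    have hpolar := Complex.norm_mul_exp_arg_mul_I w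
    have hI := Complex.arg_mem_Ioc w
    rcases mul_eq_zero.mp hfac with h | h
    · have hr : ‖w‖ = ρ := by linarith
      rw [hr] at hpolar
      refine ⟨-w.arg, ⟨by linarith [hI.2], by linarith [hI.1]⟩, ?_⟩
      have e : (ρ : ℂ) * Complex.exp (-(Complex.I * ((-w.arg : ℝ) : ℂ))) = w := by
        conv_rhs => rw [← hpolar]
        push_cast
        congr 2
        ring
      have e' : (ρ : ℂ)⁻¹ * Complex.exp (Complex.I * ((-w.arg : ℝ) : ℂ)) = w⁻¹ := by
        have h' := congrArg Inv.inv e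
        rwa [mul_inv, ← Complex.exp_neg, neg_neg] at h'
      simp only [e, e']
    · have hr : ‖w‖ = ρ⁻¹ := eq_inv_of_mul_eq_one_left (by linarith)
      rw [hr] at hpolar
      refine ⟨w.arg, ⟨hI.1.le, hI.2⟩, ?_⟩
      have e : (ρ : ℂ)⁻¹ * Complex.exp (Complex.I * (w.arg : ℂ)) = w := by
        conv_rhs => rw [← hpolar]
        push_cast
        rw [mul_comm Complex.I]
      have e' : (ρ : ℂ) * Complex.exp (-(Complex.I * (w.arg : ℂ))) = w⁻¹ := by
        have h' := congrArg Inv.inv e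
        rwa [mul_inv, inv_inv, ← Complex.exp_neg] at h'
      simp only [e, e', add_comm]

/-- The mapped Bernstein region `𝒟(ρ)`: the image of the region bounded by the Bernstein ellipse
of index `ρ` under the (two-valued, symmetric) inverse of `m` around the interval `[-1, 1]`. The
map `m` is even and has period `2 T`, so the inverse takes its values in the period strip
`|Re x| ≤ T`. -/
def mappedRegion (T ρ : ℝ) : Set ℂ := {x | |x.re| ≤ T ∧ m T x ∈ bernsteinRegion ρ}

/-- The norm of `L²(-1, 1)`. -/
def l2Norm (g : ℝ → ℂ) : ℝ := Real.sqrt (∫ x in (-1 : ℝ)..1, ‖g x‖ ^ 2)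

/-- `φ_n(x) = (2 T)^{-1/2} e^{i n π x / T}`. -/
def phi (T : ℝ) (n : ℤ) (x : ℝ) : ℂ :=
  1 / (Real.sqrt (2 * T) : ℂ) * Complex.exp (Complex.I * (n * Real.pi / T * x))

/-- The element `∑_{|n| ≤ N} a_n φ_n` of `𝒢_N`. -/
def contSum (T : ℝ) (N : ℕ) (a : EuclideanSpace ℂ (Finset.Icc (-(N : ℤ)) N)) (x : ℝ) : ℂ :=
  ∑ n, a n * phi T n x

/-- `a` is the vector of coefficients of the continuous Fourier extension `F_N(f)`, i.e.
`∑_{|n| ≤ N} a_n φ_n` is the element of `𝒢_N` that minimizes the `L²(-1, 1)` distance to `f`. -/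
def IsContinuousFECoeff (T : ℝ) (N : ℕ) (f : ℝ → ℂ)
    (a : EuclideanSpace ℂ (Finset.Icc (-(N : ℤ)) N)) : Prop :=
  ∀ b : EuclideanSpace ℂ (Finset.Icc (-(N : ℤ)) N),
    l2Norm (fun x => f x - contSum T N a x) ≤ l2Norm (fun x => f x - contSum T N b x)

/-- The nodes `x_n`, `0 ≤ n ≤ N`, obtained by mapping the Chebyshev nodes. -/
def nodeAux (T : ℝ) (N : ℕ) (n : ℤ) : ℝ :=
  T / Real.pi * Real.arccos (1 / 2 * (1 - c T) * Real.cos ((2 * n + 1) * Real.pi / (2 * N + 2))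
    + 1 / 2 * (1 + c T))

/-- The mapped symmetric Chebyshev nodes `x_n = - x_{-n-1}`, `-N-1 ≤ n ≤ N`. -/
def node (T : ℝ) (N : ℕ) (n : ℤ) : ℝ :=
  if 0 ≤ n then nodeAux T N n else -nodeAux T N (-n - 1)

/-- The basis functions of the discrete Fourier extension: `cos (n π x / T)` for the index
`n ≥ 0`, and `sin (k π x / T)` for the index `n = -k < 0`. -/
def trig (T : ℝ) (n : ℤ) (x : ℝ) : ℝ :=
  if 0 ≤ n then Real.cos (n * Real.pi / T * x) else Real.sin (-n * Real.pi / T * x)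

/-- The element of `𝒢'_N = 𝒞_N ⊕ 𝒮_{N+1}` with coefficients `a_{-N-1}, …, a_N`. -/
def discSum (T : ℝ) (N : ℕ) (a : EuclideanSpace ℂ (Finset.Icc (-(N : ℤ) - 1) N)) (x : ℝ) : ℂ :=
  ∑ n, a n * (trig T n x : ℂ)

/-- `a` is the vector of coefficients of the discrete Fourier extension of `f`: the corresponding
element of `𝒢'_N` minimizes the sum of the squared errors at the nodes `x_{-N-1}, …, x_N`. -/
def IsDiscreteFECoeff (T : ℝ) (N : ℕ) (f : ℝ → ℂ)
    (a : EuclideanSpace ℂ (Finset.Icc (-(N : ℤ) - 1) N)) : Prop :=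
  ∀ b : EuclideanSpace ℂ (Finset.Icc (-(N : ℤ) - 1) N),
    ∑ n ∈ Finset.Icc (-(N : ℤ) - 1) N, ‖f (node T N n) - discSum T N a (node T N n)‖ ^ 2 ≤
      ∑ n ∈ Finset.Icc (-(N : ℤ) - 1) N, ‖f (node T N n) - discSum T N b (node T N n)‖ ^ 2

/-- The maximum of `|f|` over the compact region `𝒟(ρ)`. -/
def maxOn (T ρ : ℝ) (f : ℂ → ℂ) : ℝ := sSup ((fun x => ‖f x‖) '' mappedRegion T ρ)

end

end FourierExtension

/-! An even element of an extension space is a polynomial in cos(πx/T), hence in z = m(x); an odd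
one is sin(πx/T) times such a polynomial. The map m folds [-1,1] onto [-1,1] and sends the real line
into [m(T), 1], where m(T) is the left vertex of the Bernstein ellipse of index E = E(T). A
polynomial of degree at most N that is bounded on [-1,1] is therefore O(E^N) over the whole period.
This is the only source of the factor E^N.

Stability. Expand a polynomial p in the `U_j`. The orthogonality of sines recovers its coefficients
from p(cos θ) sin θ, either by integration (`norm_eval_le_integral`) or from the Chebyshev nodes
(`norm_eval_le_nodes`), and `U_j` is O(E^j) inside the ellipse (`norm_eval_U_le`). Since the
trigonometric basis is orthogonal over a full period, coefficients are bounded by the supremum over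
[-T,T]. Together these give, for the extension coefficients a and any competitor b, that ‖a - b‖ ≤ C
· (error of b) · E^N; in the discrete case because least squares at these nodes is interpolation.
The competitor b = 0 settles square-integrable functions.

Approximation. For analytic f the competitor is a truncated series (`exists_approx`). Put z = (s² +
s⁻²)/2 and sin(πx/(2T)) = σ(s - s⁻¹)/(2i), with σ = sin(π/(2T)); then x is holomorphic in s for
E^(-1/2) < |s| < E^(1/2), and the Laurent coefficients of f decay like ρ^(-|k|/2). At s = e^{iη} the
even part of f is a series in cos 2nη = T_n(z). Since sin(πx/T) contains the factor cos(πx/(2T)),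
the odd part is obtained by expanding f / cos(πx/(2T)) in sin((2n+1)η), which is sin η times a
polynomial in z. This quotient may be unbounded when ρ = E, but its singularity is only an inverse
square root, so its circle means stay bounded, and the Laurent estimate needs nothing more.

Truncation costs O(ρ^(-N)), while the k-th term of the series is O((E/ρ)^k) over the period. Hence
‖a‖ ≤ C max|f| Σ_{k≤N} (E/ρ)^k: the last term dominates if ρ < E, and the sum is N + 1 if ρ = E. -/

namespace FourierExtension

/-! ### Chebyshev polynomials: growth in Bernstein ellipses and recovery of coefficients. -/

open Polynomial Polynomial.Chebyshev

/-- Joukowski parametrization of the points inside a Bernstein ellipse. -/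
theorem exists_joukowski {K : ℝ} (hK : 1 ≤ K) {z : ℂ} (hz : ‖z - 1‖ + ‖z + 1‖ ≤ K + K⁻¹) :
    ∃ w : ℂ, 1 ≤ ‖w‖ ∧ ‖w‖ ≤ K ∧ w + w⁻¹ = 2 * z := by
  obtain ⟨s, hs⟩ := IsAlgClosed.exists_pow_nat_eq (z ^ 2 - 1) (n := 2) (by norm_num)
  have hmul : (z + s) * (z - s) = 1 := by linear_combination -hs
  have key : ∀ w : ℂ, w ≠ 0 → w + w⁻¹ = 2 * z → 1 ≤ ‖w‖ → ‖w‖ ≤ K := by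
    intro w hw hwz h1
    have hn : 0 < ‖w‖ := norm_pos_iff.mpr hw
    obtain rfl : z = 1 / 2 * (w⁻¹ + w) := by linear_combination (-1 / 2 : ℂ) * hwz
    have e1 : 1 / 2 * (w⁻¹ + w) - 1 = (w - 1) ^ 2 / (2 * w) := by field_simp; ring
    have e2 : 1 / 2 * (w⁻¹ + w) + 1 = (w + 1) ^ 2 / (2 * w) := by field_simp; ring
    -- The focal distances are |w ∓ 1|²/(2|w|), so by the parallelogram law they add up to |w| +
    -- |w|⁻¹.
    have hp := parallelogram_law_with_norm ℝ w 1
    rw [norm_one] at hp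
    rw [e1, e2, norm_div, norm_div, norm_pow, norm_pow, norm_mul, Complex.norm_two,
      ← add_div, div_le_iff₀ (by positivity)] at hz
    have hK0 : 0 < K := by linarith
    have hKi : K * K⁻¹ = 1 := mul_inv_cancel₀ hK0.ne'
    by_contra! hlt
    nlinarith [mul_pos (sub_pos.mpr hlt) hK0, mul_nonneg (sub_nonneg.mpr h1) (sub_nonneg.mpr hK),
      mul_le_mul_of_nonneg_left hz hK0.le, mul_pos (sub_pos.mpr hlt)
        (show 0 < ‖w‖ * K - 1 by nlinarith)]
  have e1 : (z + s)⁻¹ = z - s := inv_eq_of_mul_eq_one_right hmul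
  have e2 : (z - s)⁻¹ = z + s := inv_eq_of_mul_eq_one_left hmul
  rcases le_total 1 ‖z + s‖ with h | h
  · refine ⟨z + s, h, key _ (left_ne_zero_of_mul_eq_one hmul) ?_ h, ?_⟩ <;> rw [e1] <;> ring
  · have h' : 1 ≤ ‖z - s‖ := by
      have := congrArg norm hmul
      rw [norm_mul, norm_one] at this
      nlinarith [norm_nonneg (z - s)]
    refine ⟨z - s, h', key _ (right_ne_zero_of_mul_eq_one hmul) ?_ h', ?_⟩ <;> rw [e2] <;> ring

/-- With z = (w + w⁻¹)/2 one has U_{n+1} = w U_n + w^{-(n+1)}, so |U_{n+1}| ≤ K|U_n| + 1, a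
geometric recursion. The closed form would divide by w - w⁻¹, which vanishes at z = ±1. -/
theorem norm_eval_U_le {K : ℝ} (hK : 1 < K) {z : ℂ} (hz : ‖z - 1‖ + ‖z + 1‖ ≤ K + K⁻¹) (n : ℕ) :
    ‖(U ℂ n).eval z‖ ≤ K / (K - 1) * K ^ n := by
  obtain ⟨w, hw1, hwK, hwz⟩ := exists_joukowski hK.le hz
  have hw0 : w ≠ 0 := norm_pos_iff.mp (by linarith)
  have hK1 : 0 < K - 1 := by linarith
  have rec2 : ∀ n : ℕ, (U ℂ (n + 1 : ℕ)).eval z = w * (U ℂ n).eval z + w⁻¹ ^ (n + 1) := by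
    intro n
    induction n with
    | zero =>
      simp only [Nat.cast_zero, zero_add, Nat.cast_one, U_one, U_zero, eval_mul, eval_ofNat,
        eval_X, eval_one, pow_one, ← hwz, mul_one]
    | succ n ih =>
      have := U_add_two ℂ (n : ℤ)
      have e : (U ℂ (n + 1 + 1 : ℕ)).eval z
          = 2 * z * (U ℂ (n + 1 : ℕ)).eval z - (U ℂ n).eval z := by
        rw [show ((n + 1 + 1 : ℕ) : ℤ) = (n : ℤ) + 2 by push_cast; ring, this]
        simp
      rw [e, ← hwz]
      rw [ih]
      linear_combination (U ℂ n).eval z * mul_inv_cancel₀ hw0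
  have bound : ∀ n : ℕ, (K - 1) * ‖(U ℂ n).eval z‖ ≤ K ^ (n + 1) - 1 := by
    intro n
    induction n with
    | zero => simp
    | succ n ih =>
      have h1 : ‖w⁻¹ ^ (n + 1)‖ ≤ 1 := by
        rw [norm_pow, norm_inv]
        exact pow_le_one₀ (by positivity) (inv_le_one_of_one_le₀ hw1)
      rw [rec2]
      have h2 : ‖w * (U ℂ n).eval z + w⁻¹ ^ (n + 1)‖ ≤ K * ‖(U ℂ n).eval z‖ + 1 := by
        refine (norm_add_le _ _).trans (add_le_add ?_ h1)
        rw [norm_mul]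
        gcongr
      calc _ ≤ (K - 1) * (K * ‖(U ℂ n).eval z‖ + 1) := by gcongr
        _ = K * ((K - 1) * ‖(U ℂ n).eval z‖) + (K - 1) := by ring
        _ ≤ K * (K ^ (n + 1) - 1) + (K - 1) := by gcongr
        _ = _ := by ring
  rw [div_mul_eq_mul_div, le_div_iff₀ hK1, mul_comm, ← pow_succ']
  linarith [bound n]

theorem norm_eval_T_le {K : ℝ} (hK : 1 < K) {z : ℂ} (hz : ‖z - 1‖ + ‖z + 1‖ ≤ K + K⁻¹) (n : ℕ) :
    ‖(T ℂ n).eval z‖ ≤ K / (K - 1) * K ^ n := by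
  have hK1 : 0 < K - 1 := by linarith
  have hD : 1 ≤ K / (K - 1) := by rw [le_div_iff₀ hK1]; linarith
  match n with
  | 0 => simpa using hD
  | 1 =>
    have h2 : ‖(2 : ℂ) * z‖ ≤ ‖z - 1‖ + ‖z + 1‖ := by
      rw [show (2 : ℂ) * z = (z - 1) + (z + 1) by ring]
      exact norm_add_le _ _
    rw [norm_mul, Complex.norm_two] at h2
    have h3 : K⁻¹ ≤ 1 := inv_le_one_of_one_le₀ hK.le
    simp only [Nat.cast_one, T_one, eval_X, pow_one]
    nlinarith
  | n + 2 =>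
    have h := congrArg (eval z) (two_mul_T_eq_U_sub_U ℂ (n : ℤ))
    simp only [eval_mul, eval_ofNat, eval_sub] at h
    have h2 := norm_eval_U_le hK hz (n + 2)
    have h0 := norm_eval_U_le hK hz n
    have e : ((n + 2 : ℕ) : ℤ) = (n : ℤ) + 2 := by push_cast; ring
    rw [e] at h2 ⊢
    have h4 : 2 * ‖(T ℂ ((n : ℤ) + 2)).eval z‖ ≤
        ‖(U ℂ ((n : ℤ) + 2)).eval z‖ + ‖(U ℂ n).eval z‖ := by
      rw [← Complex.norm_two, ← norm_mul, h]
      exact norm_sub_le _ _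
    have h5 : K ^ n ≤ K ^ (n + 2) := pow_le_pow_right₀ hK.le (by omega)
    have h6 : K / (K - 1) * K ^ n ≤ K / (K - 1) * K ^ (n + 2) := by gcongr
    linarith

/-- Expansion of a polynomial in a sequence of polynomials with one of each degree. -/
theorem exists_eq_sum_of_degree_lt {S : ℕ → ℂ[X]} (hS : ∀ n, (S n).degree = n) (N : ℕ) :
    ∀ p : ℂ[X], p.degree < N → ∃ a : ℕ → ℂ, p = ∑ j ∈ Finset.range N, C (a j) * S j := by
  induction N with
  | zero =>
    intro p hp
    refine ⟨0, ?_⟩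
    have h := (degree_lt_iff_coeff_zero _ _).mp hp
    ext n
    simpa using h n (Nat.zero_le n)
  | succ N ih =>
    intro p hp
    have hlead : (S N).coeff N ≠ 0 := coeff_ne_zero_of_eq_degree (hS N)
    obtain ⟨a, ha⟩ := ih (p - C (p.coeff N / (S N).coeff N) * S N) (by
      rw [degree_lt_iff_coeff_zero] at hp ⊢
      intro k hk
      rcases hk.eq_or_lt with rfl | hk
      · simp [hlead]
      · have : (S N).coeff k = 0 := coeff_eq_zero_of_degree_lt (by rw [hS]; exact_mod_cast hk)
        simp [this, hp k hk])
    refine ⟨fun j => if j = N then p.coeff N / (S N).coeff N else a j, ?_⟩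
    rw [Finset.sum_range_succ, ← sub_eq_iff_eq_add]
    simp only [if_true]
    rw [ha]
    refine Finset.sum_congr rfl fun j hj => ?_
    rw [if_neg (Finset.mem_range.mp hj).ne]

theorem integral_sin_mul_sin (j k : ℕ) :
    ∫ θ in (0 : ℝ)..Real.pi, Real.sin ((j + 1) * θ) * Real.sin ((k + 1) * θ)
      = if j = k then Real.pi / 2 else 0 := by
  have hcos : ∀ a : ℤ, ∫ θ in (0 : ℝ)..Real.pi, Real.cos (a * θ) = if a = 0 then Real.pi else 0 := by
    intro a
    split_ifs with h
    · simp [h]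
    · rw [intervalIntegral.integral_comp_mul_left (fun x => Real.cos x) (by exact_mod_cast h)]
      simp
  have e : ∀ θ : ℝ, Real.sin ((j + 1) * θ) * Real.sin ((k + 1) * θ)
      = 1 / 2 * (Real.cos (((j - k : ℤ) : ℝ) * θ) - Real.cos (((j + k + 2 : ℤ) : ℝ) * θ)) := by
    intro θ
    have h1 : ((j - k : ℤ) : ℝ) * θ = (j + 1) * θ - (k + 1) * θ := by push_cast; ring
    have h2 : ((j + k + 2 : ℤ) : ℝ) * θ = (j + 1) * θ + (k + 1) * θ := by push_cast; ring
    rw [h1, h2, Real.cos_sub, Real.cos_add]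
    ring
  simp_rw [e]
  rw [intervalIntegral.integral_const_mul, intervalIntegral.integral_sub
    (Continuous.intervalIntegrable (by fun_prop) _ _)
    (Continuous.intervalIntegrable (by fun_prop) _ _), hcos, hcos,
    if_neg (by omega : ¬ ((j : ℤ) + k + 2 = 0))]
  by_cases h : j = k
  · simp [h]; ring
  · rw [if_neg (by omega), if_neg h]; simp

/-- Multiplied by 2 sin(lπ/(2N+2)) the sum telescopes to sin(lπ) = 0; the range of l keeps the
multiplier nonzero. -/
theorem sum_cos_nodes (N : ℕ) (l : ℕ) (h0 : 0 < l) (hl : l ≤ 2 * N + 1) :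
    ∑ n ∈ Finset.range (N + 1), Real.cos (l * ((2 * n + 1) * Real.pi / (2 * N + 2))) = 0 := by
  have hN : (0 : ℝ) < 2 * N + 2 := by positivity
  have hd : Real.sin (l * Real.pi / (2 * N + 2)) ≠ 0 := by
    apply ne_of_gt
    apply Real.sin_pos_of_pos_of_lt_pi
    · have : (0 : ℝ) < l := by exact_mod_cast h0
      positivity
    · rw [div_lt_iff₀ hN, mul_comm]
      have : (l : ℝ) ≤ 2 * N + 1 := by exact_mod_cast hl
      nlinarith [Real.pi_pos]
  have tel : ∀ M : ℕ, 2 * Real.sin (l * Real.pi / (2 * N + 2)) * ∑ n ∈ Finset.range M,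
      Real.cos (l * ((2 * n + 1) * Real.pi / (2 * N + 2)))
      = Real.sin (M * (2 * (l * Real.pi / (2 * N + 2)))) := by
    intro M
    induction M with
    | zero => simp
    | succ M ih =>
      rw [Finset.sum_range_succ, mul_add, ih]
      set d := l * Real.pi / (2 * N + 2) with hd
      have e1 : l * ((2 * M + 1) * Real.pi / (2 * N + 2)) = M * (2 * d) + d := by
        rw [hd]; ring
      have e2 : ((M + 1 : ℕ) : ℝ) * (2 * d) = (M * (2 * d) + d) + d := by push_cast; ring
      have e3 : (M : ℝ) * (2 * d) = (M * (2 * d) + d) - d := by ring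
      rw [e1, e2, Real.sin_add (M * (2 * d) + d) d]
      nth_rewrite 1 [e3]
      rw [Real.sin_sub]
      ring
  have h := tel (N + 1)
  have e : ((N + 1 : ℕ) : ℝ) * (2 * (l * Real.pi / (2 * N + 2))) = l * Real.pi := by
    push_cast; field_simp
  rw [e, Real.sin_nat_mul_pi] at h
  simpa [hd] using h

theorem sum_sin_mul_sin_nodes (N : ℕ) {j k : ℕ} (hj : j ≤ N) (hk : k ≤ N) :
    ∑ n ∈ Finset.range (N + 1), Real.sin ((j + 1) * ((2 * n + 1) * Real.pi / (2 * N + 2)))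
      * Real.sin ((k + 1) * ((2 * n + 1) * Real.pi / (2 * N + 2)))
      = if j = k then (if k = N then (N + 1 : ℝ) else (N + 1 : ℝ) / 2) else 0 := by
  have main : ∀ i d : ℕ, i + d ≤ N →
      ∑ n ∈ Finset.range (N + 1), Real.sin (((i + d : ℕ) + 1) * ((2 * n + 1) * Real.pi / (2 * N + 2)))
      * Real.sin ((i + 1) * ((2 * n + 1) * Real.pi / (2 * N + 2)))
      = if d = 0 then (if i = N then (N + 1 : ℝ) else (N + 1 : ℝ) / 2) else 0 := by
    intro i d hd
    have e : ∀ n : ℕ, Real.sin (((i + d : ℕ) + 1) * ((2 * n + 1) * Real.pi / (2 * N + 2)))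
      * Real.sin ((i + 1) * ((2 * n + 1) * Real.pi / (2 * N + 2)))
      = 1 / 2 * (Real.cos ((d : ℕ) * ((2 * n + 1) * Real.pi / (2 * N + 2)))
        - Real.cos ((2 * i + d + 2 : ℕ) * ((2 * n + 1) * Real.pi / (2 * N + 2)))) := by
      intro n
      set t := (2 * n + 1) * Real.pi / (2 * N + 2)
      have h1 : (d : ℝ) * t = ((i + d : ℕ) + 1) * t - (i + 1) * t := by push_cast; ring
      have h2 : ((2 * i + d + 2 : ℕ) : ℝ) * t = ((i + d : ℕ) + 1) * t + (i + 1) * t := by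
        push_cast; ring
      rw [h1, h2, Real.cos_sub, Real.cos_add]
      ring
    simp_rw [e]
    rw [← Finset.mul_sum, Finset.sum_sub_distrib]
    split_ifs with h0 hi
    -- The frequency 2N + 2 lies just outside `sum_cos_nodes`: its cosine is -1 at every node, which
    -- doubles the norm of the top mode.
    · have : ∀ n : ℕ, Real.cos ((2 * i + d + 2 : ℕ) * ((2 * n + 1) * Real.pi / (2 * N + 2))) = -1 := by
        intro n
        have : ((2 * i + d + 2 : ℕ) : ℝ) * ((2 * n + 1) * Real.pi / (2 * N + 2))
            = Real.pi + n * (2 * Real.pi) := by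
          have hN : (0 : ℝ) < 2 * N + 2 := by positivity
          rw [h0, hi]; push_cast; field_simp; ring
        rw [this, Real.cos_add_nat_mul_two_pi, Real.cos_pi]
      simp_rw [this]
      simp [h0]; ring
    · rw [sum_cos_nodes N (2 * i + d + 2) (by omega) (by omega)]
      simp [h0]; ring
    · rw [sum_cos_nodes N d (by omega) (by omega), sum_cos_nodes N _ (by omega) (by omega)]
      simp
  rcases le_total k j with h | h
  · obtain ⟨d, rfl⟩ := Nat.exists_eq_add_of_le h
    rw [main k d hj]
    simp
  · obtain ⟨d, rfl⟩ := Nat.exists_eq_add_of_le h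
    simp_rw [mul_comm (Real.sin ((j + 1) * _))]
    rw [main j d hk]
    by_cases hd : d = 0
    · simp [hd]
    · simp [hd]

theorem norm_sum_smul_le_geom {K A B : ℝ} (hK : 1 < K) (hA : 0 ≤ A) (hB : 0 ≤ B) {a b : ℕ → ℂ}
    (N : ℕ) (ha : ∀ j ≤ N, ‖a j‖ ≤ A) (hb : ∀ j, ‖b j‖ ≤ B * K ^ j) :
    ‖∑ j ∈ Finset.range (N + 1), a j * b j‖ ≤ A * B * (K / (K - 1)) * K ^ N := by
  have hK1 : 0 < K - 1 := by linarith
  calc _ ≤ ∑ j ∈ Finset.range (N + 1), A * (B * K ^ j) := by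
        refine norm_sum_le_of_le _ fun j hj => ?_
        rw [norm_mul]
        exact mul_le_mul (ha j (by simpa [Nat.lt_succ_iff] using hj)) (hb j) (norm_nonneg _) hA
    _ = A * B * ∑ j ∈ Finset.range (N + 1), K ^ j := by
        rw [Finset.mul_sum]; exact Finset.sum_congr rfl fun _ _ => by ring
    _ ≤ A * B * (K / (K - 1) * K ^ N) := by
        gcongr
        rw [geom_sum_eq hK.ne', div_mul_eq_mul_div, ← pow_succ']
        gcongr
        linarith
    _ = _ := by ring

theorem eval_sum_U (a : ℕ → ℂ) (N : ℕ) (z : ℂ) :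
    (∑ j ∈ Finset.range N, Polynomial.C (a j) * U ℂ j).eval z
      = ∑ j ∈ Finset.range N, a j * (U ℂ j).eval z := by
  simp [eval_finsetSum]

theorem eval_U_cos_mul_sin (j : ℕ) (θ : ℝ) :
    (U ℂ j).eval (Real.cos θ : ℂ) * (Real.sin θ : ℂ) = (Real.sin ((j + 1) * θ) : ℝ) := by
  have := U_complex_cos (θ : ℂ) (j : ℤ)
  push_cast at this ⊢
  exact this

/-- Growth of a polynomial outside `[-1, 1]`, in terms of its integral over `[-1, 1]`. -/
theorem norm_eval_le_integral {K : ℝ} (hK : 1 < K) {z : ℂ} (hz : ‖z - 1‖ + ‖z + 1‖ ≤ K + K⁻¹)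
    {N : ℕ} {p : ℂ[X]} (hp : p.degree < (N + 1 : ℕ)) :
    ‖p.eval z‖ ≤ (∫ θ in (0 : ℝ)..Real.pi, ‖p.eval (Real.cos θ : ℂ)‖ * Real.sin θ)
      * (K / (K - 1)) ^ 2 * K ^ N := by
  obtain ⟨a, rfl⟩ := exists_eq_sum_of_degree_lt (degree_U_natCast ℂ) (N + 1) p hp
  set p := ∑ j ∈ Finset.range (N + 1), Polynomial.C (a j) * U ℂ j with hpdef
  have hpi := Real.pi_pos
  have hcont : Continuous fun θ : ℝ => p.eval (Real.cos θ : ℂ) :=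
    p.continuous.comp (Complex.continuous_ofReal.comp Real.continuous_cos)
  set I := ∫ θ in (0 : ℝ)..Real.pi, ‖p.eval (Real.cos θ : ℂ)‖ * Real.sin θ with hI
  have hI0 : 0 ≤ I := intervalIntegral.integral_nonneg hpi.le fun θ hθ =>
    mul_nonneg (norm_nonneg _) (Real.sin_nonneg_of_mem_Icc hθ)
  -- The basis `U` is used because p(cos θ) sin θ is then a sine polynomial: only p weighted by sin
  -- θ has to be controlled, and for the odd part of an extension nothing better is available.
  have hcoef : ∀ k ≤ N, ∫ θ in (0 : ℝ)..Real.pi,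
      p.eval (Real.cos θ : ℂ) * (Real.sin θ : ℂ) * (Real.sin ((k + 1) * θ) : ℝ)
        = a k * (Real.pi / 2 : ℝ) := by
    intro k hk
    have e : ∀ θ : ℝ, p.eval (Real.cos θ : ℂ) * (Real.sin θ : ℂ) * (Real.sin ((k + 1) * θ) : ℝ)
        = ∑ j ∈ Finset.range (N + 1), a j *
          ((Real.sin ((j + 1) * θ) * Real.sin ((k + 1) * θ) : ℝ) : ℂ) := by
      intro θ
      rw [hpdef, eval_sum_U, Finset.sum_mul, Finset.sum_mul]
      refine Finset.sum_congr rfl fun j _ => ?_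
      rw [mul_assoc (a j), eval_U_cos_mul_sin]
      push_cast; ring
    simp_rw [e]
    rw [intervalIntegral.integral_finsetSum fun j _ =>
      (Continuous.intervalIntegrable (by fun_prop) _ _)]
    simp_rw [intervalIntegral.integral_const_mul, intervalIntegral.integral_ofReal,
      integral_sin_mul_sin]
    rw [Finset.sum_eq_single k]
    · simp
    · intro j _ hj; simp [hj]
    · intro h; simp at h; omega
  have ha : ∀ k ≤ N, ‖a k‖ ≤ I := by
    intro k hk
    have h1 : ‖a k * (Real.pi / 2 : ℝ)‖ ≤ I := by
      rw [← hcoef k hk]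
      refine intervalIntegral.norm_integral_le_of_norm_le hpi.le ?_
        (Continuous.intervalIntegrable (by fun_prop) _ _)
      refine Filter.Eventually.of_forall fun θ hθ => ?_
      rw [norm_mul, norm_mul, Complex.norm_real, Complex.norm_real, Real.norm_eq_abs,
        Real.norm_eq_abs, abs_of_nonneg (Real.sin_nonneg_of_mem_Icc ⟨hθ.1.le, hθ.2⟩)]
      exact mul_le_of_le_one_right (mul_nonneg (norm_nonneg _)
        (Real.sin_nonneg_of_mem_Icc ⟨hθ.1.le, hθ.2⟩)) (Real.abs_sin_le_one _)
    rw [norm_mul, Complex.norm_real, Real.norm_eq_abs, abs_of_pos (by positivity)] at h1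
    nlinarith [Real.pi_gt_three, norm_nonneg (a k)]
  rw [hpdef, eval_sum_U]
  refine (norm_sum_smul_le_geom hK hI0 (div_nonneg (by linarith) (by linarith)) N ha
    (norm_eval_U_le hK hz)).trans (le_of_eq ?_)
  ring

/-- Growth of a polynomial outside `[-1, 1]`, in terms of its values at the Chebyshev nodes. -/
theorem norm_eval_le_nodes {K : ℝ} (hK : 1 < K) {z : ℂ} (hz : ‖z - 1‖ + ‖z + 1‖ ≤ K + K⁻¹)
    {N : ℕ} {p : ℂ[X]} (hp : p.degree < (N + 1 : ℕ)) {ε : ℝ}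
    (hε : ∀ n ≤ N, ‖p.eval (Real.cos ((2 * n + 1) * Real.pi / (2 * N + 2)) : ℂ)‖ *
      |Real.sin ((2 * n + 1) * Real.pi / (2 * N + 2))| ≤ ε) :
    ‖p.eval z‖ ≤ 2 * ε * (K / (K - 1)) ^ 2 * K ^ N := by
  obtain ⟨a, rfl⟩ := exists_eq_sum_of_degree_lt (degree_U_natCast ℂ) (N + 1) p hp
  set p := ∑ j ∈ Finset.range (N + 1), Polynomial.C (a j) * U ℂ j with hpdef
  have hε0 : 0 ≤ ε := (by positivity : (0 : ℝ) ≤ _).trans (hε 0 (Nat.zero_le _))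
  -- The same recovery with the integral replaced by a sum over the nodes.
  have hcoef : ∀ k ≤ N, ∑ n ∈ Finset.range (N + 1),
      p.eval (Real.cos ((2 * n + 1) * Real.pi / (2 * N + 2)) : ℂ) *
        (Real.sin ((2 * n + 1) * Real.pi / (2 * N + 2)) : ℂ) *
        (Real.sin ((k + 1) * ((2 * n + 1) * Real.pi / (2 * N + 2))) : ℝ)
        = a k * ((if k = N then (N + 1 : ℝ) else (N + 1 : ℝ) / 2) : ℝ) := by
    intro k hk
    have e : ∀ θ : ℝ, p.eval (Real.cos θ : ℂ) * (Real.sin θ : ℂ) * (Real.sin ((k + 1) * θ) : ℝ)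
        = ∑ j ∈ Finset.range (N + 1), a j *
          ((Real.sin ((j + 1) * θ) * Real.sin ((k + 1) * θ) : ℝ) : ℂ) := by
      intro θ
      rw [hpdef, eval_sum_U, Finset.sum_mul, Finset.sum_mul]
      refine Finset.sum_congr rfl fun j _ => ?_
      rw [mul_assoc (a j), eval_U_cos_mul_sin]
      push_cast; ring
    simp_rw [e]
    rw [Finset.sum_comm, Finset.sum_eq_single k]
    · rw [← Finset.mul_sum, ← Complex.ofReal_sum, sum_sin_mul_sin_nodes N hk hk, if_pos rfl]
    · intro j hj hjk
      rw [← Finset.mul_sum, ← Complex.ofReal_sum, sum_sin_mul_sin_nodes N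
        (by simpa [Nat.lt_succ_iff] using hj) hk, if_neg hjk]
      simp
    · intro h; simp at h; omega
  have ha : ∀ k ≤ N, ‖a k‖ ≤ 2 * ε := by
    intro k hk
    have h1 : ‖a k * ((if k = N then (N + 1 : ℝ) else (N + 1 : ℝ) / 2) : ℝ)‖ ≤ (N + 1) * ε := by
      rw [← hcoef k hk]
      calc _ ≤ ∑ n ∈ Finset.range (N + 1), ε := by
            refine norm_sum_le_of_le _ fun n hn => ?_
            rw [norm_mul, norm_mul, Complex.norm_real, Complex.norm_real, Real.norm_eq_abs,
              Real.norm_eq_abs]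
            exact (mul_le_of_le_one_right (by positivity) (Real.abs_sin_le_one _)).trans
              (hε n (by simpa [Nat.lt_succ_iff] using hn))
        _ = _ := by simp
    -- The exceptional norm of the top mode is the larger one, so it only helps.
    have hle : (N + 1 : ℝ) / 2 ≤ (if k = N then (N + 1 : ℝ) else (N + 1 : ℝ) / 2) := by
      split_ifs
      · linarith [(Nat.cast_nonneg N : (0 : ℝ) ≤ N)]
      · exact le_rfl
    have hN : (0 : ℝ) < (N + 1 : ℝ) / 2 := by positivity
    rw [norm_mul, Complex.norm_real, Real.norm_eq_abs, abs_of_pos (hN.trans_le hle)] at h1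
    have h2 := (mul_le_mul_of_nonneg_left hle (norm_nonneg (a k))).trans h1
    have h3 : ‖a k‖ * ((N + 1 : ℝ) / 2) ≤ 2 * ε * ((N + 1 : ℝ) / 2) := by linarith
    exact le_of_mul_le_mul_right h3 hN
  rw [hpdef, eval_sum_U]
  refine (norm_sum_smul_le_geom hK (by positivity) (div_nonneg (by linarith) (by linarith)) N ha
    (norm_eval_U_le hK hz)).trans (le_of_eq ?_)
  ring

end FourierExtension

/-! ### The map `m` on the real line and the constant `E`. -/

namespace FourierExtension

open Polynomial Polynomial.Chebyshev

/-- `sin (π / (2 T))`, so that `1 - c(T) = 2 sin² (π / (2 T))`. -/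
noncomputable def sigma (T : ℝ) : ℝ := Real.sin (Real.pi / (2 * T))

theorem sigma_pos {T : ℝ} (hT : 1 < T) : 0 < sigma T := by
  have hpi := Real.pi_pos
  refine Real.sin_pos_of_pos_of_lt_pi (by positivity) ?_
  rw [div_lt_iff₀ (by positivity)]
  nlinarith

theorem sigma_lt_one {T : ℝ} (hT : 1 < T) : sigma T < 1 := by
  have hpi := Real.pi_pos
  rw [sigma, ← Real.sin_pi_div_two]
  refine Real.sin_lt_sin_of_lt_of_le_pi_div_two ?_ le_rfl ?_
  · have : 0 < Real.pi / (2 * T) := by positivity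
    linarith
  · exact div_lt_div_of_pos_left hpi (by norm_num) (by linarith)

theorem c_eq (T : ℝ) : c T = 1 - 2 * sigma T ^ 2 := by
  have e : Real.pi / T = 2 * (Real.pi / (2 * T)) := by ring
  rw [c, sigma, e, Real.cos_two_mul, Real.cos_sq']
  ring

/-- With t = π/(4T), cot t + tan t = 1/(sin t cos t) = 2/sin 2t. So √E(T) is the Joukowski parameter
of 1/σ, which later fixes the annulus on which `m` is inverted. -/
theorem cot_quarter_add_inv {T : ℝ} (hT : 1 < T) :
    1 < Real.cot (Real.pi / (4 * T)) ∧
      Real.cot (Real.pi / (4 * T)) + (Real.cot (Real.pi / (4 * T)))⁻¹ = 2 / sigma T := by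
  have hpi := Real.pi_pos
  set t := Real.pi / (4 * T) with ht
  have ht0 : 0 < t := by positivity
  have ht4 : t < Real.pi / 4 := div_lt_div_of_pos_left hpi (by norm_num) (by linarith)
  have hs : 0 < Real.sin t := Real.sin_pos_of_pos_of_lt_pi ht0 (by linarith)
  have hc : 0 < Real.cos t := Real.cos_pos_of_mem_Ioo ⟨by linarith, by linarith⟩
  have hsig : sigma T = 2 * Real.sin t * Real.cos t := by
    rw [sigma, ← Real.sin_two_mul, ht]
    congr 1; ring
  have hlt : Real.sin t < Real.cos t := by
    rw [← Real.cos_pi_div_two_sub]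
    exact Real.cos_lt_cos_of_nonneg_of_le_pi ht0.le (by linarith) (by linarith)
  rw [Real.cot_eq_cos_div_sin]
  constructor
  · rwa [lt_div_iff₀ hs, one_mul]
  · rw [hsig]
    field_simp
    linarith [Real.sin_sq_add_cos_sq t]

theorem one_lt_E {T : ℝ} (hT : 1 < T) : 1 < E T := by
  have h := (cot_quarter_add_inv hT).1
  rw [E]
  nlinarith

/-- The square of the preceding identity. It says (E + E⁻¹)/2 = 2/σ² - 1 = -m(T), so the ellipse of
index E(T) passes through m(T). -/
theorem E_add_inv {T : ℝ} (hT : 1 < T) : E T + (E T)⁻¹ = 4 / sigma T ^ 2 - 2 := by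
  obtain ⟨h1, h2⟩ := cot_quarter_add_inv hT
  have h0 : Real.cot (Real.pi / (4 * T)) ≠ 0 := by linarith
  have h3 := congrArg (· ^ 2) h2
  simp only [div_pow] at h3
  rw [E, ← inv_pow]
  have h4 := mul_inv_cancel₀ h0
  nlinarith

theorem m_eq {T : ℝ} (hT : 1 < T) (x : ℂ) :
    m T x = 1 - 2 * Complex.sin (Real.pi / (2 * T) * x) ^ 2 / (sigma T : ℂ) ^ 2 := by
  have hs : (sigma T : ℂ) ≠ 0 := by exact_mod_cast (sigma_pos hT).ne'
  have e : (Real.pi / T * x : ℂ) = 2 * (Real.pi / (2 * T) * x) := by ring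
  rw [m, c_eq, e, Complex.cos_two_mul, Complex.cos_sq']
  push_cast
  field_simp
  ring

/-- `m` on the real line. -/
noncomputable def mReal (T x : ℝ) : ℝ := 1 - 2 * Real.sin (Real.pi / (2 * T) * x) ^ 2 / sigma T ^ 2

theorem m_ofReal {T : ℝ} (hT : 1 < T) (x : ℝ) : m T (x : ℂ) = (mReal T x : ℝ) := by
  rw [m_eq hT, mReal]
  push_cast
  rfl

theorem mReal_neg (T x : ℝ) : mReal T (-x) = mReal T x := by
  simp [mReal]

theorem cos_eq_mReal {T : ℝ} (hT : 1 < T) (x : ℝ) :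
    Real.cos (Real.pi / T * x) = sigma T ^ 2 * mReal T x + (1 - sigma T ^ 2) := by
  have hs := (sigma_pos hT).ne'
  have e : Real.pi / T * x = 2 * (Real.pi / (2 * T) * x) := by ring
  rw [mReal, e, Real.cos_two_mul, Real.cos_sq']
  field_simp
  ring

/-- On the real line m takes values in [1 - 2/σ², 1], whose left end is the vertex of the ellipse.
Through this lemma every growth estimate over the period is an estimate in the region of index E(T).
-/
theorem norm_mReal_sub_add_norm {T : ℝ} (hT : 1 < T) (x : ℝ) :
    ‖(mReal T x : ℂ) - 1‖ + ‖(mReal T x : ℂ) + 1‖ ≤ E T + (E T)⁻¹ := by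
  have hs := sigma_pos hT
  have hs1 := sigma_lt_one hT
  have h1 : mReal T x ≤ 1 := by
    have : 0 ≤ 2 * Real.sin (Real.pi / (2 * T) * x) ^ 2 / sigma T ^ 2 := by positivity
    rw [mReal]; linarith
  have h2 : 1 - 2 / sigma T ^ 2 ≤ mReal T x := by
    rw [mReal]
    have : 2 * Real.sin (Real.pi / (2 * T) * x) ^ 2 / sigma T ^ 2 ≤ 2 / sigma T ^ 2 := by
      gcongr
      linarith [Real.sin_sq_le_one (Real.pi / (2 * T) * x)]
    linarith
  have h3 : 1 ≤ 1 / sigma T ^ 2 := by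
    rw [le_div_iff₀ (by positivity)]
    nlinarith
  rw [E_add_inv hT, ← Complex.ofReal_one, ← Complex.ofReal_sub, ← Complex.ofReal_add,
    Complex.norm_real, Complex.norm_real, Real.norm_eq_abs, Real.norm_eq_abs,
    abs_of_nonpos (by linarith)]
  have h4 : 4 / sigma T ^ 2 = 4 * (1 / sigma T ^ 2) := by ring
  have h5 : 2 / sigma T ^ 2 = 2 * (1 / sigma T ^ 2) := by ring
  rcases abs_cases (mReal T x + 1) with ⟨h, -⟩ | ⟨h, -⟩ <;> rw [h] <;> linarith

theorem mReal_mem_Icc {T : ℝ} (hT : 1 < T) {x : ℝ} (hx : x ∈ Set.Icc (-1 : ℝ) 1) :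
    mReal T x ∈ Set.Icc (-1 : ℝ) 1 := by
  have hs := sigma_pos hT
  have hpi := Real.pi_pos
  have hle : |Real.sin (Real.pi / (2 * T) * x)| ≤ sigma T := by
    have h0 : 0 < Real.pi / (2 * T) := by positivity
    have h2 : Real.pi / (2 * T) ≤ Real.pi / 2 :=
      div_le_div_of_nonneg_left hpi.le (by norm_num) (by linarith)
    rw [abs_le, sigma, ← Real.sin_neg]
    constructor <;> apply Real.sin_le_sin_of_le_of_le_pi_div_two <;> nlinarith [hx.1, hx.2]
  have h : Real.sin (Real.pi / (2 * T) * x) ^ 2 / sigma T ^ 2 ≤ 1 := by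
    rw [div_le_one (by positivity)]
    exact sq_le_sq' (by linarith [(abs_le.mp hle).1]) (abs_le.mp hle).2
  have h0 : 0 ≤ Real.sin (Real.pi / (2 * T) * x) ^ 2 / sigma T ^ 2 := by positivity
  rw [mReal, mul_div_assoc]
  constructor <;> linarith

/-! ### The extension spaces as pairs of polynomials in `m`. -/

/-- The function `p(m(x)) + sin(π x / T) q(m(x))`. -/
noncomputable def ext (T : ℝ) (p q : ℂ[X]) (x : ℝ) : ℂ :=
  p.eval (mReal T x : ℂ) + (Real.sin (Real.pi / T * x) : ℂ) * q.eval (mReal T x : ℂ)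

theorem continuous_mReal (T : ℝ) : Continuous (mReal T) := by
  unfold mReal; fun_prop

theorem continuous_ext (T : ℝ) (p q : ℂ[X]) : Continuous (ext T p q) := by
  unfold ext
  have h := Complex.continuous_ofReal.comp (continuous_mReal T)
  exact (p.continuous.comp h).add ((by fun_prop : Continuous fun x : ℝ =>
    (Real.sin (Real.pi / T * x) : ℂ)).mul (q.continuous.comp h))

/-- The affine polynomial expressing `cos (π x / T)` through `m(x)`. -/
noncomputable def cosPoly (T : ℝ) : ℂ[X] :=
  Polynomial.C ((sigma T : ℂ) ^ 2) * X + Polynomial.C (1 - (sigma T : ℂ) ^ 2)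

/-- The affine polynomial expressing `m(x)` through `cos (π x / T)`. -/
noncomputable def mPoly (T : ℝ) : ℂ[X] :=
  Polynomial.C (((sigma T : ℂ) ^ 2)⁻¹) * X + Polynomial.C (1 - ((sigma T : ℂ) ^ 2)⁻¹)

theorem eval_cosPoly {T : ℝ} (hT : 1 < T) (x : ℝ) :
    (cosPoly T).eval (mReal T x : ℂ) = (Real.cos (Real.pi / T * x) : ℝ) := by
  rw [cos_eq_mReal hT]; simp [cosPoly]

theorem eval_mPoly {T : ℝ} (hT : 1 < T) (x : ℝ) :
    (mPoly T).eval (Real.cos (Real.pi / T * x) : ℂ) = (mReal T x : ℝ) := by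
  have hs : (sigma T : ℂ) ≠ 0 := by exact_mod_cast (sigma_pos hT).ne'
  rw [cos_eq_mReal hT]; simp [mPoly]; field_simp; ring

theorem degree_comp_linear_lt {p : ℂ[X]} {N : ℕ} (hp : p.degree < N) (a b : ℂ) :
    (p.comp (Polynomial.C a * X + Polynomial.C b)).degree < N := by
  rcases eq_or_ne (p.comp (Polynomial.C a * X + Polynomial.C b)) 0 with h | h
  · rw [h, degree_zero]; exact WithBot.bot_lt_coe N
  have hp0 : p ≠ 0 := by rintro rfl; simp at h
  rw [degree_eq_natDegree h]
  rw [degree_eq_natDegree hp0] at hp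
  have : (p.comp (Polynomial.C a * X + Polynomial.C b)).natDegree ≤ p.natDegree * 1 :=
    natDegree_comp_le.trans (Nat.mul_le_mul_left _ natDegree_linear_le)
  have hp' : p.natDegree < N := by exact_mod_cast hp
  exact_mod_cast (by omega : (p.comp (Polynomial.C a * X + Polynomial.C b)).natDegree < N)

theorem eval_T_comp_cosPoly {T : ℝ} (hT : 1 < T) (n : ℤ) (x : ℝ) :
    ((Chebyshev.T ℂ n).comp (cosPoly T)).eval (mReal T x : ℂ) = (Real.cos (n * Real.pi / T * x) : ℝ) := by
  rw [eval_comp, eval_cosPoly hT, Complex.ofReal_cos, T_complex_cos]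
  push_cast
  congr 1; ring

theorem sin_mul_eval_U_comp_cosPoly {T : ℝ} (hT : 1 < T) (n : ℤ) (x : ℝ) :
    (Real.sin (Real.pi / T * x) : ℂ) * ((U ℂ (n - 1)).comp (cosPoly T)).eval (mReal T x : ℂ)
      = (Real.sin (n * Real.pi / T * x) : ℝ) := by
  rw [eval_comp, eval_cosPoly hT, mul_comm, Complex.ofReal_cos, Complex.ofReal_sin, U_complex_cos]
  push_cast
  congr 1; ring

theorem degree_T_lt {n : ℤ} {N : ℕ} (h : n.natAbs < N) : (Chebyshev.T ℂ n).degree < N := by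
  rw [degree_T]; exact_mod_cast h

/-- The index is an integer so that all frequencies are treated alike: U_{-1} = 0 covers n = 0, and
U_{-n-1} = -U_{n-1} the negative ones. -/
theorem degree_U_sub_one_lt {n : ℤ} {N : ℕ} (h : n.natAbs ≤ N) : (U ℂ (n - 1)).degree < N := by
  by_cases hn : n = 0
  · subst hn; simp
  · rw [degree_U_of_ne_neg_one ℂ _ (by omega)]
    rw [sub_add_cancel]
    have : n.natAbs - 1 < N := by omega
    exact_mod_cast this

theorem ext_sum {ι : Type*} (s : Finset ι) (T : ℝ) (a : ι → ℂ) (p q : ι → ℂ[X]) (x : ℝ) :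
    ext T (∑ i ∈ s, a i • p i) (∑ i ∈ s, a i • q i) x = ∑ i ∈ s, a i * ext T (p i) (q i) x := by
  simp only [ext, eval_finsetSum, eval_smul, smul_eq_mul, mul_add, Finset.sum_add_distrib,
    Finset.mul_sum]
  congr 1
  exact Finset.sum_congr rfl fun _ _ => by ring

theorem degree_sum_smul_lt {ι : Type*} (s : Finset ι) (a : ι → ℂ) (p : ι → ℂ[X]) {N : ℕ}
    (h : ∀ i ∈ s, (p i).degree < N) : (∑ i ∈ s, a i • p i).degree < N := by
  rw [← mem_degreeLT]
  exact Submodule.sum_mem _ fun i hi => Submodule.smul_mem _ _ (mem_degreeLT.mpr (h i hi))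

theorem phi_eq (T : ℝ) (n : ℤ) (x : ℝ) : phi T n x = 1 / (Real.sqrt (2 * T) : ℂ) *
    ((Real.cos (n * Real.pi / T * x) : ℝ) + Complex.I * (Real.sin (n * Real.pi / T * x) : ℝ)) := by
  rw [phi, mul_comm Complex.I, Complex.exp_mul_I]
  push_cast
  ring

/-- cos nθ = T_n(cos θ) and sin nθ = sin θ · U_{n-1}(cos θ), with cos θ affine in m(x). The sines
lose one degree, hence the smaller bound for q. -/
theorem exists_ext_eq_contSum {T : ℝ} (hT : 1 < T) (N : ℕ)
    (a : EuclideanSpace ℂ (Finset.Icc (-(N : ℤ)) N)) :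
    ∃ p q : ℂ[X], p.degree < (N + 1 : ℕ) ∧ q.degree < (N : ℕ) ∧ contSum T N a = ext T p q := by
  have hdeg : ∀ n : Finset.Icc (-(N : ℤ)) N, (n : ℤ).natAbs ≤ N := by
    rintro ⟨n, hn⟩
    rw [Finset.mem_Icc] at hn
    simp only; omega
  refine ⟨∑ n : Finset.Icc (-(N : ℤ)) N, (a n * (1 / (Real.sqrt (2 * T) : ℂ))) •
      (Chebyshev.T ℂ n).comp (cosPoly T),
    ∑ n : Finset.Icc (-(N : ℤ)) N, (a n * (1 / (Real.sqrt (2 * T) : ℂ))) •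
      Complex.I • (U ℂ (n - 1)).comp (cosPoly T), ?_, ?_, ?_⟩
  · exact degree_sum_smul_lt _ _ _ fun n _ =>
      degree_comp_linear_lt (degree_T_lt (Nat.lt_succ_of_le (hdeg n))) _ _
  · refine degree_sum_smul_lt _ _ _ fun n _ => ?_
    rw [degree_smul_of_smul_regular _ (IsSMulRegular.of_ne_zero Complex.I_ne_zero)]
    exact degree_comp_linear_lt (degree_U_sub_one_lt (hdeg n)) _ _
  · ext x
    rw [ext_sum, contSum]
    refine Finset.sum_congr rfl fun n _ => ?_
    rw [ext, eval_T_comp_cosPoly hT, eval_smul, smul_eq_mul, mul_left_comm _ Complex.I,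
      sin_mul_eval_U_comp_cosPoly hT, phi_eq]
    ring

/-- Here the sines go up to frequency N + 1, so both polynomials may have degree N and the parameter
count matches the 2N + 2 nodes. -/
theorem exists_ext_eq_discSum {T : ℝ} (hT : 1 < T) (N : ℕ)
    (a : EuclideanSpace ℂ (Finset.Icc (-(N : ℤ) - 1) N)) :
    ∃ p q : ℂ[X], p.degree < (N + 1 : ℕ) ∧ q.degree < (N + 1 : ℕ) ∧ discSum T N a = ext T p q := by
  refine ⟨∑ n : Finset.Icc (-(N : ℤ) - 1) N, a n •
      (if 0 ≤ (n : ℤ) then (Chebyshev.T ℂ n).comp (cosPoly T) else 0),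
    ∑ n : Finset.Icc (-(N : ℤ) - 1) N, a n •
      (if 0 ≤ (n : ℤ) then 0 else (U ℂ (-n - 1)).comp (cosPoly T)), ?_, ?_, ?_⟩
  · refine degree_sum_smul_lt _ _ _ fun n _ => ?_
    split_ifs with h
    · refine degree_comp_linear_lt (degree_T_lt ?_) _ _
      have := n.2
      rw [Finset.mem_Icc] at this
      omega
    · rw [degree_zero]; exact WithBot.bot_lt_coe _
  · refine degree_sum_smul_lt _ _ _ fun n _ => ?_
    split_ifs with h
    · rw [degree_zero]; exact WithBot.bot_lt_coe _
    · refine degree_comp_linear_lt (degree_U_sub_one_lt ?_) _ _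
      have := n.2
      rw [Finset.mem_Icc] at this
      omega
  · ext x
    rw [ext_sum, discSum]
    refine Finset.sum_congr rfl fun n _ => ?_
    rw [ext, trig]
    split_ifs with h
    · rw [eval_T_comp_cosPoly hT]; simp
    · rw [sin_mul_eval_U_comp_cosPoly hT]; simp

/-- The converse direction: substituting the inverse affine map re-expands p in `T_j` and q in `U_j`
of cos(πx/T). An arbitrary submodule W serves the exponential and the trigonometric basis at once.
-/
theorem ext_mem_of_cos_sin {T : ℝ} (hT : 1 < T) {M N : ℕ} (W : Submodule ℂ (ℝ → ℂ))
    (hcos : ∀ j : ℕ, j < M → (fun x : ℝ => ((Real.cos (j * Real.pi / T * x) : ℝ) : ℂ)) ∈ W)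
    (hsin : ∀ j : ℕ, j < N → (fun x : ℝ => ((Real.sin ((j + 1) * Real.pi / T * x) : ℝ) : ℂ)) ∈ W)
    {p q : ℂ[X]} (hp : p.degree < M) (hq : q.degree < N) : ext T p q ∈ W := by
  obtain ⟨a, ha⟩ := exists_eq_sum_of_degree_lt (S := fun n => Chebyshev.T ℂ n)
    (fun n => by simp) M (p.comp (mPoly T)) (degree_comp_linear_lt hp _ _)
  obtain ⟨b, hb⟩ := exists_eq_sum_of_degree_lt (degree_U_natCast ℂ) N (q.comp (mPoly T))
    (degree_comp_linear_lt hq _ _)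
  have e : ext T p q = ∑ j ∈ Finset.range M,
      a j • (fun x : ℝ => ((Real.cos (j * Real.pi / T * x) : ℝ) : ℂ)) +
      ∑ j ∈ Finset.range N, b j •
        (fun x : ℝ => ((Real.sin ((j + 1) * Real.pi / T * x) : ℝ) : ℂ)) := by
    ext x
    have hpx := congrArg (eval (Real.cos (Real.pi / T * x) : ℂ)) ha
    have hqx := congrArg (eval (Real.cos (Real.pi / T * x) : ℂ)) hb
    rw [eval_comp, eval_mPoly hT] at hpx hqx
    simp only [Pi.add_apply, Finset.sum_apply, Pi.smul_apply, smul_eq_mul]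
    rw [ext, hpx, hqx, eval_finsetSum, eval_finsetSum, Finset.mul_sum]
    congr 1
    · refine Finset.sum_congr rfl fun j _ => ?_
      rw [eval_mul, eval_C, Complex.ofReal_cos, T_complex_cos]
      push_cast; congr 2; ring
    · refine Finset.sum_congr rfl fun j _ => ?_
      rw [eval_mul, eval_C, mul_left_comm, mul_comm (Complex.ofReal (Real.sin _)),
        eval_U_cos_mul_sin]
      congr 3; ring
  rw [e]
  exact Submodule.add_mem _
    (Submodule.sum_mem _ fun j hj => Submodule.smul_mem _ _ (hcos j (Finset.mem_range.mp hj)))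
    (Submodule.sum_mem _ fun j hj => Submodule.smul_mem _ _ (hsin j (Finset.mem_range.mp hj)))

theorem exists_contSum_eq_ext {T : ℝ} (hT : 1 < T) (N : ℕ) {p q : ℂ[X]}
    (hp : p.degree < (N + 1 : ℕ)) (hq : q.degree < N) :
    ∃ a : EuclideanSpace ℂ (Finset.Icc (-(N : ℤ)) N), contSum T N a = ext T p q := by
  set W := Submodule.span ℂ (Set.range fun n : Finset.Icc (-(N : ℤ)) N => phi T n) with hW
  have hphi : ∀ n : ℤ, n.natAbs ≤ N → phi T n ∈ W := fun n hn =>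
    Submodule.subset_span ⟨⟨n, by rw [Finset.mem_Icc]; omega⟩, rfl⟩
  have hs : (Real.sqrt (2 * T) : ℂ) ≠ 0 := by
    exact_mod_cast (Real.sqrt_pos.mpr (by linarith : 0 < 2 * T)).ne'
  have hmem : ext T p q ∈ W := by
    refine ext_mem_of_cos_sin hT W (fun j hj => ?_) (fun j hj => ?_) hp hq
    · convert W.smul_mem ((Real.sqrt (2 * T) : ℂ) / 2)
        (W.add_mem (hphi j (by omega)) (hphi (-j) (by omega))) using 1
      ext x
      simp only [Pi.smul_apply, Pi.add_apply, phi_eq, smul_eq_mul]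
      push_cast
      rw [neg_mul, neg_div, neg_mul, Complex.cos_neg, Complex.sin_neg]
      field_simp
      ring
    · convert W.smul_mem ((Real.sqrt (2 * T) : ℂ) / (2 * Complex.I))
        (W.sub_mem (hphi (j + 1 : ℕ) (by omega)) (hphi (-(j + 1 : ℕ)) (by omega))) using 1
      ext x
      simp only [Pi.smul_apply, Pi.sub_apply, phi_eq, smul_eq_mul]
      push_cast
      rw [neg_mul, neg_div, neg_mul, Complex.cos_neg, Complex.sin_neg]
      field_simp
      ring
  obtain ⟨a, ha⟩ := (Submodule.mem_span_range_iff_exists_fun ℂ).mp hmem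
  refine ⟨WithLp.toLp 2 a, ?_⟩
  rw [← ha]
  ext x
  simp [contSum]

theorem exists_discSum_eq_ext {T : ℝ} (hT : 1 < T) (N : ℕ) {p q : ℂ[X]}
    (hp : p.degree < (N + 1 : ℕ)) (hq : q.degree < (N + 1 : ℕ)) :
    ∃ a : EuclideanSpace ℂ (Finset.Icc (-(N : ℤ) - 1) N), discSum T N a = ext T p q := by
  set W := Submodule.span ℂ (Set.range fun n : Finset.Icc (-(N : ℤ) - 1) N =>
    fun x : ℝ => (trig T n x : ℂ)) with hW
  have htrig : ∀ n : ℤ, n ∈ Finset.Icc (-(N : ℤ) - 1) N → (fun x : ℝ => (trig T n x : ℂ)) ∈ W :=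
    fun n hn => Submodule.subset_span ⟨⟨n, hn⟩, rfl⟩
  have hmem : ext T p q ∈ W := by
    refine ext_mem_of_cos_sin hT W (fun j hj => ?_) (fun j hj => ?_) hp hq
    · convert htrig j (by rw [Finset.mem_Icc]; omega) using 3 with x
      simp [trig]
    · convert htrig (-(j + 1 : ℕ)) (by rw [Finset.mem_Icc]; push_cast; omega) using 3 with x
      rw [trig, if_neg (by push_cast; omega)]
      push_cast
      ring_nf
  obtain ⟨a, ha⟩ := (Submodule.mem_span_range_iff_exists_fun ℂ).mp hmem
  refine ⟨WithLp.toLp 2 a, ?_⟩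
  rw [← ha]
  ext x
  simp [discSum]

/-! ### Coefficients bounded by the supremum over a full period. -/

/-- Bessel's bound for the coefficients of a finite orthogonal sum. -/
theorem norm_coeff_le_of_orthogonal {ι : Type*} [Fintype ι] [DecidableEq ι] {T d S : ℝ} (hT : 0 < T)
    {g : ι → ℝ → ℂ} (hg : ∀ i, Continuous (g i)) {D : ι → ℝ} (hd : ∀ i, d ≤ D i)
    (horth : ∀ i j, ∫ x in (-T)..T, g i x * (starRingEnd ℂ) (g j x) = if i = j then (D i : ℂ) else 0)
    (a : EuclideanSpace ℂ ι) (hS : ∀ x ∈ Set.Icc (-T) T, ‖∑ i, a i * g i x‖ ≤ S) :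
    d * ‖a‖ ^ 2 ≤ 2 * T * S ^ 2 := by
  have h1 : ∫ x in (-T)..T, ((‖∑ i, a i * g i x‖ ^ 2 : ℝ) : ℂ) = ((∑ i, ‖a i‖ ^ 2 * D i : ℝ) : ℂ) := by
    have e : ∀ x : ℝ, ((‖∑ i, a i * g i x‖ ^ 2 : ℝ) : ℂ) = ∑ i, ∑ j, a i * (starRingEnd ℂ) (a j) *
        (g i x * (starRingEnd ℂ) (g j x)) := by
      intro x
      rw [← Complex.normSq_eq_norm_sq, ← Complex.mul_conj, map_sum, Finset.sum_mul_sum]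
      refine Finset.sum_congr rfl fun i _ => Finset.sum_congr rfl fun j _ => ?_
      rw [map_mul]; ring
    simp_rw [e]
    have hc : ∀ i j, Continuous fun x => a i * (starRingEnd ℂ) (a j) *
        (g i x * (starRingEnd ℂ) (g j x)) := fun i j =>
      continuous_const.mul ((hg i).mul (Complex.continuous_conj.comp (hg j)))
    rw [intervalIntegral.integral_finsetSum fun i _ =>
      (Continuous.intervalIntegrable (continuous_finsetSum _ fun j _ => hc i j) _ _)]
    push_cast
    refine Finset.sum_congr rfl fun i _ => ?_
    rw [intervalIntegral.integral_finsetSum fun j _ => (hc i j).intervalIntegrable _ _]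
    simp_rw [intervalIntegral.integral_const_mul, horth]
    rw [Finset.sum_eq_single i]
    · rw [if_pos rfl, Complex.mul_conj, Complex.normSq_eq_norm_sq]; push_cast; rfl
    · intro j _ hj; rw [if_neg (Ne.symm hj), mul_zero]
    · simp
  rw [intervalIntegral.integral_ofReal] at h1
  have h2 : ∫ x in (-T)..T, ‖∑ i, a i * g i x‖ ^ 2 = ∑ i, ‖a i‖ ^ 2 * D i := by exact_mod_cast h1
  rw [EuclideanSpace.norm_sq_eq, Finset.mul_sum]
  calc _ ≤ ∑ i, ‖a i‖ ^ 2 * D i := Finset.sum_le_sum fun i _ => by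
        rw [mul_comm]; exact mul_le_mul_of_nonneg_left (hd i) (by positivity)
    _ = ∫ x in (-T)..T, ‖∑ i, a i * g i x‖ ^ 2 := h2.symm
    _ ≤ ∫ _ in (-T)..T, S ^ 2 := by
        refine intervalIntegral.integral_mono_on (by linarith)
          (Continuous.intervalIntegrable ?_ _ _) (by simp) fun x hx => ?_
        · exact ((continuous_finsetSum _ fun i _ => continuous_const.mul (hg i)).norm).pow 2
        · exact pow_le_pow_left₀ (norm_nonneg _) (hS x hx) 2
    _ = _ := by rw [intervalIntegral.integral_const, smul_eq_mul]; ring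

theorem integral_cos_period {T : ℝ} (hT : 0 < T) (k : ℤ) :
    ∫ x in (-T)..T, Real.cos (k * Real.pi / T * x) = if k = 0 then 2 * T else 0 := by
  split_ifs with h
  · simp [h]; ring
  · have hk : (k : ℝ) * Real.pi / T ≠ 0 := by
      have : (k : ℝ) ≠ 0 := by exact_mod_cast h
      have := Real.pi_pos.ne'
      positivity
    rw [intervalIntegral.integral_comp_mul_left (fun x => Real.cos x) hk, integral_cos]
    have : (k : ℝ) * Real.pi / T * T = k * Real.pi := by field_simp
    rw [mul_neg, this]
    simp

theorem integral_sin_period {T : ℝ} (hT : 0 < T) (k : ℤ) :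
    ∫ x in (-T)..T, Real.sin (k * Real.pi / T * x) = 0 := by
  by_cases h : k = 0
  · simp [h]
  · have hk : (k : ℝ) * Real.pi / T ≠ 0 := by
      have : (k : ℝ) ≠ 0 := by exact_mod_cast h
      have := Real.pi_pos.ne'
      positivity
    rw [intervalIntegral.integral_comp_mul_left (fun x => Real.sin x) hk, integral_sin]
    simp

/-- The exponentials are orthonormal on (-T,T), though not on (-1,1). Bessel gives ‖a‖² ≤ 2T S²,
relaxed to (2T S)² since 2T > 1. -/
theorem norm_le_of_contSum_le {T S : ℝ} (hT : 1 < T) {N : ℕ}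
    (a : EuclideanSpace ℂ (Finset.Icc (-(N : ℤ)) N)) (hS0 : 0 ≤ S)
    (hS : ∀ x ∈ Set.Icc (-T) T, ‖contSum T N a x‖ ≤ S) : ‖a‖ ≤ 2 * T * S := by
  have hT0 : 0 < T := by linarith
  have horth : ∀ i j : Finset.Icc (-(N : ℤ)) N,
      ∫ x in (-T)..T, phi T i x * (starRingEnd ℂ) (phi T j x)
        = if i = j then ((1 : ℝ) : ℂ) else 0 := by
    intro i j
    have e : ∀ x : ℝ, phi T i x * (starRingEnd ℂ) (phi T j x) = 1 / (2 * T) *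
        (((Real.cos (((i - j : ℤ) : ℝ) * Real.pi / T * x) : ℝ) : ℂ) +
          Complex.I * ((Real.sin (((i - j : ℤ) : ℝ) * Real.pi / T * x) : ℝ) : ℂ)) := by
      intro x
      have h1 : (((i : ℤ) - (j : ℤ) : ℤ) : ℝ) * Real.pi / T * x
          = (i : ℤ) * Real.pi / T * x - (j : ℤ) * Real.pi / T * x := by push_cast; ring
      have h2 : (Real.sqrt (2 * T) : ℂ) * (Real.sqrt (2 * T) : ℂ) = 2 * T := by
        exact_mod_cast Real.mul_self_sqrt (by linarith : (0 : ℝ) ≤ 2 * T)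
      rw [phi_eq, phi_eq, h1, Real.cos_sub, Real.sin_sub]
      simp only [map_mul, map_add, map_div₀, map_one, Complex.conj_ofReal, Complex.conj_I]
      rw [← h2]
      push_cast
      linear_combination (-(1 / ((Real.sqrt (2 * T) : ℂ) * (Real.sqrt (2 * T) : ℂ)) *
        Complex.sin ((i : ℤ) * Real.pi / T * x) * Complex.sin ((j : ℤ) * Real.pi / T * x))) *
        Complex.I_mul_I
    simp_rw [e]
    rw [intervalIntegral.integral_const_mul, intervalIntegral.integral_add
      (Continuous.intervalIntegrable (by fun_prop) _ _)
      (Continuous.intervalIntegrable (by fun_prop) _ _), intervalIntegral.integral_const_mul,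
      intervalIntegral.integral_ofReal, intervalIntegral.integral_ofReal, integral_cos_period hT0,
      integral_sin_period hT0]
    have : (T : ℂ) ≠ 0 := by exact_mod_cast hT0.ne'
    by_cases h : i = j
    · subst h; simp; field_simp
    · have : (i : ℤ) - (j : ℤ) ≠ 0 := fun h' => h (Subtype.ext (by omega))
      simp [h, this]
  have h := norm_coeff_le_of_orthogonal hT0 (d := 1) (S := S) (D := fun _ => 1)
    (g := fun n : Finset.Icc (-(N : ℤ)) N => phi T n)
    (fun n => by unfold phi; fun_prop) (fun _ => le_rfl) horth a hS
  refine abs_le_of_sq_le_sq' ?_ (by positivity) |>.2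
  nlinarith [sq_nonneg S]

/-- Product-to-sum formulas give orthogonality with squared norm T, except 2T for the constant
function; T is the common lower bound. -/
theorem norm_le_of_discSum_le {T S : ℝ} (hT : 1 < T) {N : ℕ}
    (a : EuclideanSpace ℂ (Finset.Icc (-(N : ℤ) - 1) N)) (hS0 : 0 ≤ S)
    (hS : ∀ x ∈ Set.Icc (-T) T, ‖discSum T N a x‖ ≤ S) : ‖a‖ ≤ 2 * S := by
  have hT0 : 0 < T := by linarith
  have horth : ∀ i j : Finset.Icc (-(N : ℤ) - 1) N,
      ∫ x in (-T)..T, (trig T i x : ℂ) * (starRingEnd ℂ) (trig T j x : ℂ)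
        = if i = j then (((if (i : ℤ) = 0 then 2 * T else T) : ℝ) : ℂ) else 0 := by
    rintro ⟨i, hi⟩ ⟨j, hj⟩
    have hint : ∀ k l : ℤ, ∀ s t : ℝ, ∫ x in (-T)..T, (s * Real.cos (k * Real.pi / T * x)
        + t * Real.cos (l * Real.pi / T * x))
        = s * (if k = 0 then 2 * T else 0) + t * (if l = 0 then 2 * T else 0) := by
      intro k l s t
      rw [intervalIntegral.integral_add (Continuous.intervalIntegrable (by fun_prop) _ _)
        (Continuous.intervalIntegrable (by fun_prop) _ _), intervalIntegral.integral_const_mul,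
        intervalIntegral.integral_const_mul, integral_cos_period hT0, integral_cos_period hT0]
    have hint' : ∀ k l : ℤ, ∀ s t : ℝ, ∫ x in (-T)..T, (s * Real.sin (k * Real.pi / T * x)
        + t * Real.sin (l * Real.pi / T * x)) = 0 := by
      intro k l s t
      rw [intervalIntegral.integral_add (Continuous.intervalIntegrable (by fun_prop) _ _)
        (Continuous.intervalIntegrable (by fun_prop) _ _), intervalIntegral.integral_const_mul,
        intervalIntegral.integral_const_mul, integral_sin_period hT0, integral_sin_period hT0]
      simp
    have hreal : ∫ x in (-T)..T, trig T i x * trig T j x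
        = if i = j then (if i = 0 then 2 * T else T) else 0 := by
      have hsum : ∀ x : ℝ, ((i + j : ℤ) : ℝ) * Real.pi / T * x
          = i * Real.pi / T * x + j * Real.pi / T * x := fun x => by push_cast; ring
      have hdif : ∀ x : ℝ, ((i - j : ℤ) : ℝ) * Real.pi / T * x
          = i * Real.pi / T * x - j * Real.pi / T * x := fun x => by push_cast; ring
      have hneg : ∀ n : ℤ, ∀ x : ℝ, -(n : ℝ) * Real.pi / T * x = -(n * Real.pi / T * x) :=
        fun n x => by ring
      by_cases h0 : 0 ≤ i <;> by_cases h1 : 0 ≤ j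
      · have e : ∀ x, trig T i x * trig T j x =
            1 / 2 * Real.cos ((i - j : ℤ) * Real.pi / T * x)
              + 1 / 2 * Real.cos ((i + j : ℤ) * Real.pi / T * x) := by
          intro x
          rw [trig, trig, if_pos h0, if_pos h1, hsum, hdif, Real.cos_add, Real.cos_sub]
          ring
        simp_rw [e, hint]
        by_cases hij : i = j
        · subst hij
          by_cases hi0 : i = 0
          · simp [hi0]; ring
          · rw [if_pos (sub_self i), if_neg (by omega), if_pos rfl, if_neg hi0]; ring
        · rw [if_neg (by omega), if_neg (by omega), if_neg hij]; ring
      · have e : ∀ x, trig T i x * trig T j x =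
            1 / 2 * Real.sin ((i - j : ℤ) * Real.pi / T * x)
              + (-1 / 2) * Real.sin ((i + j : ℤ) * Real.pi / T * x) := by
          intro x
          rw [trig, trig, if_pos h0, if_neg h1, hsum, hdif, Real.sin_add, Real.sin_sub, hneg,
            Real.sin_neg]
          ring
        simp_rw [e, hint']
        rw [if_neg (by omega)]
      · have e : ∀ x, trig T i x * trig T j x =
            (-1 / 2) * Real.sin ((i - j : ℤ) * Real.pi / T * x)
              + (-1 / 2) * Real.sin ((i + j : ℤ) * Real.pi / T * x) := by
          intro x
          rw [trig, trig, if_neg h0, if_pos h1, hsum, hdif, Real.sin_add, Real.sin_sub, hneg,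
            Real.sin_neg]
          ring
        simp_rw [e, hint']
        rw [if_neg (by omega)]
      · have e : ∀ x, trig T i x * trig T j x =
            1 / 2 * Real.cos ((i - j : ℤ) * Real.pi / T * x)
              + (-1 / 2) * Real.cos ((i + j : ℤ) * Real.pi / T * x) := by
          intro x
          rw [trig, trig, if_neg h0, if_neg h1, hsum, hdif, Real.cos_add, Real.cos_sub, hneg, hneg,
            Real.sin_neg, Real.sin_neg]
          ring
        simp_rw [e, hint]
        rw [if_neg (by omega : ¬ i + j = 0)]
        by_cases hij : i = j
        · subst hij
          rw [if_pos (sub_self i), if_pos rfl, if_neg (by omega)]; ring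
        · rw [if_neg (by omega), if_neg hij]; ring
    have e : ∀ x, (trig T i x : ℂ) * (starRingEnd ℂ) (trig T j x : ℂ)
        = ((trig T i x * trig T j x : ℝ) : ℂ) := fun x => by
      rw [Complex.conj_ofReal]; push_cast; rfl
    simp_rw [e]
    rw [intervalIntegral.integral_ofReal, hreal]
    by_cases hij : i = j
    · simp [hij]
    · simp [hij]
  have h := norm_coeff_le_of_orthogonal hT0 (d := T) (S := S)
    (D := fun n : Finset.Icc (-(N : ℤ) - 1) N => if (n : ℤ) = 0 then 2 * T else T)
    (g := fun (n : Finset.Icc (-(N : ℤ) - 1) N) x => (trig T n x : ℂ))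
    (fun n => by unfold trig; split_ifs <;> fun_prop)
    (fun n => by split_ifs <;> linarith) horth a hS
  refine abs_le_of_sq_le_sq' ?_ (by positivity) |>.2
  have h2 : ‖a‖ ^ 2 ≤ 2 * S ^ 2 := le_of_mul_le_mul_left (by linarith) hT0
  nlinarith [sq_nonneg S]

end FourierExtension

/-! ### Growth from [-1, 1] to the period, and interpolation at the mapped nodes. -/

namespace FourierExtension

open Polynomial Polynomial.Chebyshev

theorem hasDerivAt_mReal {T : ℝ} (x : ℝ) :
    HasDerivAt (mReal T) (-(Real.pi / (T * sigma T ^ 2) * Real.sin (Real.pi / T * x))) x := by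
  have h1 : HasDerivAt (fun x : ℝ => Real.pi / (2 * T) * x) (Real.pi / (2 * T)) x := by
    simpa using (hasDerivAt_id x).const_mul (Real.pi / (2 * T))
  have h2 := (((h1.sin.pow 2).const_mul 2).div_const (sigma T ^ 2)).const_sub 1
  have e : Real.pi / T * x = 2 * (Real.pi / (2 * T) * x) := by ring
  refine HasDerivAt.congr_deriv (f := mReal T) h2 ?_
  rw [e, Real.sin_two_mul]
  by_cases hT : T = 0
  · simp [hT]
  · field_simp
    simp
    ring

/-- Both sides are the integral of g over [-1,1], through z = cos θ and through z = m(x). The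
Jacobian turns the weight sin θ into a multiple of sin(πx/T). -/
theorem integral_cos_eq_integral_mReal {T : ℝ} (hT : 1 < T) {g : ℝ → ℝ} (hg : Continuous g) :
    ∫ θ in (0 : ℝ)..Real.pi, g (Real.cos θ) * Real.sin θ
      = Real.pi / (T * sigma T ^ 2) *
        ∫ x in (0 : ℝ)..1, g (mReal T x) * Real.sin (Real.pi / T * x) := by
  have h1 := intervalIntegral.integral_comp_mul_deriv (a := 0) (b := Real.pi) (g := g)
    (fun θ _ => Real.hasDerivAt_cos θ) (by fun_prop) hg
  have h2 := intervalIntegral.integral_comp_mul_deriv (a := 0) (b := 1) (g := g)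
    (fun x _ => hasDerivAt_mReal (T := T) x) (by fun_prop) hg
  have e0 : mReal T 0 = 1 := by simp [mReal]
  have e1 : mReal T 1 = -1 := by
    have := (sigma_pos hT).ne'
    rw [mReal, mul_one, ← sigma]
    field_simp; norm_num
  rw [e0, e1] at h2
  rw [Real.cos_zero, Real.cos_pi, ← h2] at h1
  simp only [Function.comp_apply, mul_neg, intervalIntegral.integral_neg, neg_inj] at h1
  rw [h1, ← intervalIntegral.integral_const_mul]
  exact intervalIntegral.integral_congr fun x _ => by ring

theorem l2Norm_nonneg (g : ℝ → ℂ) : 0 ≤ l2Norm g := Real.sqrt_nonneg _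

theorem l2Norm_sq (g : ℝ → ℂ) : l2Norm g ^ 2 = ∫ x in (-1 : ℝ)..1, ‖g x‖ ^ 2 :=
  Real.sq_sqrt (intervalIntegral.integral_nonneg (by norm_num) fun _ _ => by positivity)

theorem integral_norm_le_l2Norm {g : ℝ → ℂ} (hg : Continuous g) :
    ∫ x in (-1 : ℝ)..1, ‖g x‖ ≤ 2 * l2Norm g := by
  set A := ∫ x in (-1 : ℝ)..1, ‖g x‖ with hA
  -- Cauchy–Schwarz as nonnegativity of the variance about the mean A/2; the sharp constant √2 is
  -- relaxed to 2.
  have h : 0 ≤ ∫ x in (-1 : ℝ)..1, (‖g x‖ - A / 2) ^ 2 :=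
    intervalIntegral.integral_nonneg (by norm_num) fun _ _ => by positivity
  have e : ∫ x in (-1 : ℝ)..1, (‖g x‖ - A / 2) ^ 2 = l2Norm g ^ 2 - A ^ 2 / 2 := by
    have : ∀ x, (‖g x‖ - A / 2) ^ 2 = ‖g x‖ ^ 2 - A * ‖g x‖ + A ^ 2 / 4 := fun x => by ring
    simp_rw [this]
    rw [intervalIntegral.integral_add (Continuous.intervalIntegrable (by fun_prop) _ _)
      (Continuous.intervalIntegrable (by fun_prop) _ _), intervalIntegral.integral_sub
      (Continuous.intervalIntegrable (by fun_prop) _ _)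
      (Continuous.intervalIntegrable (by fun_prop) _ _), intervalIntegral.integral_const_mul,
      ← hA, l2Norm_sq, intervalIntegral.integral_const, smul_eq_mul]
    ring
  rw [e] at h
  refine abs_le_of_sq_le_sq' ?_ (by linarith [l2Norm_nonneg g]) |>.2
  nlinarith [sq_nonneg (l2Norm g)]

/-- Since m is even and the sine odd, the two summands of `ext` are its even and odd parts, so a
bound on `ext` controls each separately. -/
theorem eval_mReal_eq (T : ℝ) (p q : ℂ[X]) (x : ℝ) :
    p.eval (mReal T x : ℂ) = (ext T p q x + ext T p q (-x)) / 2 := by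
  simp [ext, mReal_neg]; ring

theorem sin_mul_eval_mReal_eq (T : ℝ) (p q : ℂ[X]) (x : ℝ) :
    (Real.sin (Real.pi / T * x) : ℂ) * q.eval (mReal T x : ℂ)
      = (ext T p q x - ext T p q (-x)) / 2 := by
  simp [ext, mReal_neg]

theorem norm_ext_le_of_norm_eval_le {T B₁ B₂ x : ℝ} {p q : ℂ[X]}
    (hp : ‖p.eval (mReal T x : ℂ)‖ ≤ B₁) (hq : ‖q.eval (mReal T x : ℂ)‖ ≤ B₂) :
    ‖ext T p q x‖ ≤ B₁ + B₂ := by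
  refine (norm_add_le _ _).trans (add_le_add hp ?_)
  rw [norm_mul, Complex.norm_real, Real.norm_eq_abs]
  exact (mul_le_of_le_one_left (norm_nonneg _) (Real.abs_sin_le_one _)).trans hq

theorem sin_pos_of_mem {T : ℝ} (hT : 1 < T) {x : ℝ} (hx : 0 < x) (hx1 : x ≤ 1) :
    0 < Real.sin (Real.pi / T * x) := by
  have hpi := Real.pi_pos
  refine Real.sin_pos_of_pos_of_lt_pi (by positivity) ?_
  rw [div_mul_eq_mul_div, div_lt_iff₀ (by linarith)]
  nlinarith

/-- Growth of the elements of the extension spaces outside `[-1, 1]`, in terms of the `L²` norm. -/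
theorem norm_ext_le_l2Norm {T : ℝ} (hT : 1 < T) {N : ℕ} {p q : ℂ[X]}
    (hp : p.degree < (N + 1 : ℕ)) (hq : q.degree < (N + 1 : ℕ)) (x : ℝ) :
    ‖ext T p q x‖ ≤ 4 * (Real.pi / (T * sigma T ^ 2)) * (E T / (E T - 1)) ^ 2
      * l2Norm (ext T p q) * E T ^ N := by
  have hE := one_lt_E hT
  have hpi := Real.pi_pos
  set D := Real.pi / (T * sigma T ^ 2) with hD
  have hD0 : 0 ≤ D := by have := sigma_pos hT; positivity
  have hc := continuous_ext T p q
  have hm := Complex.continuous_ofReal.comp (continuous_mReal T)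
  have hbound : ∫ x in (0 : ℝ)..1, (‖ext T p q x‖ + ‖ext T p q (-x)‖) ≤ 2 * l2Norm (ext T p q) := by
    refine le_trans (le_of_eq ?_) (integral_norm_le_l2Norm hc)
    rw [intervalIntegral.integral_add (Continuous.intervalIntegrable (by fun_prop) _ _)
      (Continuous.intervalIntegrable (by fun_prop) _ _),
      intervalIntegral.integral_comp_neg (fun x => ‖ext T p q x‖), neg_zero, add_comm,
      intervalIntegral.integral_add_adjacent_intervals
      (Continuous.intervalIntegrable (by fun_prop) _ _)
      (Continuous.intervalIntegrable (by fun_prop) _ _)]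
  -- Only r(m(y)) sin(πy/T) must be bounded. For r = q this is exactly the odd part, so the zero of
  -- the sine at the origin is never divided out.
  have key : ∀ r : ℂ[X], r.degree < (N + 1 : ℕ) →
      (∀ x ∈ Set.Icc (0 : ℝ) 1, ‖r.eval (mReal T x : ℂ)‖ * Real.sin (Real.pi / T * x)
        ≤ ‖ext T p q x‖ + ‖ext T p q (-x)‖) →
      ‖r.eval (mReal T x : ℂ)‖ ≤ D * (2 * l2Norm (ext T p q)) * (E T / (E T - 1)) ^ 2 * E T ^ N := by
    intro r hr hle
    refine (norm_eval_le_integral hE (norm_mReal_sub_add_norm hT x) hr).trans ?_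
    have hg : Continuous fun z : ℝ => ‖r.eval (z : ℂ)‖ :=
      (r.continuous.comp Complex.continuous_ofReal).norm
    rw [integral_cos_eq_integral_mReal hT hg, ← hD]
    gcongr
    refine le_trans ?_ hbound
    refine intervalIntegral.integral_mono_on (by norm_num)
      (Continuous.intervalIntegrable ((hg.comp (continuous_mReal T)).mul (by fun_prop)) _ _)
      (Continuous.intervalIntegrable (by fun_prop) _ _) hle
  refine (norm_ext_le_of_norm_eval_le (key p hp ?_) (key q hq ?_)).trans (le_of_eq (by ring))
  · intro y _
    rw [eval_mReal_eq T p q, norm_div, Complex.norm_two]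
    have h1 := norm_add_le (ext T p q y) (ext T p q (-y))
    have h2 := Real.sin_le_one (Real.pi / T * y)
    calc _ ≤ ‖ext T p q y + ext T p q (-y)‖ / 2 * 1 := by gcongr
      _ ≤ _ := by linarith [norm_nonneg (ext T p q y + ext T p q (-y))]
  · intro y hy
    have hs : 0 ≤ Real.sin (Real.pi / T * y) := by
      rcases hy.1.eq_or_lt with h | h
      · simp [← h]
      · exact (sin_pos_of_mem hT h hy.2).le
    have e : ‖q.eval (mReal T y : ℂ)‖ * Real.sin (Real.pi / T * y)
        = ‖(ext T p q y - ext T p q (-y)) / 2‖ := by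
      rw [← sin_mul_eval_mReal_eq, norm_mul, Complex.norm_real, Real.norm_eq_abs, abs_of_nonneg hs,
        mul_comm]
    rw [e, norm_div, Complex.norm_two]
    have h1 := norm_sub_le (ext T p q y) (ext T p q (-y))
    linarith [norm_nonneg (ext T p q y - ext T p q (-y))]

/-- The arccosine is taken of σ² cos t + (1 - σ²), which is the affine relation between cos(πx/T)
and m(x), so m maps the node to the Chebyshev node. This argument lies in [c(T), 1), which places
the node in (0,1]. -/
theorem nodeAux_spec {T : ℝ} (hT : 1 < T) {N n : ℕ} (hn : n ≤ N) :
    0 < nodeAux T N n ∧ nodeAux T N n ≤ 1 ∧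
      mReal T (nodeAux T N n) = Real.cos ((2 * n + 1) * Real.pi / (2 * N + 2)) := by
  have hpi := Real.pi_pos
  have hs := sigma_pos hT
  have hs1 := sigma_lt_one hT
  have hT0 : 0 < T := by linarith
  set t := (2 * n + 1) * Real.pi / (2 * N + 2) with ht
  have ht0 : 0 < t := by positivity
  have htpi : t < Real.pi := by
    rw [ht, div_lt_iff₀ (by positivity)]
    have : (n : ℝ) ≤ N := by exact_mod_cast hn
    nlinarith
  have hlt : Real.cos t < 1 := by
    rw [← Real.cos_zero]
    exact Real.cos_lt_cos_of_nonneg_of_le_pi le_rfl htpi.le ht0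
  have hge : -1 ≤ Real.cos t := Real.neg_one_le_cos t
  set y := 1 / 2 * (1 - c T) * Real.cos t + 1 / 2 * (1 + c T) with hy
  have hy' : y = sigma T ^ 2 * Real.cos t + (1 - sigma T ^ 2) := by rw [hy, c_eq]; ring
  have hs2 : 0 < sigma T ^ 2 := by positivity
  have hy1 : y < 1 := by rw [hy']; nlinarith
  have hyc : c T ≤ y := by rw [hy', c_eq]; nlinarith
  have hnode : nodeAux T N n = T / Real.pi * Real.arccos y := by
    rw [nodeAux, hy, ht]; push_cast; rfl
  have hcosmul : Real.pi / T * nodeAux T N n = Real.arccos y := by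
    rw [hnode]; field_simp
  refine ⟨?_, ?_, ?_⟩
  · rw [hnode]
    have := Real.arccos_pos.mpr hy1
    positivity
  · have h1 : Real.arccos y ≤ Real.arccos (c T) := Real.arccos_le_arccos hyc
    rw [c, Real.arccos_cos (by positivity) (div_le_self hpi.le hT.le)] at h1
    rw [hnode]
    calc _ ≤ T / Real.pi * (Real.pi / T) := by gcongr
      _ = 1 := by field_simp
  · have h := cos_eq_mReal hT (nodeAux T N n)
    rw [hcosmul, Real.cos_arccos (by rw [c] at hyc; linarith [Real.neg_one_le_cos (Real.pi / T)])
      hy1.le, hy'] at h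
    have h' : sigma T ^ 2 * Real.cos t = sigma T ^ 2 * mReal T (nodeAux T N n) := by linarith
    exact (mul_left_cancel₀ hs2.ne' h').symm

theorem node_natCast (T : ℝ) (N n : ℕ) : node T N n = nodeAux T N n := by
  rw [node, if_pos (Int.natCast_nonneg n)]

theorem node_neg_sub_one (T : ℝ) (N n : ℕ) : node T N (-n - 1) = -nodeAux T N n := by
  rw [node, if_neg (by omega)]
  congr 2
  ring

/-- With u = 1 - cos t, sin²(πx/T) = σ²u(2 - σ²u) ≥ σ⁴u(2 - u) = σ⁴ sin² t because σ ≤ 1. At the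
nodes this comparison of weights replaces the Jacobian of the integral version. -/
theorem abs_sin_le_of_node {T : ℝ} (hT : 1 < T) {x t : ℝ} (h : mReal T x = Real.cos t) :
    |Real.sin t| ≤ |Real.sin (Real.pi / T * x)| / sigma T ^ 2 := by
  have hs := sigma_pos hT
  have hs1 := sigma_lt_one hT
  have hs2 : 0 < sigma T ^ 2 := by positivity
  have hs21 : sigma T ^ 2 ≤ 1 := by nlinarith
  have hc := cos_eq_mReal hT x
  rw [h] at hc
  rw [le_div_iff₀ hs2, ← abs_of_pos hs2, ← abs_mul]
  apply sq_le_sq.mp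
  rw [mul_pow, Real.sin_sq, Real.sin_sq, hc]
  nlinarith [Real.neg_one_le_cos t, Real.cos_le_one t, mul_nonneg (mul_nonneg hs2.le
    (sub_nonneg.mpr (Real.cos_le_one t))) (sub_nonneg.mpr hs21)]

/-- Growth of the elements of the extension spaces outside `[-1, 1]`, in terms of their values at
the mapped symmetric Chebyshev nodes. -/
theorem norm_ext_le_nodes {T : ℝ} (hT : 1 < T) {N : ℕ} {p q : ℂ[X]}
    (hp : p.degree < (N + 1 : ℕ)) (hq : q.degree < (N + 1 : ℕ)) {ε : ℝ}
    (hε : ∀ n ∈ Finset.Icc (-(N : ℤ) - 1) N, ‖ext T p q (node T N n)‖ ≤ ε) (x : ℝ) :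
    ‖ext T p q x‖ ≤ 2 * (1 + 1 / sigma T ^ 2) * (E T / (E T - 1)) ^ 2 * ε * E T ^ N := by
  have hE := one_lt_E hT
  have hs := sigma_pos hT
  have hpos : ∀ n ≤ N, ‖ext T p q (nodeAux T N n)‖ ≤ ε := fun n hn => by
    rw [← node_natCast]; exact hε n (by rw [Finset.mem_Icc]; omega)
  have hneg : ∀ n ≤ N, ‖ext T p q (-nodeAux T N n)‖ ≤ ε := fun n hn => by
    rw [← node_neg_sub_one]; exact hε (-n - 1) (by rw [Finset.mem_Icc]; omega)
  have h1 : ‖p.eval (mReal T x : ℂ)‖ ≤ 2 * ε * (E T / (E T - 1)) ^ 2 * E T ^ N := by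
    refine norm_eval_le_nodes hE (norm_mReal_sub_add_norm hT x) hp fun n hn => ?_
    rw [← (nodeAux_spec hT hn).2.2, eval_mReal_eq T p q, norm_div, Complex.norm_two]
    have h1 := norm_add_le (ext T p q (nodeAux T N n)) (ext T p q (-nodeAux T N n))
    refine (mul_le_of_le_one_right (by positivity) (Real.abs_sin_le_one _)).trans ?_
    linarith [hpos n hn, hneg n hn]
  have h2 : ‖q.eval (mReal T x : ℂ)‖ ≤
      2 * (ε / sigma T ^ 2) * (E T / (E T - 1)) ^ 2 * E T ^ N := by
    refine norm_eval_le_nodes hE (norm_mReal_sub_add_norm hT x) hq fun n hn => ?_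
    have hm := (nodeAux_spec hT hn).2.2
    refine (mul_le_mul_of_nonneg_left (abs_sin_le_of_node hT hm) (norm_nonneg _)).trans ?_
    rw [← hm, ← mul_div_assoc]
    gcongr
    have e : ‖q.eval (mReal T (nodeAux T N n) : ℂ)‖ * |Real.sin (Real.pi / T * nodeAux T N n)|
        = ‖(ext T p q (nodeAux T N n) - ext T p q (-nodeAux T N n)) / 2‖ := by
      rw [← sin_mul_eval_mReal_eq, norm_mul, Complex.norm_real, Real.norm_eq_abs, mul_comm]
    rw [e, norm_div, Complex.norm_two]
    have h1 := norm_sub_le (ext T p q (nodeAux T N n)) (ext T p q (-nodeAux T N n))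
    linarith [hpos n hn, hneg n hn]
  exact (norm_ext_le_of_norm_eval_le h1 h2).trans (le_of_eq (by ring))

/-- Interpolation at the mapped symmetric Chebyshev nodes. -/
theorem exists_ext_eq_at_nodes {T : ℝ} (hT : 1 < T) (N : ℕ) (f : ℝ → ℂ) :
    ∃ p q : ℂ[X], p.degree < (N + 1 : ℕ) ∧ q.degree < (N + 1 : ℕ) ∧
      ∀ n ∈ Finset.Icc (-(N : ℤ) - 1) N, ext T p q (node T N n) = f (node T N n) := by
  have hpi := Real.pi_pos
  set v : ℕ → ℂ := fun n => (mReal T (nodeAux T N n) : ℂ) with hv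
  have hinj : Set.InjOn v (Finset.range (N + 1)) := by
    intro i hi j hj hij
    have hi' : i ≤ N := by simpa [Nat.lt_succ_iff] using hi
    have hj' : j ≤ N := by simpa [Nat.lt_succ_iff] using hj
    have hij' : mReal T (nodeAux T N i) = mReal T (nodeAux T N j) := by
      simpa only [hv, Complex.ofReal_inj] using hij
    rw [(nodeAux_spec hT hi').2.2, (nodeAux_spec hT hj').2.2] at hij'
    have hmem : ∀ n ≤ N, (2 * n + 1) * Real.pi / (2 * N + 2) ∈ Set.Icc 0 Real.pi := by
      intro n hn
      refine ⟨by positivity, ?_⟩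
      rw [div_le_iff₀ (by positivity)]
      have : (n : ℝ) ≤ N := by exact_mod_cast hn
      nlinarith
    have := Real.injOn_cos (hmem i hi') (hmem j hj') hij'
    field_simp at this
    have h2 : (i : ℝ) = j := by linarith
    exact_mod_cast h2
  -- Data for p and q: the even part of f, and its odd part divided by sin(πx/T), which is nonzero
  -- because the positive nodes lie in (0,1] and T > 1.
  set fe : ℕ → ℂ := fun n => (f (nodeAux T N n) + f (-nodeAux T N n)) / 2
  set fo : ℕ → ℂ := fun n => (f (nodeAux T N n) - f (-nodeAux T N n)) / 2
    / (Real.sin (Real.pi / T * nodeAux T N n) : ℂ)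
  refine ⟨Lagrange.interpolate (Finset.range (N + 1)) v fe,
    Lagrange.interpolate (Finset.range (N + 1)) v fo, ?_, ?_, ?_⟩
  · simpa using Lagrange.degree_interpolate_lt fe hinj
  · simpa using Lagrange.degree_interpolate_lt fo hinj
  · have hmain : ∀ n : ℕ, n ≤ N → ext T (Lagrange.interpolate (Finset.range (N + 1)) v fe)
        (Lagrange.interpolate (Finset.range (N + 1)) v fo) (nodeAux T N n) = f (nodeAux T N n) ∧
        ext T (Lagrange.interpolate (Finset.range (N + 1)) v fe)
        (Lagrange.interpolate (Finset.range (N + 1)) v fo) (-nodeAux T N n)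
          = f (-nodeAux T N n) := by
      intro n hn
      have hmem : n ∈ Finset.range (N + 1) := by simpa [Nat.lt_succ_iff] using hn
      have h1 := Lagrange.eval_interpolate_at_node fe hinj hmem
      have h2 := Lagrange.eval_interpolate_at_node fo hinj hmem
      obtain ⟨hn0, hn1, -⟩ := nodeAux_spec hT hn
      have hsin : (Real.sin (Real.pi / T * nodeAux T N n) : ℂ) ≠ 0 := by
        exact_mod_cast (sin_pos_of_mem hT hn0 hn1).ne'
      have h3 : (Real.sin (Real.pi / T * nodeAux T N n) : ℂ) * fo n
          = (f (nodeAux T N n) - f (-nodeAux T N n)) / 2 := mul_div_cancel₀ _ hsin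
      simp only [hv] at h1 h2
      constructor
      · rw [ext, h1, h2, h3]; simp only [fe]; ring
      · rw [ext, mReal_neg, h1, h2, mul_neg, Real.sin_neg, Complex.ofReal_neg, neg_mul, h3]
        simp only [fe]; ring
    intro n hn
    rw [Finset.mem_Icc] at hn
    rcases lt_or_ge n 0 with h | h
    · obtain ⟨k, rfl⟩ : ∃ k : ℕ, n = -k - 1 := ⟨(-n - 1).toNat, by omega⟩
      rw [node_neg_sub_one]
      exact (hmain k (by omega)).2
    · obtain ⟨k, rfl⟩ := Int.eq_ofNat_of_zero_le h
      rw [node_natCast]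
      exact (hmain k (by omega)).1

end FourierExtension

/-! ### Laurent series in an annulus and their parity components. -/

namespace FourierExtension

theorem intervalIntegrable_abs_rpow {r : ℝ} (hr : -1 < r) (a b : ℝ) :
    IntervalIntegrable (fun x : ℝ => |x| ^ r) MeasureTheory.volume a b := by
  have h := (intervalIntegral.intervalIntegrable_cpow' (a := a) (b := b) (r := (r : ℂ))
    (by simpa using hr)).norm
  refine h.congr_ae (Filter.Eventually.of_forall fun x => ?_)
  simp only [Complex.norm_cpow_real, Complex.norm_real, Real.norm_eq_abs]

/-- On one period [-π/4, π/4] the only singularity is at 0, where Jordan's inequality compares the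
function with |x|^(-1/2). It will dominate 1/cos(πx/(2T)) on the circles. -/
theorem intervalIntegrable_abs_sin_rpow (a b : ℝ) :
    IntervalIntegrable (fun x : ℝ => |Real.sin (2 * x)| ^ (-(1 / 2) : ℝ))
      MeasureTheory.volume a b := by
  have hpi := Real.pi_pos
  have hper : Function.Periodic (fun x : ℝ => |Real.sin (2 * x)| ^ (-(1 / 2) : ℝ)) (Real.pi / 2) := by
    intro x
    have : 2 * (x + Real.pi / 2) = 2 * x + Real.pi := by ring
    simp only [this, Real.sin_add_pi, abs_neg]
  refine hper.intervalIntegrable (by positivity) (t := -(Real.pi / 4)) ?_ a b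
  have hdom := (intervalIntegrable_abs_rpow (r := -(1 / 2)) (by norm_num) (-(Real.pi / 4))
    (-(Real.pi / 4) + Real.pi / 2)).const_mul ((4 / Real.pi) ^ (-(1 / 2) : ℝ))
  refine hdom.mono_fun' (Measurable.aestronglyMeasurable (by fun_prop)) ?_
  refine (MeasureTheory.ae_restrict_mem measurableSet_uIoc).mono fun x hx => ?_
  rw [Set.uIoc_of_le (by linarith)] at hx
  dsimp only
  rw [Real.norm_of_nonneg (by positivity), ← Real.mul_rpow (by positivity) (abs_nonneg x)]
  rcases eq_or_ne x 0 with rfl | hx0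
  · simp
  refine Real.rpow_le_rpow_of_nonpos (by positivity) ?_ (by norm_num)
  have h := Real.mul_abs_le_abs_sin (x := 2 * x) (by
    rw [abs_le]; constructor <;> linarith [hx.1, hx.2])
  rw [abs_mul, abs_two] at h
  calc _ = 2 / Real.pi * (2 * |x|) := by ring
    _ ≤ _ := h

/-- Laurent expansion on the unit circle of a function holomorphic in an annulus. -/
theorem exists_laurent_hasSum {R B : ℝ} (hR : 1 < R) {H : ℂ → ℂ}
    (hH : ∀ s : ℂ, R⁻¹ < ‖s‖ → ‖s‖ < R → DifferentiableAt ℂ H s)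
    (hB : ∀ r : ℝ, R⁻¹ < r → r < R →
      ∫ θ in (0 : ℝ)..(2 * Real.pi), ‖H (circleMap 0 r θ)‖ ≤ 2 * Real.pi * B) :
    ∃ h : ℤ → ℂ, (∀ k, ‖h k‖ ≤ B * R⁻¹ ^ k.natAbs) ∧
      ∀ η : ℝ, HasSum (fun k => h k * Complex.exp (k * η * Complex.I))
        (H (Complex.exp (η * Complex.I))) := by
  have hR0 : 0 < R := by linarith
  have hRi : R⁻¹ < 1 := inv_lt_one_of_one_lt₀ hR
  have hpi := Real.pi_pos
  -- Cauchy's theorem: the coefficient integrals do not depend on the radius.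
  have hcirc : ∀ k : ℤ, ∀ r : ℝ, R⁻¹ < r → r < R →
      (∮ s in C(0, r), s ^ (-k - 1) * H s) = ∮ s in C(0, 1), s ^ (-k - 1) * H s := by
    intro k
    have hd : ∀ s : ℂ, R⁻¹ < ‖s‖ → ‖s‖ < R → DifferentiableAt ℂ (fun s => s ^ (-k - 1) * H s) s := by
      intro s h1 h2
      have hs : s ≠ 0 := norm_pos_iff.mp ((inv_pos.mpr hR0).trans h1)
      exact (differentiableAt_zpow.mpr (Or.inl hs)).mul (hH s h1 h2)
    have hle : ∀ r r' : ℝ, R⁻¹ < r → r ≤ r' → r' < R →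
        (∮ s in C(0, r'), s ^ (-k - 1) * H s) = ∮ s in C(0, r), s ^ (-k - 1) * H s := by
      intro r r' h1 h2 h3
      refine Complex.circleIntegral_eq_of_differentiable_on_annulus_off_countable
        ((inv_pos.mpr hR0).trans h1) h2 Set.countable_empty ?_ ?_
      · intro s hs
        simp only [Set.mem_sdiff, Metric.mem_closedBall, Metric.mem_ball, dist_zero_right,
          not_lt] at hs
        exact (hd s (h1.trans_le hs.2) (hs.1.trans_lt h3)).continuousAt.continuousWithinAt
      · intro s hs
        simp only [Set.mem_sdiff, Metric.mem_closedBall, Metric.mem_ball, dist_zero_right,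
          not_le] at hs
        exact hd s (h1.trans hs.1.2) (hs.1.1.trans h3)
    intro r h1 h2
    rcases le_total r 1 with h | h
    · exact (hle r 1 h1 h hR).symm
    · exact hle 1 r hRi h h2
  set h : ℤ → ℂ := fun k => (2 * Real.pi * Complex.I)⁻¹ * ∮ s in C(0, 1), s ^ (-k - 1) * H s with hh
  -- Only the mean of |H| over the circle enters, so H may become unbounded as r approaches R or
  -- R⁻¹.
  have hbound : ∀ k : ℤ, ∀ r : ℝ, R⁻¹ < r → r < R → ‖h k‖ ≤ B * r ^ (-k) := by
    intro k r h1 h2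
    have hr : 0 < r := (inv_pos.mpr hR0).trans h1
    have hint : IntervalIntegrable (fun θ : ℝ => ‖H (circleMap 0 r θ)‖) MeasureTheory.volume 0
        (2 * Real.pi) := by
      refine Continuous.intervalIntegrable ?_ _ _
      refine continuous_iff_continuousAt.mpr fun θ => ?_
      have : DifferentiableAt ℂ H (circleMap 0 r θ) := hH _ (by simpa [abs_of_pos hr] using h1)
        (by simpa [abs_of_pos hr] using h2)
      exact (this.continuousAt.comp (f := circleMap 0 r) (continuous_circleMap 0 r).continuousAt).norm
    have hI : ‖∮ s in C(0, r), s ^ (-k - 1) * H s‖ ≤ 2 * Real.pi * B * r ^ (-k) := by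
      rw [circleIntegral]
      refine (intervalIntegral.norm_integral_le_of_norm_le (by positivity)
        (g := fun θ => r ^ (-k) * ‖H (circleMap 0 r θ)‖) ?_ (hint.const_mul _)).trans ?_
      · refine Filter.Eventually.of_forall fun θ _ => ?_
        rw [deriv_circleMap, smul_eq_mul, norm_mul, norm_mul, norm_mul, norm_zpow, Complex.norm_I,
          norm_circleMap_zero, abs_of_pos hr, ← mul_assoc, mul_one]
        rw [← zpow_one_add₀ hr.ne']
        ring_nf
        exact le_rfl
      · rw [intervalIntegral.integral_const_mul, mul_comm]
        gcongr
        exact hB r h1 h2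
    rw [hh]
    simp only
    rw [← hcirc k r h1 h2, norm_mul, norm_inv]
    have : ‖(2 * Real.pi * Complex.I : ℂ)‖ = 2 * Real.pi := by
      simp [abs_of_pos hpi]
    rw [this, inv_mul_le_iff₀ (by positivity)]
    linarith
  -- H is not assumed to exist on the boundary circles; the optimal rate is reached as r → R for k ≥
  -- 0 and r → R⁻¹ for k ≤ 0.
  have hdecay : ∀ k, ‖h k‖ ≤ B * R⁻¹ ^ k.natAbs := by
    intro k
    rcases le_total 0 k with hk | hk
    · obtain ⟨n, rfl⟩ := Int.eq_ofNat_of_zero_le hk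
      have hlim : Filter.Tendsto (fun r : ℝ => B * r ^ (-(n : ℤ))) (nhdsWithin R (Set.Iio R))
          (nhds (B * R ^ (-(n : ℤ)))) :=
        ((continuousAt_zpow₀ R _ (Or.inl hR0.ne')).tendsto.const_mul B).mono_left
          nhdsWithin_le_nhds
      have := ge_of_tendsto hlim (by
        filter_upwards [Ioo_mem_nhdsLT (hRi.trans hR)] with r hr
        exact hbound n r hr.1 hr.2)
      simpa using this
    · obtain ⟨n, rfl⟩ := Int.exists_eq_neg_ofNat hk
      have hlim : Filter.Tendsto (fun r : ℝ => B * r ^ (-(-(n : ℤ))))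
          (nhdsWithin R⁻¹ (Set.Ioi R⁻¹)) (nhds (B * R⁻¹ ^ (-(-(n : ℤ))))) :=
        ((continuousAt_zpow₀ R⁻¹ _ (Or.inl (inv_pos.mpr hR0).ne')).tendsto.const_mul B).mono_left
          nhdsWithin_le_nhds
      have := ge_of_tendsto hlim (by
        filter_upwards [Ioo_mem_nhdsGT (hRi.trans hR)] with r hr
        exact hbound _ r hr.1 hr.2)
      simpa using this
  refine ⟨h, hdecay, ?_⟩
  have : Fact (0 < 2 * Real.pi) := ⟨by positivity⟩
  -- On the unit circle the Laurent coefficients are Fourier coefficients. Their geometric decay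
  -- makes the Fourier series converge pointwise.
  let F : C(AddCircle (2 * Real.pi), ℂ) := ⟨fun t => H (AddCircle.toCircle t), by
    refine continuous_iff_continuousAt.mpr fun t => ?_
    have : DifferentiableAt ℂ H (AddCircle.toCircle t : ℂ) := hH _ (by rwa [Circle.norm_coe])
      (by rwa [Circle.norm_coe])
    exact this.continuousAt.comp (f := fun t : AddCircle (2 * Real.pi) =>
      (AddCircle.toCircle t : ℂ)) (by fun_prop)⟩
  have hF : ∀ η : ℝ, F (η : AddCircle (2 * Real.pi)) = H (Complex.exp (η * Complex.I)) := by
    intro η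
    change H _ = _
    rw [AddCircle.toCircle_apply_mk, Circle.coe_exp]
    congr 3
    push_cast
    field_simp
  have hfour : ∀ (k : ℤ) (η : ℝ), fourier k (η : AddCircle (2 * Real.pi))
      = Complex.exp (k * η * Complex.I) := by
    intro k η
    rw [fourier_coe_apply]
    congr 1
    push_cast
    field_simp
  have hcoef : ∀ k, fourierCoeff F k = h k := by
    intro k
    rw [fourierCoeff_eq_intervalIntegral F k 0, hh]
    simp only
    rw [circleIntegral, zero_add]
    simp_rw [hF, hfour, smul_eq_mul]
    rw [← intervalIntegral.integral_const_mul, Complex.real_smul,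
      ← intervalIntegral.integral_const_mul]
    refine intervalIntegral.integral_congr fun θ _ => ?_
    rw [deriv_circleMap, circleMap_zero, Complex.ofReal_one, one_mul, ← Complex.exp_int_mul]
    have e : Complex.exp (θ * Complex.I) * Complex.exp (((-k - 1 : ℤ) : ℂ) * (θ * Complex.I))
        = Complex.exp (((-k : ℤ) : ℂ) * θ * Complex.I) := by
      rw [← Complex.exp_add]; congr 1; push_cast; ring
    rw [← e]
    have hpi' : (Real.pi : ℂ) ≠ 0 := by exact_mod_cast hpi.ne'
    push_cast
    field_simp
  have hsum : Summable (fourierCoeff F) := by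
    have hgeo : Summable fun n : ℕ => B * R⁻¹ ^ n :=
      (summable_geometric_of_lt_one (by positivity) hRi).mul_left B
    have hZ : Summable fun k : ℤ => B * R⁻¹ ^ k.natAbs := by
      refine Summable.of_nat_of_neg ?_ ?_ <;> simpa using hgeo
    exact Summable.of_norm_bounded hZ fun k => by rw [hcoef]; exact hdecay k
  intro η
  have := has_pointwise_sum_fourier_series_of_summable hsum (η : AddCircle (2 * Real.pi))
  simp_rw [hcoef, hF, hfour, smul_eq_mul] at this
  exact this

theorem exp_int_pi_sub (k : ℤ) (η : ℝ) : Complex.exp (k * ((Real.pi - η : ℝ) : ℂ) * Complex.I)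
    = k.negOnePow * Complex.exp (-(k * η * Complex.I)) := by
  have e : k * ((Real.pi - η : ℝ) : ℂ) * Complex.I
      = (k : ℂ) * (Real.pi * Complex.I) + -(k * η * Complex.I) := by push_cast; ring
  rw [e, Complex.exp_add, Complex.exp_int_mul, Complex.exp_pi_mul_I]
  rw [Int.cast_negOnePow]

/-- The even and odd parts, under `η ↦ -η`, of a Fourier series that is symmetric
under `η ↦ π - η`. -/
theorem hasSum_even_odd {h : ℤ → ℂ} {F : ℝ → ℂ} {a b : ℂ} {η : ℝ}
    (hF : ∀ η : ℝ, HasSum (fun k => h k * Complex.exp (k * η * Complex.I)) (F η))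
    (h1 : F η = a) (h2 : F (Real.pi - η) = a) (h3 : F (-η) = b) (h4 : F (Real.pi - -η) = b) :
    HasSum (fun n : ℕ => h (2 * n) * Complex.cos (2 * n * η) +
      h (-(2 * (n + 1))) * Complex.cos (2 * (n + 1) * η)) ((a + b) / 2) ∧
    HasSum (fun n : ℕ => (h (2 * n + 1) - h (-(2 * n + 1))) * Complex.I *
      Complex.sin ((2 * n + 1) * η)) ((a - b) / 2) := by
  have s1 := h1 ▸ hF η
  have s2 := h2 ▸ hF (Real.pi - η)
  have s3 := h3 ▸ hF (-η)
  have s4 := h4 ▸ hF (Real.pi - -η)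
  simp_rw [exp_int_pi_sub] at s2 s4
  have expI : ∀ z : ℂ, Complex.exp (z * Complex.I) = Complex.cos z + Complex.sin z * Complex.I :=
    fun z => Complex.exp_mul_I z
  constructor
  -- Under η ↦ π - η the k-th exponential becomes (-1)^k e^{-ikη}. The average of the four series
  -- thus loses its odd frequencies; the frequencies 2n and -2(n+1) are then paired.
  · have hs := ((s1.add s2).add (s3.add s4)).mul_left (1 / 4)
    have e : 1 / 4 * (a + a + (b + b)) = (a + b) / 2 := by ring
    rw [e] at hs
    have hinj : Function.Injective fun j : ℤ => 2 * j := fun i j hij => by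
      simpa using hij
    rw [← hinj.hasSum_iff] at hs
    · have hN := hs.nat_add_neg_add_one
      refine hN.congr_fun fun n => ?_
      simp only [Function.comp_apply, Int.negOnePow_two_mul, Units.val_one, Int.cast_one, one_mul]
      push_cast
      have e1 : ∀ k : ℂ, Complex.exp (k * η * Complex.I) = Complex.cos (k * η) + Complex.sin (k * η) * Complex.I :=
        fun k => expI _
      have e2 : ∀ k : ℂ, Complex.exp (-(k * η * Complex.I)) = Complex.cos (k * η) - Complex.sin (k * η) * Complex.I := by
        intro k
        rw [← neg_mul, expI, Complex.cos_neg, Complex.sin_neg]; ring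
      have e3 : ∀ k : ℂ, Complex.exp (k * -η * Complex.I) = Complex.cos (k * η) - Complex.sin (k * η) * Complex.I := by
        intro k
        rw [← e2]; congr 1; ring
      have e4 : ∀ k : ℂ, Complex.exp (-(k * -η * Complex.I)) = Complex.cos (k * η) + Complex.sin (k * η) * Complex.I := by
        intro k
        rw [← e1]; congr 1; ring
      simp only [e1, e2, e3, e4]
      have e5 : (2 : ℂ) * (-(n + 1)) * η = -(2 * (n + 1) * η) := by ring
      have e6 : -((2 : ℤ) * (n + 1)) = 2 * (-(n + 1)) := by ring
      rw [e5, Complex.cos_neg, Complex.sin_neg, e6]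
      ring
    · intro k hk
      have hodd : Odd k := by
        rw [← Int.not_even_iff_odd]
        rintro ⟨j, rfl⟩
        exact hk ⟨j, by ring⟩
      rw [Int.negOnePow_odd k hodd, Units.val_neg, Units.val_one]
      push_cast
      rw [show (k : ℂ) * -η * Complex.I = -(k * η * Complex.I) by ring]
      rw [neg_neg]
      ring
  -- With this sign pattern the even frequencies cancel, and 2n+1 is paired with -(2n+1).
  · have hs := ((s1.add s2).sub (s3.add s4)).mul_left (1 / 4)
    have e : 1 / 4 * (a + a - (b + b)) = (a - b) / 2 := by ring
    rw [e] at hs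
    have hinj : Function.Injective fun j : ℤ => 2 * j + 1 := fun i j hij => by
      simpa using hij
    rw [← hinj.hasSum_iff] at hs
    · have hN := hs.nat_add_neg_add_one
      refine hN.congr_fun fun n => ?_
      have hodd : ∀ j : ℤ, (2 * j + 1).negOnePow = -1 := fun j =>
        Int.negOnePow_odd _ ⟨j, rfl⟩
      simp only [Function.comp_apply, hodd, Units.val_neg, Units.val_one, Int.cast_neg,
        Int.cast_one]
      push_cast
      have e1 : ∀ k : ℂ, Complex.exp (k * η * Complex.I) = Complex.cos (k * η) + Complex.sin (k * η) * Complex.I :=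
        fun k => expI _
      have e2 : ∀ k : ℂ, Complex.exp (-(k * η * Complex.I)) = Complex.cos (k * η) - Complex.sin (k * η) * Complex.I := by
        intro k
        rw [← neg_mul, expI, Complex.cos_neg, Complex.sin_neg]; ring
      have e3 : ∀ k : ℂ, Complex.exp (k * -η * Complex.I) = Complex.cos (k * η) - Complex.sin (k * η) * Complex.I := by
        intro k
        rw [← e2]; congr 1; ring
      have e4 : ∀ k : ℂ, Complex.exp (-(k * -η * Complex.I)) = Complex.cos (k * η) + Complex.sin (k * η) * Complex.I := by
        intro k
        rw [← e1]; congr 1; ring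
      simp only [e1, e2, e3, e4]
      have e5 : ((2 : ℂ) * (-(n + 1)) + 1) * η = -((2 * n + 1) * η) := by ring
      have e6 : -((2 : ℤ) * n + 1) = 2 * (-(n + 1)) + 1 := by ring
      rw [e5, Complex.cos_neg, Complex.sin_neg, e6]
      ring
    · intro k hk
      have heven : Even k := by
        rw [← Int.not_odd_iff_even]
        rintro ⟨j, rfl⟩
        exact hk ⟨j, rfl⟩
      rw [Int.negOnePow_even k heven, Units.val_one]
      push_cast
      rw [show (k : ℂ) * -η * Complex.I = -(k * η * Complex.I) by ring]
      rw [neg_neg]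
      ring

end FourierExtension

/-! ### Holomorphic inversion of `m`. -/

namespace FourierExtension

/-- The branch of `√(1 - z²)` with positive real part on the unit disc. -/
noncomputable def sqrtOneSubSq (z : ℂ) : ℂ := Complex.exp (Complex.log (1 - z ^ 2) / 2)

/-- The principal branch of the inverse sine. -/
noncomputable def arcsin (z : ℂ) : ℂ :=
  -Complex.I * Complex.log (Complex.I * z + sqrtOneSubSq z)

theorem one_sub_sq_re_pos {z : ℂ} (hz : ‖z‖ < 1) : 0 < (1 - z ^ 2).re := by
  have h1 : ‖z ^ 2‖ < 1 := by rw [norm_pow]; nlinarith [norm_nonneg z]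
  have h2 := Complex.re_le_norm (z ^ 2)
  simp only [Complex.sub_re, Complex.one_re]
  linarith

theorem sqrtOneSubSq_ne_zero (z : ℂ) : sqrtOneSubSq z ≠ 0 := Complex.exp_ne_zero _

theorem sqrtOneSubSq_sq {z : ℂ} (hz : ‖z‖ < 1) : sqrtOneSubSq z ^ 2 = 1 - z ^ 2 := by
  have h : 1 - z ^ 2 ≠ 0 := fun h => by
    have := one_sub_sq_re_pos hz
    rw [h] at this; simp at this
  rw [sqrtOneSubSq, ← Complex.exp_nat_mul]
  push_cast
  rw [mul_div_cancel₀ _ (two_ne_zero), Complex.exp_log h]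

theorem sqrtOneSubSq_re_pos {z : ℂ} (hz : ‖z‖ < 1) : 0 < (sqrtOneSubSq z).re := by
  rw [sqrtOneSubSq, Complex.exp_re]
  refine mul_pos (Real.exp_pos _) (Real.cos_pos_of_mem_Ioo ?_)
  have h1 := abs_lt.mp (Complex.abs_arg_lt_pi_div_two_iff.mpr (Or.inl (one_sub_sq_re_pos hz)))
  have e : (Complex.log (1 - z ^ 2) / 2).im = (1 - z ^ 2).arg / 2 := by
    rw [show (2 : ℂ) = ((2 : ℝ) : ℂ) by norm_num, Complex.div_ofReal_im, Complex.log_im]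
  rw [e]
  have := Real.pi_pos
  constructor <;> linarith

theorem mul_eq_one_of_norm_lt {z : ℂ} (hz : ‖z‖ < 1) :
    (Complex.I * z + sqrtOneSubSq z) * (-(Complex.I * z) + sqrtOneSubSq z) = 1 := by
  linear_combination sqrtOneSubSq_sq hz - z ^ 2 * Complex.I_sq

/-- For y = iz + √(1 - z²) one has y + y⁻¹ = 2√(1 - z²) and Re(y + y⁻¹) = Re y · (1 + |y|⁻²), so Re
y inherits the sign of Re √(1 - z²). This makes `arcsin` holomorphic on the disc with |Re| < π/2. -/
theorem re_pos_of_norm_lt {z : ℂ} (hz : ‖z‖ < 1) : 0 < (Complex.I * z + sqrtOneSubSq z).re := by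
  have h := mul_eq_one_of_norm_lt hz
  have hv := sqrtOneSubSq_re_pos hz
  set y := Complex.I * z + sqrtOneSubSq z with hy
  have hy0 : y ≠ 0 := left_ne_zero_of_mul_eq_one h
  have e : y + y⁻¹ = 2 * sqrtOneSubSq z := by
    rw [inv_eq_of_mul_eq_one_right h, hy]; ring
  have hre := congrArg Complex.re e
  rw [Complex.add_re, Complex.inv_re, Complex.mul_re, Complex.re_ofNat, Complex.im_ofNat] at hre
  have hn : 0 < Complex.normSq y := Complex.normSq_pos.mpr hy0
  have hfac : y.re * (1 + (Complex.normSq y)⁻¹) = 2 * (sqrtOneSubSq z).re := by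
    rw [div_eq_mul_inv] at hre; linarith
  by_contra! hle
  have : 0 < 1 + (Complex.normSq y)⁻¹ := by positivity
  nlinarith

theorem exp_arcsin_mul_I {z : ℂ} (hz : ‖z‖ < 1) :
    Complex.exp (arcsin z * Complex.I) = Complex.I * z + sqrtOneSubSq z := by
  have e : arcsin z * Complex.I = Complex.log (Complex.I * z + sqrtOneSubSq z) := by
    rw [arcsin]
    linear_combination (-Complex.log (Complex.I * z + sqrtOneSubSq z)) * Complex.I_mul_I
  rw [e, Complex.exp_log (left_ne_zero_of_mul_eq_one (mul_eq_one_of_norm_lt hz))]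

theorem exp_neg_arcsin_mul_I {z : ℂ} (hz : ‖z‖ < 1) :
    Complex.exp (-arcsin z * Complex.I) = -(Complex.I * z) + sqrtOneSubSq z := by
  rw [neg_mul, Complex.exp_neg, exp_arcsin_mul_I hz,
    inv_eq_of_mul_eq_one_right (mul_eq_one_of_norm_lt hz)]

theorem sin_arcsin {z : ℂ} (hz : ‖z‖ < 1) : Complex.sin (arcsin z) = z := by
  rw [Complex.sin, exp_arcsin_mul_I hz, exp_neg_arcsin_mul_I hz]
  linear_combination (-z) * Complex.I_mul_I

theorem abs_re_arcsin_lt {z : ℂ} (hz : ‖z‖ < 1) : |(arcsin z).re| < Real.pi / 2 := by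
  have e : (arcsin z).re = (Complex.I * z + sqrtOneSubSq z).arg := by
    simp [arcsin, Complex.log_im]
  rw [e]
  exact Complex.abs_arg_lt_pi_div_two_iff.mpr (Or.inl (re_pos_of_norm_lt hz))

theorem sqrtOneSubSq_sin {t : ℝ} (ht : |t| < Real.pi / 2) :
    sqrtOneSubSq (Real.sin t : ℝ) = (Real.cos t : ℝ) := by
  have hcos : 0 < Real.cos t := Real.cos_pos_of_mem_Ioo (abs_lt.mp ht)
  have e : (1 : ℂ) - ((Real.sin t : ℝ) : ℂ) ^ 2 = ((Real.cos t ^ 2 : ℝ) : ℂ) := by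
    rw [Real.cos_sq']; push_cast; ring
  rw [sqrtOneSubSq, e, ← Complex.ofReal_log (by positivity), Real.log_pow]
  push_cast
  rw [mul_div_cancel_left₀ _ (two_ne_zero), ← Complex.ofReal_cos, ← Complex.ofReal_exp,
    Real.exp_log hcos]

theorem arcsin_sin {t : ℝ} (ht : |t| < Real.pi / 2) : arcsin (Real.sin t : ℝ) = t := by
  have hpi := Real.pi_pos
  have h := abs_lt.mp ht
  have e : Complex.I * ((Real.sin t : ℝ) : ℂ) + ((Real.cos t : ℝ) : ℂ)
      = Complex.exp (t * Complex.I) := by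
    rw [Complex.exp_mul_I]; push_cast; ring
  rw [arcsin, sqrtOneSubSq_sin ht, e, Complex.log_exp (by simp; linarith) (by simp; linarith)]
  linear_combination (-(t : ℂ)) * Complex.I_mul_I

theorem differentiableAt_sqrtOneSubSq {z : ℂ} (hz : ‖z‖ < 1) :
    DifferentiableAt ℂ sqrtOneSubSq z := by
  have h1 : DifferentiableAt ℂ (fun z : ℂ => 1 - z ^ 2) z := by fun_prop
  exact ((h1.clog (Or.inl (one_sub_sq_re_pos hz))).div_const 2).cexp

theorem differentiableAt_arcsin {z : ℂ} (hz : ‖z‖ < 1) : DifferentiableAt ℂ arcsin z := by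
  have h1 : DifferentiableAt ℂ (fun z : ℂ => Complex.I * z + sqrtOneSubSq z) z :=
    (differentiableAt_id.const_mul _).add (differentiableAt_sqrtOneSubSq hz)
  exact (h1.clog (Or.inl (re_pos_of_norm_lt hz))).const_mul _

/-- `sin (π x / (2 T))` as a function of the square root `s` of the Joukowski variable. -/
noncomputable def zeta (T : ℝ) (s : ℂ) : ℂ := sigma T * ((s - s⁻¹) / (2 * Complex.I))

/-- The inverse of `m` on the annulus covering the Bernstein region. -/
noncomputable def mInv (T : ℝ) (s : ℂ) : ℂ := (2 * T / Real.pi : ℝ) * arcsin (zeta T s)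

theorem add_inv_lt_add_inv {r R : ℝ} (hR : 1 < R) (h1 : R⁻¹ < r) (h2 : r < R) :
    r + r⁻¹ < R + R⁻¹ := by
  have hR0 : 0 < R := by linarith
  have hr : 0 < r := (inv_pos.mpr hR0).trans h1
  have h3 : 1 < R * r := by rwa [inv_lt_iff_one_lt_mul₀' hR0] at h1
  have : R + R⁻¹ - (r + r⁻¹) = (R - r) * (R * r - 1) / (R * r) := by field_simp; ring
  have h4 : 0 < (R - r) * (R * r - 1) / (R * r) :=
    div_pos (mul_pos (by linarith) (by linarith)) (by positivity)
  linarith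

/-- |s - s⁻¹| ≤ |s| + |s|⁻¹ < √E + 1/√E = 2/σ. The annulus cannot be enlarged: at s = ±i√E the value
is ±1, corresponding to x = ±T. -/
theorem norm_zeta_lt {T : ℝ} (hT : 1 < T) {s : ℂ} (h1 : (√(E T))⁻¹ < ‖s‖) (h2 : ‖s‖ < √(E T)) :
    ‖zeta T s‖ < 1 := by
  have hs := sigma_pos hT
  obtain ⟨hk1, hk2⟩ := cot_quarter_add_inv hT
  have e : √(E T) = Real.cot (Real.pi / (4 * T)) := Real.sqrt_sq (by linarith)
  rw [e] at h1 h2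
  have h := add_inv_lt_add_inv hk1 h1 h2
  rw [hk2, lt_div_iff₀ hs] at h
  have h3 : ‖s - s⁻¹‖ ≤ ‖s‖ + ‖s‖⁻¹ := by
    rw [← norm_inv]; exact norm_sub_le _ _
  rw [zeta, norm_mul, norm_div, norm_mul, Complex.norm_I, Complex.norm_two, Complex.norm_real,
    Real.norm_eq_abs, abs_of_pos hs]
  nlinarith

/-- s² is the Joukowski variable of z. Passing to its square root resolves the two-valued inverse of
`m`: s and s⁻¹ correspond to x and -x, while s and -s⁻¹ give the same x. -/
theorem m_mInv {T : ℝ} (hT : 1 < T) {s : ℂ} (hs : s ≠ 0) (hz : ‖zeta T s‖ < 1) :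
    m T (mInv T s) = (s ^ 2 + (s⁻¹) ^ 2) / 2 := by
  have hsig : (sigma T : ℂ) ≠ 0 := by exact_mod_cast (sigma_pos hT).ne'
  have hpi : (Real.pi : ℂ) ≠ 0 := by exact_mod_cast Real.pi_pos.ne'
  have hT0 : (T : ℂ) ≠ 0 := by
    have : T ≠ 0 := by linarith
    exact_mod_cast this
  have e : (Real.pi / (2 * T) * mInv T s : ℂ) = arcsin (zeta T s) := by
    rw [mInv]; push_cast; field_simp
  rw [m_eq hT, e, sin_arcsin hz, zeta, mul_pow, div_pow, mul_pow, Complex.I_sq]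
  field_simp
  ring

/-- The parallelogram law again. It places the image of the circle |s| = r, for r ≥ 1, on the
ellipse of index r², whence the annuli of radii √ρ and 1/√ρ. -/
theorem norm_sub_add_norm_of_sq {s : ℂ} (hs : s ≠ 0) :
    ‖(s ^ 2 + (s⁻¹) ^ 2) / 2 - 1‖ + ‖(s ^ 2 + (s⁻¹) ^ 2) / 2 + 1‖
      = ‖s‖ ^ 2 + (‖s‖ ^ 2)⁻¹ := by
  have e1 : (s ^ 2 + (s⁻¹) ^ 2) / 2 - 1 = (s - s⁻¹) ^ 2 / 2 := by field_simp; ring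
  have e2 : (s ^ 2 + (s⁻¹) ^ 2) / 2 + 1 = (s + s⁻¹) ^ 2 / 2 := by field_simp; ring
  have hp := parallelogram_law_with_norm ℝ s s⁻¹
  rw [e1, e2, norm_div, norm_div, norm_pow, norm_pow, Complex.norm_two]
  rw [norm_inv] at hp
  rw [← inv_pow]
  nlinarith

theorem abs_re_mInv_lt {T : ℝ} (hT : 1 < T) {s : ℂ} (hz : ‖zeta T s‖ < 1) :
    |(mInv T s).re| < T := by
  have hpi := Real.pi_pos
  rw [mInv, Complex.re_ofReal_mul, abs_mul, abs_of_pos (by positivity)]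
  calc _ < 2 * T / Real.pi * (Real.pi / 2) := by
        gcongr; exact abs_re_arcsin_lt hz
    _ = T := by field_simp

theorem continuous_m (T : ℝ) : Continuous (m T) := by
  unfold m; fun_prop

theorem mInv_mem_interior {T ρ : ℝ} (hT : 1 < T) {s : ℂ} (hs : s ≠ 0) (hz : ‖zeta T s‖ < 1)
    (hlt : ‖s‖ ^ 2 + (‖s‖ ^ 2)⁻¹ < ρ + ρ⁻¹) : mInv T s ∈ interior (mappedRegion T ρ) := by
  have hm := continuous_m T
  have hopen : IsOpen {x : ℂ | |x.re| < T ∧ ‖m T x - 1‖ + ‖m T x + 1‖ < ρ + ρ⁻¹} :=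
    (isOpen_lt (by fun_prop : Continuous fun x : ℂ => |x.re|) continuous_const).inter (isOpen_lt
      (by fun_prop : Continuous fun x => ‖m T x - 1‖ + ‖m T x + 1‖) continuous_const)
  have hsub : {x : ℂ | |x.re| < T ∧ ‖m T x - 1‖ + ‖m T x + 1‖ < ρ + ρ⁻¹} ⊆ mappedRegion T ρ :=
    fun x hx => And.intro hx.1.le hx.2.le
  refine interior_maximal hsub hopen ?_
  refine ⟨abs_re_mInv_lt hT hz, ?_⟩
  rwa [m_mInv hT hs hz, norm_sub_add_norm_of_sq hs]

theorem differentiableAt_zeta (T : ℝ) {s : ℂ} (hs : s ≠ 0) : DifferentiableAt ℂ (zeta T) s := by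
  unfold zeta
  exact ((differentiableAt_id.sub (differentiableAt_inv hs)).div_const _).const_mul _

theorem differentiableAt_mInv {T : ℝ} {s : ℂ} (hs : s ≠ 0) (hz : ‖zeta T s‖ < 1) :
    DifferentiableAt ℂ (mInv T) s :=
  (DifferentiableAt.comp s (differentiableAt_arcsin hz) (differentiableAt_zeta T hs)).const_mul _

theorem zeta_exp (T η : ℝ) : zeta T (Complex.exp (η * Complex.I))
    = ((sigma T * Real.sin η : ℝ) : ℂ) := by
  rw [zeta, ← Complex.exp_neg]
  push_cast
  rw [Complex.sin]
  have : Complex.I ≠ 0 := Complex.I_ne_zero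
  congr 1
  field_simp
  rw [← neg_mul]
  linear_combination (Complex.exp (η * Complex.I) - Complex.exp (-η * Complex.I)) * Complex.I_sq

theorem mInv_of_zeta_eq {T x : ℝ} (hT : 1 < T) (hx : x ∈ Set.Icc (-1 : ℝ) 1) {s : ℂ}
    (h : zeta T s = (Real.sin (Real.pi / (2 * T) * x) : ℝ)) :
    mInv T s = x ∧ sqrtOneSubSq (zeta T s) = (Real.cos (Real.pi / (2 * T) * x) : ℝ) := by
  have hpi := Real.pi_pos
  have ht : |Real.pi / (2 * T) * x| < Real.pi / 2 := by
    have h1 : Real.pi / (2 * T) < Real.pi / 2 :=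
      div_lt_div_of_pos_left hpi (by norm_num) (by linarith)
    have h0 : 0 < Real.pi / (2 * T) := by positivity
    rw [abs_lt]
    constructor <;> nlinarith [hx.1, hx.2]
  constructor
  · rw [mInv, h, arcsin_sin ht, ← Complex.ofReal_mul]
    congr 1
    field_simp
  · rw [h, sqrtOneSubSq_sin ht]

/-- |Im z| ≤ sinh|Im z| ≤ |cos z|, so a bound on m confines x vertically. Compactness makes the
supremum in `maxOn` a genuine bound. -/
theorem isCompact_mappedRegion {T : ℝ} (hT : 1 < T) (ρ : ℝ) : IsCompact (mappedRegion T ρ) := by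
  have hm := continuous_m T
  have hs := sigma_pos hT
  have hpi := Real.pi_pos
  have hclosed : IsClosed (mappedRegion T ρ) :=
    (isClosed_le (by fun_prop : Continuous fun x : ℂ => |x.re|) continuous_const).inter
      (isClosed_le (by fun_prop : Continuous fun x => ‖m T x - 1‖ + ‖m T x + 1‖) continuous_const)
  refine Metric.isCompact_of_isClosed_isBounded hclosed ?_
  have him : ∀ z : ℂ, |z.im| ≤ ‖Complex.cos z‖ := by
    intro z
    have h1 : ∀ z : ℂ, Real.exp (-z.im) - Real.exp z.im ≤ 2 * ‖Complex.cos z‖ := by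
      intro z
      have e : Complex.exp (z * Complex.I) = 2 * Complex.cos z - Complex.exp (-z * Complex.I) := by
        rw [Complex.two_cos]; ring
      have h := congrArg norm e
      have h' := norm_sub_le (2 * Complex.cos z) (Complex.exp (-z * Complex.I))
      rw [← h, Complex.norm_exp, Complex.norm_exp, norm_mul, Complex.norm_two] at h'
      simp only [Complex.mul_I_re, Complex.neg_im, neg_neg] at h'
      linarith
    have h2 := h1 z
    have h3 := h1 (-z)
    rw [Complex.cos_neg, Complex.neg_im, neg_neg] at h3
    have key : ∀ b : ℝ, 0 ≤ b → 2 * b ≤ Real.exp b - Real.exp (-b) := by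
      intro b hb
      have := Real.self_le_sinh_iff.mpr hb
      rw [Real.sinh_eq] at this
      linarith
    rcases abs_cases z.im with ⟨h, h0⟩ | ⟨h, h0⟩
    · linarith [key z.im h0]
    · have := key (-z.im) (by linarith)
      rw [neg_neg] at this
      linarith
  have hsub : mappedRegion T ρ ⊆ (Set.Icc (-T) T) ×ℂ
      (Set.Icc (-(T / Real.pi * (sigma T ^ 2 * ((ρ + ρ⁻¹) / 2) + 1)))
        (T / Real.pi * (sigma T ^ 2 * ((ρ + ρ⁻¹) / 2) + 1))) := by
    rintro x ⟨hre, hx⟩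
    refine Complex.mem_reProdIm.mpr ⟨abs_le.mp hre, abs_le.mp ?_⟩
    have hx' : ‖m T x - 1‖ + ‖m T x + 1‖ ≤ ρ + ρ⁻¹ := hx
    have hmx : ‖m T x‖ ≤ (ρ + ρ⁻¹) / 2 := by
      have h := norm_add_le (m T x - 1) (m T x + 1)
      rw [show m T x - 1 + (m T x + 1) = 2 * m T x by ring, norm_mul, Complex.norm_two] at h
      linarith
    have hsig : (sigma T : ℂ) ≠ 0 := by exact_mod_cast hs.ne'
    have e : Complex.cos (Real.pi / T * x) = (sigma T ^ 2 : ℝ) * m T x + (1 - sigma T ^ 2 : ℝ) := by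
      rw [m, c_eq]; push_cast; field_simp; ring
    have hcos : ‖Complex.cos (Real.pi / T * x)‖ ≤ sigma T ^ 2 * ((ρ + ρ⁻¹) / 2) + 1 := by
      rw [e]
      refine (norm_add_le _ _).trans (add_le_add ?_ ?_)
      · rw [norm_mul, Complex.norm_real, Real.norm_eq_abs, abs_of_pos (by positivity)]
        gcongr
      · rw [Complex.norm_real, Real.norm_eq_abs, abs_le]
        constructor <;> nlinarith [sigma_lt_one hT]
    have h := (him _).trans hcos
    have e2 : (Real.pi / T * x : ℂ).im = Real.pi / T * x.im := by
      rw [← Complex.ofReal_div, Complex.im_ofReal_mul]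
    rw [e2, abs_mul, abs_of_pos (by positivity)] at h
    calc |x.im| = T / Real.pi * (Real.pi / T * |x.im|) := by field_simp
      _ ≤ _ := by gcongr
  exact ((Metric.isBounded_Icc _ _).reProdIm (Metric.isBounded_Icc _ _)).subset hsub

/-- Lower bound for `1 - sin² (π x / (2 T))` on the circles of the annulus. -/
theorem norm_one_sub_zeta_sq_ge {T r : ℝ} (hT : 1 < T) (hr : 0 < r) (θ : ℝ) :
    sigma T ^ 2 / (4 * E T) * (E T - 1) * |Real.sin (2 * θ)|
      ≤ ‖1 - zeta T (circleMap 0 r θ) ^ 2‖ := by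
  have hs := sigma_pos hT
  have hE := one_lt_E hT
  have hE0 : E T ≠ 0 := by linarith
  have hsE : (sigma T : ℂ) ^ 2 * (E T + (E T)⁻¹ + 2) = 4 := by
    have h := E_add_inv hT
    have : sigma T ^ 2 * (E T + (E T)⁻¹ + 2) = 4 := by rw [h]; field_simp; ring
    exact_mod_cast this
  set s := circleMap 0 r θ with hsdef
  have hs0 : s ≠ 0 := by simp [hsdef, hr.ne']
  have hEpos : 0 < E T := by linarith
  have hEc : (E T : ℂ) ≠ 0 := by exact_mod_cast hE0
  -- The factorization shows the zeros s² = -E and s² = -1/E, both on the boundary of the annulus.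
  have e : 1 - zeta T s ^ 2 = ((sigma T ^ 2 / (4 * E T) : ℝ) : ℂ) *
      ((s ^ 2 + E T) * ((s⁻¹) ^ 2 + E T)) := by
    have e1 : zeta T s ^ 2 = -(sigma T : ℂ) ^ 2 * (s ^ 2 + s⁻¹ ^ 2 - 2) / 4 := by
      rw [zeta, mul_pow, div_pow, mul_pow, Complex.I_sq]
      field_simp
      ring
    rw [e1]
    have e2 : (1 : ℂ) = (sigma T : ℂ) ^ 2 * (E T + (E T)⁻¹ + 2) / 4 := by rw [hsE]; norm_num
    nth_rewrite 1 [e2]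
    push_cast
    field_simp
    ring
  have hs2 : s ^ 2 = ((r ^ 2 : ℝ) : ℂ) * Complex.exp ((2 * θ : ℝ) * Complex.I) := by
    rw [hsdef, circleMap_zero, mul_pow, ← Complex.exp_nat_mul]
    push_cast; congr 2; ring
  have hsi2 : (s⁻¹) ^ 2 = ((r⁻¹ ^ 2 : ℝ) : ℂ) * Complex.exp ((-(2 * θ) : ℝ) * Complex.I) := by
    rw [inv_pow, hs2, mul_inv, ← Complex.exp_neg]
    push_cast; congr 2
    · rw [inv_pow]
    · ring
  have him : ∀ (a t : ℝ), 1 ≤ a →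
      |Real.sin t| ≤ ‖((a : ℝ) : ℂ) * Complex.exp ((t : ℝ) * Complex.I) + E T‖ := by
    intro a t ha
    refine le_trans ?_ (Complex.abs_im_le_norm _)
    rw [Complex.add_im, Complex.im_ofReal_mul, Complex.exp_ofReal_mul_I_im, Complex.ofReal_im,
      add_zero, abs_mul, abs_of_nonneg (by linarith : (0 : ℝ) ≤ a)]
    exact le_mul_of_one_le_left (abs_nonneg _) ha
  have hlow : ∀ (a t : ℝ), 0 ≤ a → a ≤ 1 →
      E T - 1 ≤ ‖((a : ℝ) : ℂ) * Complex.exp ((t : ℝ) * Complex.I) + E T‖ := by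
    intro a t ha0 ha
    have h := norm_sub_norm_le (E T : ℂ) (-(((a : ℝ) : ℂ) * Complex.exp ((t : ℝ) * Complex.I)))
    rw [sub_neg_eq_add, norm_neg, norm_mul, Complex.norm_exp_ofReal_mul_I, mul_one,
      Complex.norm_real, Complex.norm_real, Real.norm_eq_abs, Real.norm_eq_abs,
      abs_of_pos (by linarith), abs_of_nonneg ha0, add_comm] at h
    linarith
  rw [e, norm_mul, norm_mul, Complex.norm_real, Real.norm_eq_abs,
    abs_of_pos (by positivity : 0 < sigma T ^ 2 / (4 * E T)), mul_assoc]
  refine mul_le_mul_of_nonneg_left ?_ (by positivity)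
  rw [hs2, hsi2]
  -- Of s² and s⁻² one has modulus at least 1, and its factor is bounded below by its imaginary
  -- part; the other has modulus at most 1, and its factor is at least E - 1. The bound is uniform
  -- in r.
  rcases le_total 1 r with h | h
  · have h1 := him (r ^ 2) (2 * θ) (one_le_pow₀ h)
    have h2 := hlow (r⁻¹ ^ 2) (-(2 * θ)) (by positivity)
      (pow_le_one₀ (by positivity) (inv_le_one_of_one_le₀ h))
    rw [mul_comm]
    exact mul_le_mul h1 h2 (by linarith) (norm_nonneg _)
  · have h1 := him (r⁻¹ ^ 2) (-(2 * θ)) (one_le_pow₀ (one_le_inv_iff₀.mpr ⟨hr, h⟩))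
    have h2 := hlow (r ^ 2) (2 * θ) (by positivity) (pow_le_one₀ hr.le h)
    rw [Real.sin_neg, abs_neg] at h1
    exact mul_le_mul h2 h1 (abs_nonneg _) (norm_nonneg _)

end FourierExtension

/-! ### Approximation of analytic functions from the extension spaces. -/

namespace FourierExtension

open Polynomial Polynomial.Chebyshev

/-- The Dirichlet kernel sin((2n+1)η)/sin η is a polynomial in cos 2η: both sides obey the
three-term recursion with multiplier 2cos 2η. It turns the odd series into polynomials in m. -/
theorem eval_U_add_U_mul_sin (η : ℂ) (n : ℕ) :
    (U ℂ n + U ℂ ((n : ℤ) - 1)).eval (Complex.cos (2 * η)) * Complex.sin η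
      = Complex.sin ((2 * n + 1) * η) := by
  induction n using Nat.twoStepInduction with
  | zero => simp
  | one =>
    have e : (2 * ((1 : ℕ) : ℂ) + 1) * η = 2 * η + η := by push_cast; ring
    rw [e, Complex.sin_add, Complex.sin_two_mul, Complex.cos_two_mul]
    simp only [Nat.cast_one, U_one, sub_self, U_zero, eval_add, eval_mul, eval_ofNat, eval_X,
      eval_one]
    ring
  | more n ih1 ih2 =>
    have e1 : U ℂ ((n + 2 : ℕ) : ℤ) = 2 * X * U ℂ ((n + 1 : ℕ) : ℤ) - U ℂ (n : ℤ) := by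
      push_cast; exact U_add_two ℂ n
    have e2 : U ℂ (((n + 2 : ℕ) : ℤ) - 1) = 2 * X * U ℂ (((n + 1 : ℕ) : ℤ) - 1)
        - U ℂ ((n : ℤ) - 1) := by
      have := U_add_two ℂ ((n : ℤ) - 1)
      convert this using 2 <;> push_cast <;> ring_nf
    have e3 : (2 * ((n + 2 : ℕ) : ℂ) + 1) * η = (2 * ((n + 1 : ℕ) : ℂ) + 1) * η + 2 * η := by
      push_cast; ring
    have e4 : (2 * (n : ℂ) + 1) * η = (2 * ((n + 1 : ℕ) : ℂ) + 1) * η - 2 * η := by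
      push_cast; ring
    rw [e4, Complex.sin_sub] at ih1
    rw [e1, e2, e3, Complex.sin_add]
    simp only [eval_add, eval_sub, eval_mul, eval_ofNat, eval_X] at ih1 ih2 ⊢
    linear_combination 2 * Complex.cos (2 * η) * ih2 - ih1

theorem degree_U_add_U_lt {n N : ℕ} (h : n < N) : (U ℂ n + U ℂ ((n : ℤ) - 1)).degree < N := by
  refine (degree_add_le _ _).trans_lt (max_lt ?_ (degree_U_sub_one_lt (by simpa using h.le)))
  rw [degree_U_natCast]
  exact_mod_cast h

theorem norm_eval_U_add_U_le {K : ℝ} (hK : 1 < K) {z : ℂ} (hz : ‖z - 1‖ + ‖z + 1‖ ≤ K + K⁻¹)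
    (n : ℕ) : ‖(U ℂ n + U ℂ ((n : ℤ) - 1)).eval z‖ ≤ 2 * (K / (K - 1)) * K ^ n := by
  have hD : 0 ≤ K / (K - 1) := div_nonneg (by linarith) (by linarith)
  rw [eval_add]
  refine (norm_add_le _ _).trans ?_
  have h1 := norm_eval_U_le hK hz n
  have h2 : ‖(U ℂ ((n : ℤ) - 1)).eval z‖ ≤ K / (K - 1) * K ^ n := by
    cases n with
    | zero => simpa using hD
    | succ n =>
      rw [show ((n + 1 : ℕ) : ℤ) - 1 = n by push_cast; ring]
      refine (norm_eval_U_le hK hz n).trans ?_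
      gcongr
      · exact hK.le
      · omega
  linarith

theorem ae_sin_two_mul_ne_zero : ∀ᵐ θ : ℝ, Real.sin (2 * θ) ≠ 0 := by
  have hc : {θ : ℝ | Real.sin (2 * θ) = 0}.Countable := by
    refine (Set.countable_range fun n : ℤ => (n : ℝ) * Real.pi / 2).mono fun θ hθ => ?_
    obtain ⟨n, hn⟩ := Real.sin_eq_zero_iff.mp hθ
    exact ⟨n, by simp only; linarith⟩
  exact hc.ae_notMem _

/-- The circle means of `1 / cos (π x / (2 T))` are uniformly bounded on the annulus. -/
theorem exists_integral_div_sqrt_le {T : ℝ} (hT : 1 < T) : ∃ A : ℝ, 0 < A ∧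
    ∀ (g : ℂ → ℂ) (M r : ℝ), 0 ≤ M → (√(E T))⁻¹ < r → r < √(E T) →
      (∀ θ, ‖g (circleMap 0 r θ)‖ ≤ M) →
      ∫ θ in (0 : ℝ)..(2 * Real.pi),
        ‖g (circleMap 0 r θ) / sqrtOneSubSq (zeta T (circleMap 0 r θ))‖
          ≤ 2 * Real.pi * (A * M) := by
  have hpi := Real.pi_pos
  have hs := sigma_pos hT
  have hE := one_lt_E hT
  set κ := sigma T ^ 2 / (4 * E T) * (E T - 1) with hκ
  have hκ0 : 0 < κ := mul_pos (by positivity) (by linarith)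
  set I := ∫ θ in (0 : ℝ)..(2 * Real.pi), |Real.sin (2 * θ)| ^ (-(1 / 2) : ℝ) with hI
  have hI0 : 0 ≤ I := intervalIntegral.integral_nonneg (by positivity) fun _ _ => by positivity
  -- The main term is the circle mean of (κ|sin 2θ|)^(-1/2); the summand 1 only secures positivity.
  refine ⟨κ ^ (-(1 / 2) : ℝ) * I / (2 * Real.pi) + 1, by positivity, ?_⟩
  intro g M r hM h1 h2 hg
  have hr : 0 < r := (inv_pos.mpr (Real.sqrt_pos.mpr (by linarith))).trans h1
  have hle : ∫ θ in (0 : ℝ)..(2 * Real.pi),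
      ‖g (circleMap 0 r θ) / sqrtOneSubSq (zeta T (circleMap 0 r θ))‖
        ≤ ∫ θ in (0 : ℝ)..(2 * Real.pi),
          M * κ ^ (-(1 / 2) : ℝ) * |Real.sin (2 * θ)| ^ (-(1 / 2) : ℝ) := by
    refine (le_abs_self _).trans ?_
    rw [← Real.norm_eq_abs]
    refine intervalIntegral.norm_integral_le_of_norm_le (by positivity) ?_
      ((intervalIntegrable_abs_sin_rpow _ _).const_mul _)
    -- Zeros of sin 2θ are excluded because there the real power is 0 by convention and would bound
    -- nothing.
    filter_upwards [ae_sin_two_mul_ne_zero] with θ hθ _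
    have hz : ‖zeta T (circleMap 0 r θ)‖ < 1 :=
      norm_zeta_lt hT (by simpa [abs_of_pos hr] using h1) (by simpa [abs_of_pos hr] using h2)
    have hlow := norm_one_sub_zeta_sq_ge hT hr θ
    rw [← hκ, ← sqrtOneSubSq_sq hz, norm_pow] at hlow
    have hsin : 0 < |Real.sin (2 * θ)| := abs_pos.mpr hθ
    have hv : (κ * |Real.sin (2 * θ)|) ^ (1 / 2 : ℝ)
        ≤ ‖sqrtOneSubSq (zeta T (circleMap 0 r θ))‖ := by
      rw [← Real.sqrt_eq_rpow]
      exact Real.sqrt_le_iff.mpr ⟨norm_nonneg _, hlow⟩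
    rw [norm_norm, norm_div, mul_assoc, ← Real.mul_rpow hκ0.le hsin.le,
      Real.rpow_neg (by positivity), div_eq_mul_inv]
    gcongr
    exact hg θ
  refine hle.trans ?_
  rw [intervalIntegral.integral_const_mul, ← hI]
  have e : 2 * Real.pi * ((κ ^ (-(1 / 2) : ℝ) * I / (2 * Real.pi) + 1) * M)
      = M * κ ^ (-(1 / 2) : ℝ) * I + 2 * Real.pi * M := by
    field_simp
  rw [e]
  linarith [mul_nonneg (by positivity : 0 ≤ 2 * Real.pi) hM]

theorem sqrt_inv_pow_two_mul {ρ : ℝ} (hρ : 0 ≤ ρ) (n : ℕ) : (√ρ)⁻¹ ^ (2 * n) = ρ⁻¹ ^ n := by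
  rw [pow_mul, inv_pow, Real.sq_sqrt hρ]

theorem geom_range_le {r : ℝ} (hr : 0 ≤ r) (N : ℕ) :
    ∑ n ∈ Finset.range N, r ^ n ≤ ∑ n ∈ Finset.range (N + 1), r ^ n := by
  rw [Finset.sum_range_succ]; linarith [pow_nonneg hr N]

theorem geom_range_succ_le {r : ℝ} (N : ℕ) :
    ∑ n ∈ Finset.range N, r ^ (n + 1) ≤ ∑ n ∈ Finset.range (N + 1), r ^ n := by
  rw [Finset.sum_range_succ']; linarith [pow_zero r]

/-- Approximation of the even part of an analytic function. -/
theorem exists_even_approx {T ρ : ℝ} (hT : 1 < T) (hρ : 1 < ρ) {h : ℤ → ℂ} {B : ℝ}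
    (hB : 0 ≤ B) (hh : ∀ k, ‖h k‖ ≤ B * (√ρ)⁻¹ ^ k.natAbs) (N : ℕ) :
    ∃ p : ℂ[X], p.degree < (N + 1 : ℕ) ∧
      (∀ (η : ℝ) (a : ℂ), HasSum (fun n : ℕ => h (2 * n) * Complex.cos (2 * n * η) +
        h (-(2 * (n + 1))) * Complex.cos (2 * (n + 1) * η)) a →
        ‖p.eval (Real.cos (2 * η) : ℂ) - a‖ ≤ 2 * B * ρ⁻¹ ^ N / (1 - ρ⁻¹)) ∧
      ∀ x : ℝ, ‖p.eval (mReal T x : ℂ)‖ ≤ 2 * B * (E T / (E T - 1)) *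
        ∑ k ∈ Finset.range (N + 1), (E T / ρ) ^ k := by
  have hρ0 : 0 < ρ := by linarith
  have hρi : ρ⁻¹ < 1 := inv_lt_one_of_one_lt₀ hρ
  have hE := one_lt_E hT
  have hD : 0 ≤ E T / (E T - 1) := div_nonneg (by linarith) (by linarith)
  have h1 : ∀ n : ℕ, ‖h (2 * n)‖ ≤ B * ρ⁻¹ ^ n := fun n => by
    have := hh (2 * n)
    rwa [show (2 * (n : ℤ)).natAbs = 2 * n by omega, sqrt_inv_pow_two_mul hρ0.le] at this
  have h2 : ∀ n : ℕ, ‖h (-(2 * (n + 1)))‖ ≤ B * ρ⁻¹ ^ (n + 1) := fun n => by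
    have := hh (-(2 * (n + 1)))
    rwa [show (-(2 * ((n : ℤ) + 1))).natAbs = 2 * (n + 1) by omega,
      sqrt_inv_pow_two_mul hρ0.le] at this
  -- The n-th paired term contains both T_n and T_{n+1}, so stopping before n = N gives degree at
  -- most N.
  refine ⟨∑ n ∈ Finset.range N, (Polynomial.C (h (2 * n)) * Chebyshev.T ℂ n +
    Polynomial.C (h (-(2 * (n + 1)))) * Chebyshev.T ℂ ((n + 1 : ℕ) : ℤ)), ?_, ?_, ?_⟩
  · rw [← mem_degreeLT]
    refine Submodule.sum_mem _ fun n hn => Submodule.add_mem _ ?_ ?_ <;>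
      rw [← smul_eq_C_mul] <;> refine Submodule.smul_mem _ _ (mem_degreeLT.mpr (degree_T_lt ?_)) <;>
      have := Finset.mem_range.mp hn <;> omega
  · intro η a ha
    have e : (∑ n ∈ Finset.range N, (Polynomial.C (h (2 * n)) * Chebyshev.T ℂ n +
        Polynomial.C (h (-(2 * (n + 1)))) * Chebyshev.T ℂ ((n + 1 : ℕ) : ℤ))).eval
          (Real.cos (2 * η) : ℂ) = ∑ n ∈ Finset.range N, (h (2 * n) * Complex.cos (2 * n * η) +
        h (-(2 * (n + 1))) * Complex.cos (2 * (n + 1) * η)) := by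
      rw [eval_finsetSum]
      refine Finset.sum_congr rfl fun n _ => ?_
      rw [eval_add, eval_mul, eval_mul, eval_C, eval_C, Complex.ofReal_cos, T_complex_cos,
        T_complex_cos]
      push_cast
      congr 3 <;> ring
    rw [e]
    refine norm_sub_le_of_geometric_bound_of_hasSum hρi (fun n => ?_) ha N
    have hc : ∀ t : ℝ, ‖Complex.cos t‖ ≤ 1 := fun t => by
      rw [← Complex.ofReal_cos, Complex.norm_real]; exact Real.abs_cos_le_one t
    have c1 := hc (2 * n * η)
    have c2 := hc (2 * (n + 1) * η)
    push_cast at c1 c2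
    refine (norm_add_le _ _).trans ?_
    rw [norm_mul, norm_mul]
    have h3 : ρ⁻¹ ^ (n + 1) ≤ ρ⁻¹ ^ n := pow_le_pow_of_le_one (by positivity) hρi.le (by omega)
    have h4 := mul_le_of_le_one_right (norm_nonneg (h (2 * n))) c1
    have h5 := mul_le_of_le_one_right (norm_nonneg (h (-(2 * (n + 1))))) c2
    have h6 := mul_le_mul_of_nonneg_left h3 hB
    linarith [h1 n, h2 n]
  · intro x
    have hz := norm_mReal_sub_add_norm hT x
    rw [eval_finsetSum]
    have hterm : ∀ n ∈ Finset.range N, ‖(Polynomial.C (h (2 * n)) * Chebyshev.T ℂ n +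
        Polynomial.C (h (-(2 * (n + 1)))) * Chebyshev.T ℂ ((n + 1 : ℕ) : ℤ)).eval (mReal T x : ℂ)‖
        ≤ B * (E T / (E T - 1)) * ((E T / ρ) ^ n + (E T / ρ) ^ (n + 1)) := by
      intro n _
      rw [eval_add, eval_mul, eval_mul, eval_C, eval_C]
      refine (norm_add_le _ _).trans ?_
      rw [norm_mul, norm_mul]
      have t1 := mul_le_mul (h1 n) (norm_eval_T_le hE hz n) (norm_nonneg _) (by positivity)
      have t2 := mul_le_mul (h2 n) (norm_eval_T_le hE hz (n + 1)) (norm_nonneg _) (by positivity)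
      refine (add_le_add t1 t2).trans (le_of_eq ?_)
      rw [div_pow, div_pow, inv_pow, inv_pow]
      ring
    refine (norm_sum_le_of_le _ hterm).trans ?_
    rw [← Finset.mul_sum, Finset.sum_add_distrib]
    have s1 := geom_range_le (r := E T / ρ) (by positivity) N
    have s2 := geom_range_succ_le (r := E T / ρ) N
    have := mul_le_mul_of_nonneg_left (add_le_add s1 s2) (mul_nonneg hB hD)
    linarith

/-- Approximation of the odd part of an analytic function. -/
theorem exists_odd_approx {T ρ : ℝ} (hT : 1 < T) (hρ : 1 < ρ) {h : ℤ → ℂ} {B : ℝ}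
    (hB : 0 ≤ B) (hh : ∀ k, ‖h k‖ ≤ B * (√ρ)⁻¹ ^ k.natAbs) (N : ℕ) :
    ∃ q : ℂ[X], q.degree < N ∧
      (∀ (η : ℝ) (a : ℂ), HasSum (fun n : ℕ => (h (2 * n + 1) - h (-(2 * n + 1))) * Complex.I *
        Complex.sin ((2 * n + 1) * η)) a →
        ‖2 * sigma T * Real.sin η * q.eval (Real.cos (2 * η) : ℂ) - a‖
          ≤ 2 * B * ρ⁻¹ ^ N / (1 - ρ⁻¹)) ∧
      ∀ x : ℝ, ‖q.eval (mReal T x : ℂ)‖ ≤ 2 * B * (E T / (E T - 1)) / sigma T *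
        ∑ k ∈ Finset.range (N + 1), (E T / ρ) ^ k := by
  have hρ0 : 0 < ρ := by linarith
  have hρi : ρ⁻¹ < 1 := inv_lt_one_of_one_lt₀ hρ
  have hE := one_lt_E hT
  have hs := sigma_pos hT
  have hsc : (sigma T : ℂ) ≠ 0 := by exact_mod_cast hs.ne'
  have hD : 0 ≤ E T / (E T - 1) := div_nonneg (by linarith) (by linarith)
  set d : ℕ → ℂ := fun n => (h (2 * n + 1) - h (-(2 * n + 1))) * Complex.I with hd
  have hdn : ∀ n, ‖d n‖ ≤ 2 * B * ρ⁻¹ ^ n := by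
    intro n
    have hRi : (√ρ)⁻¹ ≤ 1 := inv_le_one_of_one_le₀ (Real.one_le_sqrt.mpr hρ.le)
    have h3 : (√ρ)⁻¹ ^ (2 * n + 1) ≤ ρ⁻¹ ^ n := by
      rw [← sqrt_inv_pow_two_mul hρ0.le]
      exact pow_le_pow_of_le_one (by positivity) hRi (by omega)
    have h1 := hh (2 * n + 1)
    have h2 := hh (-(2 * n + 1))
    rw [show (2 * (n : ℤ) + 1).natAbs = 2 * n + 1 by omega] at h1
    rw [show (-(2 * (n : ℤ) + 1)).natAbs = 2 * n + 1 by omega] at h2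
    rw [hd, norm_mul, Complex.norm_I, mul_one]
    have h4 := mul_le_mul_of_nonneg_left h3 hB
    linarith [norm_sub_le (h (2 * n + 1)) (h (-(2 * n + 1)))]
  -- The divisor 2σ compensates sin(πx/T) = cos(πx/(2T)) · 2σ sin η.
  refine ⟨∑ n ∈ Finset.range N, Polynomial.C (d n / (2 * sigma T)) *
    (U ℂ n + U ℂ ((n : ℤ) - 1)), ?_, ?_, ?_⟩
  · rw [← mem_degreeLT]
    refine Submodule.sum_mem _ fun n hn => ?_
    rw [← smul_eq_C_mul]
    exact Submodule.smul_mem _ _ (mem_degreeLT.mpr (degree_U_add_U_lt (Finset.mem_range.mp hn)))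
  · intro η a ha
    have e : 2 * sigma T * Real.sin η * (∑ n ∈ Finset.range N, Polynomial.C (d n / (2 * sigma T)) *
        (U ℂ n + U ℂ ((n : ℤ) - 1))).eval (Real.cos (2 * η) : ℂ)
        = ∑ n ∈ Finset.range N, d n * Complex.sin ((2 * n + 1) * η) := by
      rw [eval_finsetSum, Finset.mul_sum]
      refine Finset.sum_congr rfl fun n _ => ?_
      rw [eval_mul, eval_C, ← eval_U_add_U_mul_sin]
      push_cast
      field_simp
    rw [e]
    refine norm_sub_le_of_geometric_bound_of_hasSum hρi (fun n => ?_) ha N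
    have hc : ‖Complex.sin ((2 * n + 1) * η)‖ ≤ 1 := by
      have : ((2 * n + 1) * η : ℂ) = (((2 * n + 1) * η : ℝ) : ℂ) := by push_cast; ring
      rw [this, ← Complex.ofReal_sin, Complex.norm_real]; exact Real.abs_sin_le_one _
    rw [norm_mul]
    exact (mul_le_of_le_one_right (norm_nonneg _) hc).trans (hdn n)
  · intro x
    have hz := norm_mReal_sub_add_norm hT x
    rw [eval_finsetSum]
    have hterm : ∀ n ∈ Finset.range N, ‖(Polynomial.C (d n / (2 * sigma T)) *
        (U ℂ n + U ℂ ((n : ℤ) - 1))).eval (mReal T x : ℂ)‖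
        ≤ 2 * B * (E T / (E T - 1)) / sigma T * (E T / ρ) ^ n := by
      intro n _
      have hn2 : ‖(2 * sigma T : ℂ)‖ = 2 * sigma T := by
        rw [norm_mul, Complex.norm_two, Complex.norm_real, Real.norm_of_nonneg hs.le]
      rw [eval_mul, eval_C, norm_mul, norm_div, hn2]
      have t1 := mul_le_mul (div_le_div_of_nonneg_right (hdn n) (by positivity : 0 ≤ 2 * sigma T))
        (norm_eval_U_add_U_le hE hz n) (norm_nonneg _) (by positivity)
      refine t1.trans (le_of_eq ?_)
      rw [div_pow, inv_pow]
      field_simp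
    refine (norm_sum_le_of_le _ hterm).trans ?_
    rw [← Finset.mul_sum]
    exact mul_le_mul_of_nonneg_left (geom_range_le (by positivity) N)
      (div_nonneg (by positivity) hs.le)

/-- Approximation of an analytic function on `[-1, 1]` from the extension spaces. -/
theorem exists_approx {T ρ : ℝ} (hT : 1 < T) (hρ : 1 < ρ) (hρE : ρ ≤ E T) : ∃ C : ℝ, 0 < C ∧
    ∀ (f : ℂ → ℂ) (M : ℝ),
      (∀ s : ℂ, (√ρ)⁻¹ < ‖s‖ → ‖s‖ < √ρ → DifferentiableAt ℂ f (mInv T s)) →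
      (∀ s : ℂ, (√ρ)⁻¹ < ‖s‖ → ‖s‖ < √ρ → ‖f (mInv T s)‖ ≤ M) →
      ∀ N : ℕ, ∃ p q : ℂ[X], p.degree < (N + 1 : ℕ) ∧ q.degree < N ∧
        (∀ x ∈ Set.Icc (-1 : ℝ) 1, ‖f x - ext T p q x‖ ≤ C * M * ρ⁻¹ ^ N) ∧
        ∀ x : ℝ, ‖ext T p q x‖ ≤ C * M * ∑ k ∈ Finset.range (N + 1), (E T / ρ) ^ k := by
  obtain ⟨A, hA0, hA⟩ := exists_integral_div_sqrt_le hT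
  have hpi := Real.pi_pos
  have hs := sigma_pos hT
  have hE := one_lt_E hT
  have hE1 : 0 < E T - 1 := by linarith
  have hρ0 : 0 < ρ := by linarith
  have hρi : ρ⁻¹ < 1 := inv_lt_one_of_one_lt₀ hρ
  have hρi' : 0 < 1 - ρ⁻¹ := by linarith
  set D := E T / (E T - 1) with hD
  have hD0 : 0 < D := div_pos (by linarith) hE1
  refine ⟨2 * D + 2 * A * D / sigma T + (2 + 2 * A) / (1 - ρ⁻¹), by positivity, ?_⟩
  intro f M hf hM N
  have hR : 1 < √ρ := by rwa [Real.lt_sqrt (by norm_num), one_pow]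
  have hRi : (√ρ)⁻¹ < 1 := inv_lt_one_of_one_lt₀ hR
  have hRE : √ρ ≤ √(E T) := Real.sqrt_le_sqrt hρE
  have hRE' : (√(E T))⁻¹ ≤ (√ρ)⁻¹ := inv_anti₀ (by positivity) hRE
  have hM0 : 0 ≤ M := (norm_nonneg _).trans (hM 1 (by simpa using hRi) (by simpa using hR))
  have hz : ∀ s : ℂ, (√ρ)⁻¹ < ‖s‖ → ‖s‖ < √ρ → ‖zeta T s‖ < 1 := fun s h1 h2 =>
    norm_zeta_lt hT (hRE'.trans_lt h1) (h2.trans_le hRE)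
  have hne : ∀ s : ℂ, (√ρ)⁻¹ < ‖s‖ → s ≠ 0 := fun s h1 =>
    norm_pos_iff.mp ((inv_pos.mpr (by positivity)).trans h1)
  have hcirc : ∀ r θ : ℝ, (√ρ)⁻¹ < r → r < √ρ →
      (√ρ)⁻¹ < ‖circleMap 0 r θ‖ ∧ ‖circleMap 0 r θ‖ < √ρ := fun r θ h1 h2 => by
    have hr : 0 < r := (inv_pos.mpr (by positivity)).trans h1
    rw [norm_circleMap_zero, abs_of_pos hr]
    exact ⟨h1, h2⟩
  have hHd : ∀ s : ℂ, (√ρ)⁻¹ < ‖s‖ → ‖s‖ < √ρ → DifferentiableAt ℂ (fun s => f (mInv T s)) s :=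
    fun s h1 h2 => DifferentiableAt.comp s (hf s h1 h2)
      (differentiableAt_mInv (hne s h1) (hz s h1 h2))
  -- This quotient is f(x)/cos(πx/(2T)), expanded for the odd part.
  have hKd : ∀ s : ℂ, (√ρ)⁻¹ < ‖s‖ → ‖s‖ < √ρ →
      DifferentiableAt ℂ (fun s => f (mInv T s) / sqrtOneSubSq (zeta T s)) s :=
    fun s h1 h2 => (hHd s h1 h2).div (DifferentiableAt.comp (g := sqrtOneSubSq) s
      (differentiableAt_sqrtOneSubSq (hz s h1 h2)) (differentiableAt_zeta T (hne s h1)))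
      (sqrtOneSubSq_ne_zero _)
  obtain ⟨h, hh, hsum⟩ := exists_laurent_hasSum (B := M) hR hHd (by
    intro r h1 h2
    have := intervalIntegral.norm_integral_le_of_norm_le_const (a := 0) (b := 2 * Real.pi)
      (f := fun θ => ‖f (mInv T (circleMap 0 r θ))‖) (C := M) fun θ _ => by
        rw [norm_norm]; exact hM _ (hcirc r θ h1 h2).1 (hcirc r θ h1 h2).2
    rw [sub_zero, abs_of_pos (by positivity)] at this
    refine (le_abs_self _).trans (this.trans (le_of_eq (mul_comm _ _))))
  obtain ⟨k, hk, ksum⟩ := exists_laurent_hasSum (B := A * M) hR hKd (by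
    intro r h1 h2
    exact hA (fun s => f (mInv T s)) M r hM0 (hRE'.trans_lt h1) (h2.trans_le hRE)
      fun θ => hM _ (hcirc r θ h1 h2).1 (hcirc r θ h1 h2).2)
  obtain ⟨p, hpd, hpa, hpb⟩ := exists_even_approx hT hρ hM0 hh N
  obtain ⟨q, hqd, hqa, hqb⟩ := exists_odd_approx hT hρ (mul_nonneg hA0.le hM0) hk N
  refine ⟨p, q, hpd, hqd, ?_, ?_⟩
  · intro x hx
    have hx' : -x ∈ Set.Icc (-1 : ℝ) 1 := ⟨by linarith [hx.2], by linarith [hx.1]⟩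
    have hsinη : Real.sin (Real.pi / (2 * T) * x) ^ 2 ≤ sigma T ^ 2 := by
      have h1 := (mReal_mem_Icc hT hx).1
      rw [mReal, mul_div_assoc] at h1
      have h2 : Real.sin (Real.pi / (2 * T) * x) ^ 2 / sigma T ^ 2 ≤ 1 := by linarith
      rwa [div_le_one (by positivity)] at h2
    have habs := abs_le_of_sq_le_sq' hsinη hs.le
    -- The angle for which e^{iη} is mapped to x by `mInv`; then m(x) = cos 2η. The angles π - η, -η
    -- and π + η are mapped to x, -x and -x.
    set η := Real.arcsin (Real.sin (Real.pi / (2 * T) * x) / sigma T) with hη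
    have hsin : sigma T * Real.sin η = Real.sin (Real.pi / (2 * T) * x) := by
      rw [hη, Real.sin_arcsin (by rw [le_div_iff₀ hs]; linarith [habs.1])
        (by rw [div_le_iff₀ hs]; linarith [habs.2])]
      field_simp
    have hcos2 : Real.cos (2 * η) = mReal T x := by
      rw [Real.cos_two_mul, Real.cos_sq', mReal, ← hsin]
      field_simp
      ring
    have val : ∀ ξ y : ℝ, y ∈ Set.Icc (-1 : ℝ) 1 →
        sigma T * Real.sin ξ = Real.sin (Real.pi / (2 * T) * y) →
        mInv T (Complex.exp (ξ * Complex.I)) = y ∧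
        sqrtOneSubSq (zeta T (Complex.exp (ξ * Complex.I)))
          = (Real.cos (Real.pi / (2 * T) * y) : ℝ) := by
      intro ξ y hy hξ
      exact mInv_of_zeta_eq hT hy (by rw [zeta_exp, hξ])
    have hsinneg : sigma T * Real.sin (-η) = Real.sin (Real.pi / (2 * T) * -x) := by
      rw [Real.sin_neg, mul_neg, mul_neg, Real.sin_neg, hsin]
    obtain ⟨v1, w1⟩ := val η x hx hsin
    obtain ⟨v2, w2⟩ := val (Real.pi - η) x hx (by rw [Real.sin_pi_sub, hsin])
    obtain ⟨v3, w3⟩ := val (-η) (-x) hx' hsinneg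
    obtain ⟨v4, w4⟩ := val (Real.pi - -η) (-x) hx' (by rw [Real.sin_pi_sub, hsinneg])
    have hcneg : Real.cos (Real.pi / (2 * T) * -x) = Real.cos (Real.pi / (2 * T) * x) := by
      rw [mul_neg, Real.cos_neg]
    rw [hcneg] at w3 w4
    have hev := (hasSum_even_odd hsum (a := f x) (b := f ((-x : ℝ) : ℂ)) (η := η)
      (by rw [v1]) (by rw [v2]) (by rw [v3]) (by rw [v4])).1
    set ct := Real.cos (Real.pi / (2 * T) * x) with hct
    have hod := (hasSum_even_odd ksum (a := f x / (ct : ℂ)) (b := f ((-x : ℝ) : ℂ) / (ct : ℂ))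
      (η := η) (by rw [v1, w1]) (by rw [v2, w2]) (by rw [v3, w3]) (by rw [v4, w4])).2
    have hct0 : (ct : ℂ) ≠ 0 := by rw [← w1]; exact sqrtOneSubSq_ne_zero _
    have b1 := hpa η _ hev
    have b2 := hqa η _ hod
    rw [hcos2] at b1 b2
    have hsinu : (Real.sin (Real.pi / T * x) : ℂ) = ct * (2 * sigma T * Real.sin η) := by
      have e : Real.pi / T * x = 2 * (Real.pi / (2 * T) * x) := by ring
      have : Real.sin (Real.pi / T * x) = ct * (2 * sigma T * Real.sin η) := by
        rw [e, Real.sin_two_mul, ← hsin]; ring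
      exact_mod_cast this
    -- The error splits into the even error and cos(πx/(2T)) times the error for the quotient; the
    -- cosine is at most 1 in modulus.
    have key : ext T p q x - f x = (p.eval (mReal T x : ℂ) - (f x + f ((-x : ℝ) : ℂ)) / 2) +
        ct * (2 * sigma T * Real.sin η * q.eval (mReal T x : ℂ) -
          (f x / (ct : ℂ) - f ((-x : ℝ) : ℂ) / (ct : ℂ)) / 2) := by
      rw [ext, hsinu]
      field_simp
      ring
    rw [norm_sub_rev, key]
    refine (norm_add_le _ _).trans ?_
    rw [norm_mul, Complex.norm_real, Real.norm_eq_abs]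
    have b3 := mul_le_of_le_one_left (norm_nonneg (2 * sigma T * Real.sin η *
      q.eval (mReal T x : ℂ) - (f x / (ct : ℂ) - f ((-x : ℝ) : ℂ) / (ct : ℂ)) / 2))
      (Real.abs_cos_le_one (Real.pi / (2 * T) * x))
    refine (add_le_add b1 (b3.trans b2)).trans ?_
    have e : 2 * M * ρ⁻¹ ^ N / (1 - ρ⁻¹) + 2 * (A * M) * ρ⁻¹ ^ N / (1 - ρ⁻¹)
        = (2 + 2 * A) / (1 - ρ⁻¹) * M * ρ⁻¹ ^ N := by ring
    rw [e]
    gcongr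
    have : 0 ≤ 2 * D + 2 * A * D / sigma T := by positivity
    linarith
  · intro x
    refine (norm_ext_le_of_norm_eval_le (hpb x) (hqb x)).trans ?_
    have hG : 0 ≤ ∑ k ∈ Finset.range (N + 1), (E T / ρ) ^ k :=
      Finset.sum_nonneg fun _ _ => by positivity
    have e : 2 * M * D * ∑ k ∈ Finset.range (N + 1), (E T / ρ) ^ k +
        2 * (A * M) * D / sigma T * ∑ k ∈ Finset.range (N + 1), (E T / ρ) ^ k
        = (2 * D + 2 * A * D / sigma T) * M * ∑ k ∈ Finset.range (N + 1), (E T / ρ) ^ k := by ring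
    rw [e]
    have : 0 ≤ (2 + 2 * A) / (1 - ρ⁻¹) := by positivity
    exact mul_le_mul_of_nonneg_right
      (mul_le_mul_of_nonneg_right (le_add_of_nonneg_right this) hM0) hG

end FourierExtension

/-! ### Stability of the coefficients and the combined bound. -/

namespace FourierExtension

open Polynomial MeasureTheory

theorem l2Norm_sq_eq_setIntegral (g : ℝ → ℂ) :
    l2Norm g ^ 2 = ∫ x in Set.Ioo (-1 : ℝ) 1, ‖g x‖ ^ 2 := by
  rw [l2Norm_sq, intervalIntegral.integral_of_le (by norm_num), integral_Ioc_eq_integral_Ioo]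

theorem l2Norm_sub_sq_le {u v : ℝ → ℂ} (hu : MemLp u 2 (volume.restrict (Set.Ioo (-1 : ℝ) 1)))
    (hv : MemLp v 2 (volume.restrict (Set.Ioo (-1 : ℝ) 1))) :
    l2Norm (fun x => u x - v x) ^ 2 ≤ 2 * (l2Norm u ^ 2 + l2Norm v ^ 2) := by
  have iu := hu.integrable_norm_pow (by norm_num)
  have iv := hv.integrable_norm_pow (by norm_num)
  have iuv := (hu.sub hv).integrable_norm_pow (by norm_num)
  rw [l2Norm_sq_eq_setIntegral, l2Norm_sq_eq_setIntegral, l2Norm_sq_eq_setIntegral,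
    ← integral_add iu iv, ← integral_const_mul]
  refine integral_mono iuv ((iu.add iv).const_mul 2) fun x => ?_
  have h := norm_sub_le (u x) (v x)
  change ‖u x - v x‖ ^ 2 ≤ 2 * (‖u x‖ ^ 2 + ‖v x‖ ^ 2)
  nlinarith [norm_nonneg (u x - v x), sq_nonneg (‖u x‖ - ‖v x‖)]

theorem memLp_of_continuousOn {g : ℝ → ℂ} (hg : ContinuousOn g (Set.Icc (-1 : ℝ) 1)) :
    MemLp g 2 (volume.restrict (Set.Ioo (-1 : ℝ) 1)) := by
  obtain ⟨B, hB⟩ := isCompact_Icc.exists_bound_of_continuousOn hg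
  refine MemLp.of_bound ((hg.mono Set.Ioo_subset_Icc_self).aestronglyMeasurable
    measurableSet_Ioo) B ?_
  filter_upwards [ae_restrict_mem measurableSet_Ioo] with x hx
  exact hB x (Set.Ioo_subset_Icc_self hx)

theorem l2Norm_le_of_norm_le {g : ℝ → ℂ} {ε : ℝ} (hg : ContinuousOn g (Set.Icc (-1 : ℝ) 1))
    (h : ∀ x ∈ Set.Icc (-1 : ℝ) 1, ‖g x‖ ≤ ε) : l2Norm g ≤ 2 * ε := by
  have hε : 0 ≤ ε := (norm_nonneg _).trans (h 0 (by norm_num))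
  refine abs_le_of_sq_le_sq' ?_ (by positivity) |>.2
  rw [l2Norm_sq]
  have : ∫ x in (-1 : ℝ)..1, ‖g x‖ ^ 2 ≤ ∫ _ in (-1 : ℝ)..1, ε ^ 2 := by
    refine intervalIntegral.integral_mono_on (by norm_num) ?_ (by simp) fun x hx =>
      pow_le_pow_left₀ (norm_nonneg _) (h x hx) 2
    refine ContinuousOn.intervalIntegrable ?_
    rw [Set.uIcc_of_le (by norm_num)]
    exact hg.norm.pow 2
  rw [intervalIntegral.integral_const, smul_eq_mul] at this
  nlinarith [sq_nonneg ε]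

theorem contSum_sub (T : ℝ) (N : ℕ) (a b : EuclideanSpace ℂ (Finset.Icc (-(N : ℤ)) N)) (x : ℝ) :
    contSum T N (a - b) x = contSum T N a x - contSum T N b x := by
  simp [contSum, sub_mul, Finset.sum_sub_distrib]

theorem discSum_sub (T : ℝ) (N : ℕ) (a b : EuclideanSpace ℂ (Finset.Icc (-(N : ℤ) - 1) N)) (x : ℝ) :
    discSum T N (a - b) x = discSum T N a x - discSum T N b x := by
  simp [discSum, sub_mul, Finset.sum_sub_distrib]

theorem continuous_contSum (T : ℝ) (N : ℕ) (a : EuclideanSpace ℂ (Finset.Icc (-(N : ℤ)) N)) :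
    Continuous (contSum T N a) := by
  unfold contSum phi; fun_prop

/-- Stability of the coefficients of the continuous Fourier extension. -/
theorem exists_norm_sub_le_of_continuous {T : ℝ} (hT : 1 < T) : ∃ C : ℝ, 0 < C ∧
    ∀ (f : ℝ → ℂ), MemLp f 2 (volume.restrict (Set.Ioo (-1 : ℝ) 1)) →
    ∀ (N : ℕ) (a b : EuclideanSpace ℂ (Finset.Icc (-(N : ℤ)) N)), IsContinuousFECoeff T N f a →
      ‖a - b‖ ≤ C * l2Norm (fun x => f x - contSum T N b x) * E T ^ N := by
  have hE := one_lt_E hT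
  have hE1 : 0 < E T - 1 := by linarith
  have hE0 : 0 < E T := by linarith
  have hs := sigma_pos hT
  have hpi := Real.pi_pos
  have hT0 : 0 < T := by linarith
  refine ⟨2 * T * (4 * (Real.pi / (T * sigma T ^ 2)) * (E T / (E T - 1)) ^ 2 * 2),
    by positivity, ?_⟩
  intro f hf N a b ha
  obtain ⟨p, q, hp, hq, hpq⟩ := exists_ext_eq_contSum hT N (a - b)
  have hq' : q.degree < (N + 1 : ℕ) := hq.trans (by exact_mod_cast Nat.lt_succ_self N)
  set L := l2Norm (fun x => f x - contSum T N b x) with hL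
  have hL0 : 0 ≤ L := l2Norm_nonneg _
  have hfa : MemLp (fun x => f x - contSum T N a x) 2 (volume.restrict (Set.Ioo (-1 : ℝ) 1)) :=
    hf.sub (memLp_of_continuousOn (continuous_contSum T N a).continuousOn)
  have hfb : MemLp (fun x => f x - contSum T N b x) 2 (volume.restrict (Set.Ioo (-1 : ℝ) 1)) :=
    hf.sub (memLp_of_continuousOn (continuous_contSum T N b).continuousOn)
  -- The sum with coefficients a - b is a difference of two residuals, and by minimality neither
  -- exceeds L.
  have hdiff : l2Norm (contSum T N (a - b)) ≤ 2 * L := by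
    have h := l2Norm_sub_sq_le hfb hfa
    have e : (fun x => f x - contSum T N b x - (f x - contSum T N a x)) = contSum T N (a - b) := by
      ext x; rw [contSum_sub]; ring
    rw [e] at h
    have h2 := ha b
    have h3 := pow_le_pow_left₀ (l2Norm_nonneg _) h2 2
    refine abs_le_of_sq_le_sq' ?_ (by positivity) |>.2
    linarith
  have hbound : ∀ x, ‖contSum T N (a - b) x‖ ≤ 4 * (Real.pi / (T * sigma T ^ 2)) *
      (E T / (E T - 1)) ^ 2 * (2 * L) * E T ^ N := by
    intro x
    rw [hpq] at hdiff ⊢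
    refine (norm_ext_le_l2Norm hT hp hq' x).trans ?_
    gcongr
  refine (norm_le_of_contSum_le hT (a - b) (by positivity) fun x _ => hbound x).trans
    (le_of_eq (by ring))

/-- Stability of the coefficients of the discrete Fourier extension. -/
theorem exists_norm_sub_le_of_discrete {T : ℝ} (hT : 1 < T) : ∃ C : ℝ, 0 < C ∧
    ∀ (f : ℝ → ℂ) (N : ℕ) (a b : EuclideanSpace ℂ (Finset.Icc (-(N : ℤ) - 1) N)) (ε : ℝ),
      IsDiscreteFECoeff T N f a →
      (∀ n ∈ Finset.Icc (-(N : ℤ) - 1) N, ‖f (node T N n) - discSum T N b (node T N n)‖ ≤ ε) →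
      ‖a - b‖ ≤ C * ε * E T ^ N := by
  have hE := one_lt_E hT
  have hE1 : 0 < E T - 1 := by linarith
  have hE0 : 0 < E T := by linarith
  have hs := sigma_pos hT
  refine ⟨2 * (2 * (1 + 1 / sigma T ^ 2) * (E T / (E T - 1)) ^ 2), by positivity, ?_⟩
  intro f N a b ε ha hε
  have hε0 : 0 ≤ ε := (norm_nonneg _).trans (hε 0 (by rw [Finset.mem_Icc]; omega))
  obtain ⟨p₀, q₀, hp₀, hq₀, hint⟩ := exists_ext_eq_at_nodes hT N f
  obtain ⟨a₀, ha₀⟩ := exists_discSum_eq_ext hT N hp₀ hq₀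
  -- Some element interpolates f at all nodes, so the least-squares minimum is 0 and the minimizer
  -- interpolates too.
  have hzero : ∀ n ∈ Finset.Icc (-(N : ℤ) - 1) N, f (node T N n) = discSum T N a (node T N n) := by
    have h := ha a₀
    have h0 : ∑ n ∈ Finset.Icc (-(N : ℤ) - 1) N,
        ‖f (node T N n) - discSum T N a₀ (node T N n)‖ ^ 2 = 0 :=
      Finset.sum_eq_zero fun n hn => by rw [ha₀, hint n hn, sub_self, norm_zero]; norm_num
    rw [h0] at h
    have h1 := (Finset.sum_eq_zero_iff_of_nonneg fun n _ => by positivity).mp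
      (le_antisymm h (Finset.sum_nonneg fun n _ => by positivity))
    intro n hn
    exact sub_eq_zero.mp (norm_eq_zero.mp (pow_eq_zero_iff two_ne_zero |>.mp (h1 n hn)))
  obtain ⟨p, q, hp, hq, hpq⟩ := exists_ext_eq_discSum hT N (a - b)
  have hnode : ∀ n ∈ Finset.Icc (-(N : ℤ) - 1) N, ‖ext T p q (node T N n)‖ ≤ ε := by
    intro n hn
    rw [← hpq, discSum_sub, ← hzero n hn]
    exact hε n hn
  have hbound : ∀ x, ‖discSum T N (a - b) x‖ ≤
      2 * (1 + 1 / sigma T ^ 2) * (E T / (E T - 1)) ^ 2 * ε * E T ^ N := by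
    intro x
    rw [hpq]
    exact norm_ext_le_nodes hT hp hq hnode x
  refine (norm_le_of_discSum_le hT (a - b) (by positivity) fun x _ => hbound x).trans
    (le_of_eq (by ring))

theorem add_inv_le_add_inv {r R : ℝ} (h1 : 1 < r) (h2 : r ≤ R) : r + r⁻¹ ≤ R + R⁻¹ := by
  rcases h2.eq_or_lt with rfl | h
  · exact le_rfl
  · exact (add_inv_lt_add_inv (h1.trans h)
      ((inv_lt_one_of_one_lt₀ (h1.trans h)).trans h1) h).le

theorem two_le_add_inv {r : ℝ} (hr : 1 < r) : 2 ≤ r + r⁻¹ := by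
  have h0 : 0 < r := by linarith
  have e : r + r⁻¹ - 2 = (r - 1) ^ 2 / r := by field_simp; ring
  have : 0 ≤ (r - 1) ^ 2 / r := by positivity
  linarith

theorem mappedRegion_mono {T r R : ℝ} (h1 : 1 < r) (h2 : r ≤ R) :
    mappedRegion T r ⊆ mappedRegion T R := fun _ hx =>
  And.intro hx.1 (le_trans (show _ ≤ r + r⁻¹ from hx.2) (add_inv_le_add_inv h1 h2))

theorem ofReal_mem_mappedRegion {T ρ : ℝ} (hT : 1 < T) (hρ : 1 < ρ) {x : ℝ}
    (hx : x ∈ Set.Icc (-1 : ℝ) 1) : (x : ℂ) ∈ mappedRegion T ρ := by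
  refine ⟨?_, ?_⟩
  · rw [Complex.ofReal_re, abs_le]
    constructor <;> linarith [hx.1, hx.2]
  · change ‖m T x - 1‖ + ‖m T x + 1‖ ≤ ρ + ρ⁻¹
    obtain ⟨h1, h2⟩ := mReal_mem_Icc hT hx
    rw [m_ofReal hT, ← Complex.ofReal_one, ← Complex.ofReal_sub, ← Complex.ofReal_add,
      Complex.norm_real, Complex.norm_real, Real.norm_eq_abs, Real.norm_eq_abs,
      abs_of_nonpos (by linarith), abs_of_nonneg (by linarith)]
    have := two_le_add_inv hρ
    linarith

theorem node_mem_Icc {T : ℝ} (hT : 1 < T) {N : ℕ} {n : ℤ} (hn : n ∈ Finset.Icc (-(N : ℤ) - 1) N) :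
    node T N n ∈ Set.Icc (-1 : ℝ) 1 := by
  rw [Finset.mem_Icc] at hn
  rcases lt_or_ge n 0 with h | h
  · obtain ⟨k, rfl⟩ : ∃ k : ℕ, n = -k - 1 := ⟨(-n - 1).toNat, by omega⟩
    rw [node_neg_sub_one]
    obtain ⟨h1, h2, -⟩ := nodeAux_spec hT (by omega : k ≤ N)
    constructor <;> linarith
  · obtain ⟨k, rfl⟩ := Int.eq_ofNat_of_zero_le h
    rw [node_natCast]
    obtain ⟨h1, h2, -⟩ := nodeAux_spec hT (by omega : k ≤ N)
    constructor <;> linarith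

/-- Common form of the coefficient bounds for analytic functions. -/
theorem exists_norm_coeff_le {T ρs : ℝ} (hT : 1 < T) (hρs : 1 < ρs) : ∃ C : ℝ, 0 < C ∧
    ∀ f : ℂ → ℂ, DifferentiableOn ℂ f (interior (mappedRegion T ρs)) →
      ContinuousOn f (mappedRegion T ρs) → 0 ≤ maxOn T (min ρs (E T)) f ∧ ∀ N : ℕ,
      (∀ a, IsContinuousFECoeff T N (fun x : ℝ => f x) a → ‖a‖ ≤ C * maxOn T (min ρs (E T)) f *
        ∑ k ∈ Finset.range (N + 1), (E T / min ρs (E T)) ^ k) ∧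
      (∀ a, IsDiscreteFECoeff T N (fun x : ℝ => f x) a → ‖a‖ ≤ C * maxOn T (min ρs (E T)) f *
        ∑ k ∈ Finset.range (N + 1), (E T / min ρs (E T)) ^ k) := by
  have hE := one_lt_E hT
  have hE0 : 0 < E T := by linarith
  have hT0 : 0 < T := by linarith
  set ρ := min ρs (E T) with hρdef
  have hρ : 1 < ρ := lt_min hρs hE
  have hρ0 : 0 < ρ := by linarith
  have hρE : ρ ≤ E T := min_le_right _ _
  have hρρs : ρ ≤ ρs := min_le_left _ _
  obtain ⟨C₁, hC₁, happ⟩ := exists_approx hT hρ hρE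
  obtain ⟨C₂, hC₂, hcont⟩ := exists_norm_sub_le_of_continuous hT
  obtain ⟨C₃, hC₃, hdisc⟩ := exists_norm_sub_le_of_discrete hT
  refine ⟨2 * T * C₁ + 2 * C₁ + 2 * C₂ * C₁ + C₃ * C₁, by positivity, ?_⟩
  intro f hd hc
  set M := maxOn T ρ f with hMdef
  have hsub : mappedRegion T ρ ⊆ mappedRegion T ρs := mappedRegion_mono hρ hρρs
  have hbdd : BddAbove ((fun x => ‖f x‖) '' mappedRegion T ρ) :=
    ((isCompact_mappedRegion hT ρ).image_of_continuousOn (hc.mono hsub).norm).bddAbove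
  have hle : ∀ x ∈ mappedRegion T ρ, ‖f x‖ ≤ M := fun x hx => le_csSup hbdd ⟨x, hx, rfl⟩
  have hM0 : 0 ≤ M := (norm_nonneg _).trans
    (hle ((0 : ℝ) : ℂ) (ofReal_mem_mappedRegion hT hρ (by norm_num)))
  -- Used with R = ρs for differentiability of f and with R = ρ for the bound by its maximum on the
  -- smaller region.
  have hs : ∀ s : ℂ, (√ρ)⁻¹ < ‖s‖ → ‖s‖ < √ρ → ∀ R, ρ ≤ R →
      mInv T s ∈ interior (mappedRegion T R) := by
    intro s h1 h2 R hR
    have hsq : 0 < √ρ := Real.sqrt_pos.mpr hρ0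
    have hs0 : 0 < ‖s‖ := (inv_pos.mpr hsq).trans h1
    refine mInv_mem_interior hT (norm_pos_iff.mp hs0) (norm_zeta_lt hT
      ((inv_anti₀ hsq (Real.sqrt_le_sqrt hρE)).trans_lt h1)
      (h2.trans_le (Real.sqrt_le_sqrt hρE))) ?_
    refine lt_of_lt_of_le (add_inv_lt_add_inv hρ ?_ ?_) (add_inv_le_add_inv hρ hR)
    · have := pow_lt_pow_left₀ h1 (by positivity) two_ne_zero
      rwa [inv_pow, Real.sq_sqrt hρ0.le] at this
    · have := pow_lt_pow_left₀ h2 (by positivity) two_ne_zero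
      rwa [Real.sq_sqrt hρ0.le] at this
  refine ⟨hM0, fun N => ?_⟩
  obtain ⟨p, q, hp, hq, hpq, hsup⟩ := happ f M
    (fun s h1 h2 => (hd _ (hs s h1 h2 ρs hρρs)).differentiableAt
      (isOpen_interior.mem_nhds (hs s h1 h2 ρs hρρs)))
    (fun s h1 h2 => hle _ (interior_subset (hs s h1 h2 ρ le_rfl))) N
  set S := ∑ k ∈ Finset.range (N + 1), (E T / ρ) ^ k with hS
  have hS0 : 0 ≤ S := Finset.sum_nonneg fun _ _ => by positivity
  -- Approximation error times stability factor is the last term of the sum that already bounds the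
  -- competitor.
  have hSN : ρ⁻¹ ^ N * E T ^ N ≤ S := by
    have e : ρ⁻¹ ^ N * E T ^ N = (E T / ρ) ^ N := by rw [div_pow, inv_pow]; ring
    rw [e]
    exact Finset.single_le_sum (f := fun k => (E T / ρ) ^ k) (fun _ _ => by positivity)
      (Finset.self_mem_range_succ N)
  have hMS : 0 ≤ M * S := mul_nonneg hM0 hS0
  have hC1 : 0 ≤ C₁ * M * S := by positivity
  have hfc : ContinuousOn (fun x : ℝ => f x) (Set.Icc (-1 : ℝ) 1) :=
    hc.comp Complex.continuous_ofReal.continuousOn fun x hx => ofReal_mem_mappedRegion hT hρs hx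
  constructor
  · intro a ha
    obtain ⟨b, hb⟩ := exists_contSum_eq_ext hT N hp hq
    have hbn : ‖b‖ ≤ 2 * T * (C₁ * M * S) :=
      norm_le_of_contSum_le hT b hC1 fun x _ => by rw [hb]; exact hsup x
    have hl2 : l2Norm (fun x => f x - contSum T N b x) ≤ 2 * (C₁ * M * ρ⁻¹ ^ N) := by
      refine l2Norm_le_of_norm_le (hfc.sub (continuous_contSum T N b).continuousOn) fun x hx => ?_
      rw [hb]; exact hpq x hx
    have hab := hcont _ (memLp_of_continuousOn hfc) N a b ha
    have h2 : C₂ * l2Norm (fun x => f x - contSum T N b x) * E T ^ N ≤ 2 * C₂ * C₁ * (M * S) := by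
      calc _ ≤ C₂ * (2 * (C₁ * M * ρ⁻¹ ^ N)) * E T ^ N := by gcongr
        _ = 2 * C₂ * C₁ * M * (ρ⁻¹ ^ N * E T ^ N) := by ring
        _ ≤ 2 * C₂ * C₁ * M * S := by gcongr
        _ = _ := by ring
    have h3 : ‖a‖ ≤ ‖b‖ + ‖a - b‖ := by
      have := norm_add_le b (a - b)
      rwa [add_sub_cancel] at this
    have h4 : 0 ≤ (2 * C₁ + C₃ * C₁) * (M * S) := by positivity
    linarith
  · intro a ha
    obtain ⟨b, hb⟩ := exists_discSum_eq_ext hT N hp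
      (hq.trans (by exact_mod_cast Nat.lt_succ_self N))
    have hbn : ‖b‖ ≤ 2 * (C₁ * M * S) :=
      norm_le_of_discSum_le hT b hC1 fun x _ => by rw [hb]; exact hsup x
    have hab := hdisc _ N a b (C₁ * M * ρ⁻¹ ^ N) ha fun n hn => by
      rw [hb]; exact hpq _ (node_mem_Icc hT hn)
    have h2 : C₃ * (C₁ * M * ρ⁻¹ ^ N) * E T ^ N ≤ C₃ * C₁ * (M * S) := by
      calc _ = C₃ * C₁ * M * (ρ⁻¹ ^ N * E T ^ N) := by ring
        _ ≤ C₃ * C₁ * M * S := by gcongr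
        _ = _ := by ring
    have h3 : ‖a‖ ≤ ‖b‖ + ‖a - b‖ := by
      have := norm_add_le b (a - b)
      rwa [add_sub_cancel] at this
    have h4 : 0 ≤ (2 * T * C₁ + 2 * C₂ * C₁) * (M * S) := by positivity
    linarith

/-- If x < y the ratio exceeds 1 and the last term dominates. Otherwise every term is 1 and N + 1 ≤
2N, which is where N ≥ 1 is needed. -/
theorem exists_geom_sum_le {x y : ℝ} (hx : 1 < x) (hy : 1 < y) : ∃ G : ℝ, 0 < G ∧
    (x < y → ∀ N : ℕ, ∑ k ∈ Finset.range (N + 1), (y / min x y) ^ k ≤ G * (y / x) ^ N) ∧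
    (y ≤ x → ∀ N : ℕ, 1 ≤ N → ∑ k ∈ Finset.range (N + 1), (y / min x y) ^ k ≤ G * N) := by
  rcases lt_or_ge x y with h | h
  · have hr : 1 < y / x := (one_lt_div (by linarith)).mpr h
    have hr1 : 0 < y / x - 1 := by linarith
    refine ⟨(y / x) / (y / x - 1), by positivity, fun _ N => ?_, fun h' => absurd h' (not_le.mpr h)⟩
    rw [min_eq_left h.le, geom_sum_eq hr.ne', div_mul_eq_mul_div, ← pow_succ']
    gcongr
    linarith
  · refine ⟨2, by norm_num, fun h' => absurd h (not_le.mpr h'), fun _ N hN => ?_⟩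
    have hN' : (1 : ℝ) ≤ N := by exact_mod_cast hN
    rw [min_eq_right h, div_self (by linarith)]
    simp
    linarith

end FourierExtension

theorem theoremt (T : ℝ) (hT : 1 < T) :
    -- analytic functions: continuous and discrete Fourier extension
    (∀ ρs : ℝ, 1 < ρs → ∃ C : ℝ, 0 < C ∧ ∀ f : ℂ → ℂ,
      DifferentiableOn ℂ f (interior (FourierExtension.mappedRegion T ρs)) →
      ContinuousOn f (FourierExtension.mappedRegion T ρs) →
      ∀ N : ℕ,
        (∀ a : EuclideanSpace ℂ (Finset.Icc (-(N : ℤ)) N),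
          FourierExtension.IsContinuousFECoeff T N (fun x : ℝ => f x) a →
          (ρs < FourierExtension.E T → ‖a‖ ≤
            C * FourierExtension.maxOn T (min ρs (FourierExtension.E T)) f
              * (FourierExtension.E T / ρs) ^ N) ∧
          (FourierExtension.E T ≤ ρs → 1 ≤ N → ‖a‖ ≤
            C * FourierExtension.maxOn T (min ρs (FourierExtension.E T)) f * N)) ∧
        (∀ a : EuclideanSpace ℂ (Finset.Icc (-(N : ℤ) - 1) N),
          FourierExtension.IsDiscreteFECoeff T N (fun x : ℝ => f x) a →
          (ρs < FourierExtension.E T → ‖a‖ ≤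
            C * FourierExtension.maxOn T (min ρs (FourierExtension.E T)) f
              * (FourierExtension.E T / ρs) ^ N) ∧
          (FourierExtension.E T ≤ ρs → 1 ≤ N → ‖a‖ ≤
            C * FourierExtension.maxOn T (min ρs (FourierExtension.E T)) f * N))) ∧
    -- square-integrable functions: continuous Fourier extension
    (∃ C : ℝ, 0 < C ∧ ∀ f : ℝ → ℂ,
      MeasureTheory.MemLp f 2 (MeasureTheory.volume.restrict (Set.Ioo (-1 : ℝ) 1)) →
      ∀ (N : ℕ) (a : EuclideanSpace ℂ (Finset.Icc (-(N : ℤ)) N)),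
        FourierExtension.IsContinuousFECoeff T N f a →
        ‖a‖ ≤ C * FourierExtension.l2Norm f * FourierExtension.E T ^ N) := by
  constructor
  · intro ρs hρs
    obtain ⟨C, hC, hmain⟩ := FourierExtension.exists_norm_coeff_le hT hρs
    obtain ⟨G, hG, hlt, hge⟩ := FourierExtension.exists_geom_sum_le hρs
      (FourierExtension.one_lt_E hT)
    refine ⟨C * G, by positivity, fun f hd hc N => ?_⟩
    obtain ⟨hM, hbound⟩ := hmain f hd hc
    obtain ⟨h1, h2⟩ := hbound N
    have hCM := mul_nonneg hC.le hM
    have key : ∀ {A S B : ℝ}, A ≤ C * FourierExtension.maxOn T (min ρs (FourierExtension.E T)) f * S →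
        S ≤ G * B →
        A ≤ C * G * FourierExtension.maxOn T (min ρs (FourierExtension.E T)) f * B :=
      fun hA hS => hA.trans ((mul_le_mul_of_nonneg_left hS hCM).trans (le_of_eq (by ring)))
    exact ⟨fun a ha => ⟨fun h => key (h1 a ha) (hlt h N), fun h hN => key (h1 a ha) (hge h N hN)⟩,
      fun a ha => ⟨fun h => key (h2 a ha) (hlt h N), fun h hN => key (h2 a ha) (hge h N hN)⟩⟩
  · obtain ⟨C, hC, hmain⟩ := FourierExtension.exists_norm_sub_le_of_continuous hT
    refine ⟨C, hC, fun f hf N a ha => ?_⟩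
    -- The competitor 0 has residual f.
    have h := hmain f hf N a 0 ha
    simpa [FourierExtension.contSum] using h
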